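/- A *branch decomposition* of a finite simple undirected graph $G$ is a pair $(T,\delta)$ of a tree $T$ of maximum degree at most $3$ and a bijection $\delta$ from the leaves of $T$ to $V(G)$ (the node of a one-node tree counts as a leaf). Every edge $e$ of $T$ induces the cut $(A,\overline A)$ of $G$, where $\overline A = V(G)\setminus A$ and $A$, $\overline A$ are the images under $\delta$ of the leaves in the two components of $T-e$. A cut $(A,\overline A)$ is a *split* if $|A|,|\overline A|\ge 2$ and all vertices of $A$ that have a neighbour in $\overline A$ have the same neighbourhood in $\overline A$. Let $\operatorname{sm}(A)=1$ if $(A,\overline A)$ is a split, and otherwise let $\operatorname{sm}(A)$ be the maximum size of a matching consisting of edges of $G$ between $A$ and $\overline A$. The *sm-width* of $(T,\delta)$ is the maximum of $\operatorname{sm}(A)$ over all cuts $(A,\overline A)$ induced by the edges of $T$ (and $0$ if $T$ has no edge). **Theorem.** Given a graph $G$ and a branch decomposition $(T,\delta)$ of $G$ of sm-width $k$, MaxCut can be solved in time $\mathcal{O}^*(8^k)$. That is, there are a random access machine program and a constant $c$ such that, for every graph $G$ with $n$ vertices and every branch decomposition $(T,\delta)$ of $G$ with $m$ nodes and of sm-width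 $k$, the program on input $(G,T,\delta)$ halts after at most $c\cdot 8^k\cdot (n+m)^c$ steps and outputs a set $W\subseteq V(G)$ that maximizes the number of edges of $G$ between $W$ and $V(G)\setminus W$, together with this number. -/

import Mathlib

namespace SMWidth

section Graphs

variable {V N : Type*}

/-- `(A, V ∖ A)` is a split of `G`: both sides have at least two vertices, and all vertices of `A`
that have a neighbour outside `A` have the same neighbourhood outside `A`. -/
def IsSplit (G : SimpleGraph V) (A : Set V) : Prop :=
  2 ≤ A.ncard ∧ 2 ≤ Aᶜ.ncard ∧
    ∀ u ∈ A, ∀ v ∈ A, (G.neighborSet u ∩ Aᶜ).Nonempty → (G.neighborSet v ∩ Aᶜ).Nonempty →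
      G.neighborSet u ∩ Aᶜ = G.neighborSet v ∩ Aᶜ

/-- The maximum number of edges of a matching of the bipartite graph `G[A, V ∖ A]`. -/
noncomputable def mm (G : SimpleGraph V) (A : Set V) : ℕ :=
  sSup {r | ∃ M : (G.between A Aᶜ).Subgraph, M.IsMatching ∧ M.edgeSet.ncard = r}

open Classical in
/-- The split-matching cut function. -/
noncomputable def sm (G : SimpleGraph V) (A : Set V) : ℕ :=
  if IsSplit G A then 1 else mm G A

/-- The number of edges of `G` with one endpoint in `W` and the other one outside `W`. -/
noncomputable def cutSize (G : SimpleGraph V) (W : Set V) : ℕ :=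
  (G.between W Wᶜ).edgeSet.ncard

/-- `W` is a maximum cut of `G`. -/
def IsMaxCut (G : SimpleGraph V) (W : Set V) : Prop :=
  ∀ W' : Set V, cutSize G W' ≤ cutSize G W

/-- A branch decomposition `(T, δ)` of a graph with vertex set `V`: a tree `T` (with node set `N`)
of maximum degree at most three and a bijection `δ` from the leaves of `T` to `V`.
The single node of a one-node tree counts as a leaf. -/
structure BranchDecomposition (V N : Type*) where
  tree : SimpleGraph N
  isTree : tree.IsTree
  subcubic : ∀ x, (tree.neighborSet x).encard ≤ 3
  δ : {x : N // (tree.neighborSet x).encard ≤ 1} ≃ V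

namespace BranchDecomposition

/-- The vertices mapped by `δ` from the leaves in the component of `x` in `T - xy`. -/
def side (D : BranchDecomposition V N) (x y : N) : Set V :=
  {v | (D.tree.deleteEdges {s(x, y)}).Reachable x (D.δ.symm v : N)}

/-- The sm-width: the maximum of `sm` over all cuts induced by the edges of `T`
(it is `0` if `T` has no edge). -/
noncomputable def smWidth (D : BranchDecomposition V N) (G : SimpleGraph V) : ℕ :=
  sSup {r | ∃ x y : N, D.tree.Adj x y ∧ r = sm G (D.side x y)}

end BranchDecomposition

end Graphs

/-! ### Random access machine

The machine has registers and a memory, both indexed by `ℕ` and holding natural numbers. A program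
names finitely many registers; memory is accessed indirectly. Every instruction and every test
costs one time unit. The only arithmetic is successor and predecessor, so that in `t` steps no
number grows by more than `t` beyond the input and the constants of the program: unit cost does not
hide any computation on long numbers, and the time bounds hold a fortiori for a machine with a
larger instruction set. -/

namespace RAM

structure State where
  reg : ℕ → ℕ
  mem : ℕ → ℕ

inductive Test where
  /-- `Rᵢ = Rⱼ` -/
  | eq (i j : ℕ)
  /-- `Rᵢ < Rⱼ` -/
  | lt (i j : ℕ)

def Test.Holds (s : State) : Test → Prop
  | .eq i j => s.reg i = s.reg j
  | .lt i j => s.reg i < s.reg j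

inductive Instr where
  /-- `Rᵢ := c` -/
  | const (i c : ℕ)
  /-- `Rᵢ := Rⱼ` -/
  | copy (i j : ℕ)
  /-- `Rᵢ := Rᵢ + 1` -/
  | succ (i : ℕ)
  /-- `Rᵢ := max (Rᵢ - 1) 0` -/
  | pred (i : ℕ)
  /-- `Rᵢ := M[Rⱼ]` -/
  | load (i j : ℕ)
  /-- `M[Rᵢ] := Rⱼ` -/
  | store (i j : ℕ)

def Instr.apply (s : State) : Instr → State
  | .const i c => { s with reg := Function.update s.reg i c }
  | .copy i j => { s with reg := Function.update s.reg i (s.reg j) }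
  | .succ i => { s with reg := Function.update s.reg i (s.reg i + 1) }
  | .pred i => { s with reg := Function.update s.reg i (s.reg i - 1) }
  | .load i j => { s with reg := Function.update s.reg i (s.mem (s.reg j)) }
  | .store i j => { s with mem := Function.update s.mem (s.reg i) (s.reg j) }

inductive Program where
  | instr (a : Instr)
  | seq (p q : Program)
  | ite (b : Test) (p q : Program)
  | whileDo (b : Test) (p : Program)

/-- `Exec p s s' t`: started in state `s`, the program `p` halts after exactly `t` steps in
state `s'`. -/
inductive Exec : Program → State → State → ℕ → Prop where
  | instr (a : Instr) (s : State) : Exec (.instr a) s (a.apply s) 1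
  | seq {p q : Program} {s s' s'' : State} {t t' : ℕ} :
      Exec p s s' t → Exec q s' s'' t' → Exec (.seq p q) s s'' (t + t')
  | ite_true {b : Test} {p q : Program} {s s' : State} {t : ℕ} :
      b.Holds s → Exec p s s' t → Exec (.ite b p q) s s' (t + 1)
  | ite_false {b : Test} {p q : Program} {s s' : State} {t : ℕ} :
      ¬ b.Holds s → Exec q s s' t → Exec (.ite b p q) s s' (t + 1)
  | while_true {b : Test} {p : Program} {s s' s'' : State} {t t' : ℕ} :
      b.Holds s → Exec p s s' t → Exec (.whileDo b p) s' s'' t' →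
        Exec (.whileDo b p) s s'' (t + t' + 1)
  | while_false {b : Test} {p : Program} {s : State} :
      ¬ b.Holds s → Exec (.whileDo b p) s s 1

/-- The initial state on input `l`: the input is in the memory cells `0, …, |l| - 1`, its length is
in register `0`, and everything else is zero. -/
def State.init (l : List ℕ) : State where
  reg := fun i => if i = 0 then l.length else 0
  mem := fun i => l.getD i 0

/-- The list `l` is in the memory cells `0, …, |l| - 1`. -/
def State.HasOutput (s : State) (l : List ℕ) : Prop :=
  ∀ (i : ℕ) (h : i < l.length), s.mem i = l[i]

/-- On input `l`, the program `p` halts within `T` steps with an output in `Out`. -/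
def Program.RunsInTime (p : Program) (l : List ℕ) (Out : Set (List ℕ)) (T : ℕ) : Prop :=
  ∃ (s : State) (t : ℕ), Exec p (State.init l) s t ∧ t ≤ T ∧ ∃ o ∈ Out, s.HasOutput o

end RAM

section Encoding

open Classical in
/-- The adjacency matrix of a graph, row by row. -/
noncomputable def encodeGraph {n : ℕ} (G : SimpleGraph (Fin n)) : List ℕ :=
  (List.finRange n).flatMap fun i => (List.finRange n).map fun j => if G.Adj i j then 1 else 0

/-- The input: the numbers `n` and `m`, the adjacency matrices of `G` and of `T`, and for every
vertex of `G` the leaf of `T` that `δ` maps to it. -/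
noncomputable def encodeInput {n m : ℕ} (G : SimpleGraph (Fin n))
    (D : BranchDecomposition (Fin n) (Fin m)) : List ℕ :=
  [n, m] ++ encodeGraph G ++ encodeGraph D.tree ++
    (List.finRange n).map fun v => ((D.δ.symm v : Fin m) : ℕ)

open Classical in
/-- The output describing `W`: its characteristic vector followed by the size of its cut. -/
noncomputable def encodeCut {n : ℕ} (G : SimpleGraph (Fin n)) (W : Set (Fin n)) : List ℕ :=
  ((List.finRange n).map fun v => if v ∈ W then 1 else 0) ++ [cutSize G W]

end Encoding

end SMWidth

set_option linter.constructorNameAsVariable false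

/-! Root `T` at the leaf of a vertex `v₀` and do dynamic programming from the leaves upwards. Let
`A` be the set of vertices below an edge of `T`, and `C` a minimum vertex cover of the bipartite
graph between `A` and its complement. A labelling `L` (one side of a cut of `G`) is judged at `A` by
`partialCut`, the number of cut edges inside `A` or between `A` and `C \ A`. The rest of `G` sees `L
∩ A` only through the state of `L` (`SameState`): how many neighbours in `L ∩ A` each vertex outside
`A ∪ C` has, and how many neighbours in `L ∩ (C \ A)` each vertex of `A` has. The table of `A`
stores, for each state, a labelling of maximum `partialCut`.

Tables are small. The state is determined by `L ∩ C` (`IsCover.sameState`), so there are at most `2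
^ |C|` states, and `|C|` is at most the matching number by König's argument
(`IsCanonical.card_le_mm`). At a split the cover may be large, but the frontiers of the two sides
are completely joined, so only the number of labels in the smaller frontier matters
(`IsRankOne.sameState`) and `n + 1` states suffice. The program tests for this rank-one property
rather than for being a split. In all cases a table has at most `(n + 1) * 2 ^ k` records.

Tables of nested cuts `B ⊆ A` fit together only if the edges already counted at `B` are also counted
at `A`, that is, if the cover `E` of `B` satisfies `E \ A ⊆ C`. Arbitrary minimum covers need not
satisfy this. Those with as few vertices as possible outside the set (`IsCanonical`) do, by a
Hall-type counting argument (`IsCanonical.compat`). Then `partialCut` at `A` equals `partialCut` at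
`B` plus terms that depend only on the state at `B` and on the labels off `B`, so the restriction of
a labelling to `B` may be exchanged for a table entry (`SameState.exchange`). One exchange per child
shows that an optimal labelling for every state of `A` arises by merging a record of each child
(`table_complete`). At the root `A` is everything, `C` is empty, and the single record is a maximum
cut among the labellings avoiding `v₀`, which is enough because a cut may be complemented.

Trying all pairs of records for every state costs `2 ^ k * 2 ^ k * 2 ^ k = 8 ^ k` up to a polynomial
factor (`table_bound`). The covers are found by branching on uncovered edges, over at most `2 ^ k`
bit vectors.

The algorithm is written in a small imperative language with an explicit cost, which is compiled to
the machine by `Cmd.code_spec`. As the machine has only successor and predecessor, arithmetic is cut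
off at the input length `P`, which makes each operation polynomial. The tables, which are
exponentially long, live on a tape that is only scanned sequentially, so that no long address is
ever computed. -/

namespace SMWidth

/-! ### Total correctness with time bounds for the random access machine -/

namespace RAM

/-- Started in `s`, the program `p` halts within `T` steps in a state satisfying `Q`. -/
def Ex (p : Program) (s : State) (T : ℕ) (Q : State → Prop) : Prop :=
  ∃ (s' : State) (t : ℕ), Exec p s s' t ∧ t ≤ T ∧ Q s'

theorem Ex.mono {p : Program} {s : State} {T T' : ℕ} {Q Q' : State → Prop} (h : Ex p s T Q)
    (hT : T ≤ T') (hQ : ∀ s', Q s' → Q' s') : Ex p s T' Q' := by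
  obtain ⟨s', t, h1, h2, h3⟩ := h
  exact ⟨s', t, h1, h2.trans hT, hQ _ h3⟩

theorem Ex.instr {a : Instr} {s : State} {Q : State → Prop} (h : Q (a.apply s)) :
    Ex (.instr a) s 1 Q :=
  ⟨_, _, .instr a s, le_rfl, h⟩

theorem Ex.seq {p q : Program} {s : State} {T T' : ℕ} {R Q : State → Prop} (h : Ex p s T R)
    (h' : ∀ s', R s' → Ex q s' T' Q) : Ex (.seq p q) s (T + T') Q := by
  obtain ⟨s', t, h1, h2, h3⟩ := h
  obtain ⟨s'', t', h1', h2', h3'⟩ := h' _ h3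
  exact ⟨_, _, .seq h1 h1', add_le_add h2 h2', h3'⟩

theorem Ex.ite {b : Test} {p q : Program} {s : State} {T : ℕ} {Q : State → Prop}
    (hp : b.Holds s → Ex p s T Q) (hq : ¬ b.Holds s → Ex q s T Q) :
    Ex (.ite b p q) s (T + 1) Q := by
  by_cases hb : b.Holds s
  · obtain ⟨s', t, h1, h2, h3⟩ := hp hb
    exact ⟨_, _, .ite_true hb h1, by omega, h3⟩
  · obtain ⟨s', t, h1, h2, h3⟩ := hq hb
    exact ⟨_, _, .ite_false hb h1, by omega, h3⟩

/-- The invariant is indexed by the value of the counter, so termination and running time come with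
it: one test per round and a final failing test. -/
theorem Ex.while_lt {body : Program} {c b k : ℕ} (I : ℕ → State → Prop) (T : ℕ → ℕ)
    (hreg : ∀ i s, I i s → s.reg c = i ∧ s.reg b = k)
    (hstep : ∀ i, i < k → ∀ s, I i s → Ex body s (T i) (I (i + 1))) {s : State} (h0 : I 0 s) :
    Ex (.whileDo (.lt c b) body) s (∑ i ∈ Finset.range k, (T i + 1) + 1) (I k) := by
  -- Induction on the number `j` of remaining rounds.
  have key : ∀ j i, i + j = k → ∀ s, I i s →
      Ex (.whileDo (.lt c b) body) s (∑ l ∈ Finset.Ico i k, (T l + 1) + 1) (I k) := by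
    intro j
    induction j with
    | zero =>
      intro i hi s hs
      obtain rfl : i = k := by omega
      refine ⟨s, 1, .while_false ?_, by simp, hs⟩
      simp [Test.Holds, hreg _ _ hs]
    | succ j ih =>
      intro i hi s hs
      obtain ⟨s', t, h1, h2, h3⟩ := hstep i (by omega) s hs
      obtain ⟨s'', t', h1', h2', h3'⟩ := ih (i + 1) (by omega) s' h3
      refine ⟨s'', _, .while_true ?_ h1 h1', ?_, h3'⟩
      · simp only [Test.Holds, hreg _ _ hs]; omega
      · rw [Finset.sum_eq_sum_Ico_succ_bot (by omega)]; omega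
  rw [Finset.range_eq_Ico]
  exact key k 0 (by omega) s h0

end RAM

/-! ### An imperative language with variables and arrays -/

namespace Imp

/-- The variables of the language. -/
inductive Var
  | n | m | tO | dO | r | R | x | y | z | c1 | c2 | u | v | w | i | j | rnd | d | a | b | rk | found
  | K | e | e2 | out | fail | o | ns | cv | bv | id1 | id2 | tmp | ok | j1 | j2 | carry
deriving DecidableEq

/-- The arrays of the language. -/
inductive Arr
  | top | dead | inA | fr | inC | bt | mk | cov | s | best | l1 | l2 | L
deriving DecidableEq

/-- The states: `P` is the length of the input, which bounds the arithmetic; `io` is the array that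
holds the input and the output, and `tab` is a tape that is accessed by the heads `cur`. -/
structure Store where
  P : ℕ
  var : Var → ℕ
  arr : Arr → ℕ → ℕ
  io : ℕ → ℕ
  tab : ℕ → ℕ
  cur : Fin 3 → ℕ

namespace Store

def setVar (h : Store) (x : Var) (k : ℕ) : Store :=
  { h with var := Function.update h.var x k }

def setArr (h : Store) (a : Arr) (i k : ℕ) : Store :=
  { h with arr := Function.update h.arr a (Function.update (h.arr a) i k) }

end Store

/-- First summands and comparisons are not cut off at `P` in the semantics, since counts of states
and of records can be exponentially large. Everything that costs a loop on the machine is. -/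
inductive Exp
  | lit (c : ℕ)
  | var (x : Var)
  | add (a b : Exp)
  | mul (a b : Exp)
  | arr (a : Arr) (i : Exp)
  | io (i : Exp)

/-- The value of an expression. Factors, second summands and array indices are cut off at `P`. -/
def Exp.eval (h : Store) : Exp → ℕ
  | .lit c => c
  | .var x => h.var x
  | .add a b => a.eval h + min (b.eval h) h.P
  | .mul a b => min (a.eval h) h.P * min (b.eval h) h.P
  | .arr a i => h.arr a (min (i.eval h) h.P)
  | .io i => if i.eval h < h.P then h.io (i.eval h) else 0

/-- Upper bounds for the compiled code: addition is a loop of at most `P` successors, multiplication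
a loop of at most `P` additions, and an array access multiplies its index by the stride 32 of the
memory layout. -/
def Exp.cost (P : ℕ) : Exp → ℕ
  | .lit _ => 1
  | .var _ => 1
  | .add a b => a.cost P + b.cost P + (4 * P + 4)
  | .mul a b => a.cost P + b.cost P + (P * (4 * P + 4) + 8)
  | .arr _ i => i.cost P + (35 * P + 40)
  | .io i => i.cost P + 2

inductive Cond
  | eq (a b : Exp)
  | lt (a b : Exp)
  | and (a b : Cond)
  | or (a b : Cond)
  | not (a : Cond)

def Cond.eval (h : Store) : Cond → Bool
  | .eq a b => a.eval h == b.eval h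
  | .lt a b => decide (a.eval h < b.eval h)
  | .and a b => a.eval h && b.eval h
  | .or a b => a.eval h || b.eval h
  | .not a => !a.eval h

def Cond.cost (P : ℕ) : Cond → ℕ
  | .eq a b => a.cost P + b.cost P + 1
  | .lt a b => a.cost P + b.cost P + 1
  | .and a b => a.cost P + b.cost P
  | .or a b => a.cost P + b.cost P
  | .not a => a.cost P

/-- The exponential part of the running time can only come from `bigLoop`. The tape is accessed
through heads that move one step at a time, so its exponentially large addresses are never computed
from indices. -/
inductive Cmd
  | skip
  | assign (x : Var) (e : Exp)
  | store (a : Arr) (i e : Exp)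
  | put (i e : Exp)
  | seq (c d : Cmd)
  | ite (b : Cond) (c d : Cmd)
  /-- repeat `c` for `x = 0, …, min e P - 1` -/
  | loop (x : Var) (e : Exp) (c : Cmd)
  /-- repeat `c` for `x = 0, …, e - 1` -/
  | bigLoop (x : Var) (e : Exp) (c : Cmd)
  | rewind (p : Fin 3)
  | read (p : Fin 3) (x : Var)
  /-- write `e` at the position of head `0` and move the head -/
  | append (e : Exp)

/-- `k`-fold iteration of `f 0, f 1, …`. -/
def iter {α : Type*} (f : ℕ → α → α) (h : α) : ℕ → α
  | 0 => h
  | k + 1 => f k (iter f h k)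

namespace Cmd

def run : Cmd → Store → Store
  | .skip, h => h
  | .assign x e, h => h.setVar x (e.eval h)
  | .store a i e, h => h.setArr a (min (i.eval h) h.P) (e.eval h)
  | .put i e, h =>
      if i.eval h < h.P then { h with io := Function.update h.io (i.eval h) (e.eval h) } else h
  | .seq c d, h => d.run (c.run h)
  | .ite b c d, h => if b.eval h then c.run h else d.run h
  | .loop x e c, h => iter (fun i h' => c.run (h'.setVar x i)) h (min (e.eval h) h.P)
  | .bigLoop x e c, h => iter (fun i h' => c.run (h'.setVar x i)) h (e.eval h)
  | .rewind p, h => { h with cur := Function.update h.cur p 0 }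
  | .read p x, h =>
      { h.setVar x (h.tab (h.cur p)) with cur := Function.update h.cur p (h.cur p + 1) }
  | .append e, h =>
      { h with
        tab := Function.update h.tab (h.cur 0) (e.eval h)
        cur := Function.update h.cur 0 (h.cur 0 + 1) }

/-- The state before round `i` of a loop over `x` with body `c`. -/
def at_ (c : Cmd) (x : Var) (h : Store) (i : ℕ) : Store :=
  iter (fun i h' => c.run (h'.setVar x i)) h i

def cost : Cmd → Store → ℕ
  | .skip, _ => 1
  | .assign _ e, h => e.cost h.P + 1
  | .store _ i e, h => i.cost h.P + e.cost h.P + (35 * h.P + 40)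
  | .put i e, h => i.cost h.P + e.cost h.P + 2
  | .seq c d, h => c.cost h + d.cost (c.run h)
  | .ite b c d, h => b.cost h.P + (if b.eval h then c.cost h else d.cost h)
  | .loop x e c, h => e.cost h.P +
      (∑ i ∈ Finset.range (min (e.eval h) h.P), (c.cost ((c.at_ x h i).setVar x i) + 3) + 4)
  | .bigLoop x e c, h => e.cost h.P +
      (∑ i ∈ Finset.range (e.eval h), (c.cost ((c.at_ x h i).setVar x i) + 3) + 4)
  | .rewind _, _ => 1
  | .read _ _, _ => 3
  | .append e, h => e.cost h.P + 3

end Cmd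

/-! ### Compilation to the random access machine -/

open RAM

/-- Register `0` keeps `P`; the residues modulo 3 separate the variables, the tape heads and the
temporary registers. -/
def vreg (x : Var) : ℕ := 3 * x.ctorIdx + 1
def creg (p : Fin 3) : ℕ := 3 * p + 2
def treg (d : ℕ) : ℕ := 3 * d + 3

theorem vreg_inj {x y : Var} : vreg x = vreg y ↔ x = y := by
  refine ⟨fun h => ?_, fun h => h ▸ rfl⟩
  have : x.ctorIdx = y.ctorIdx := by unfold vreg at h; omega
  rw [← Var.ofNat_ctorIdx x, this, Var.ofNat_ctorIdx]

theorem arrIdx_inj {x y : Arr} (h : x.ctorIdx = y.ctorIdx) : x = y := by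
  rw [← Arr.ofNat_ctorIdx x, h, Arr.ofNat_ctorIdx]

/-- The bound 16 is half the stride 32 of `acell`. The input lies below `P`, tape cells have even
and array cells odd offsets from `P`, and the entries with index `i` of all arrays share a block of
32 cells. -/
theorem arrIdx_lt (x : Arr) : x.ctorIdx < 16 := by cases x <;> decide

/-- The memory cell of an array entry. -/
def acell (P : ℕ) (a : Arr) (i : ℕ) : ℕ := P + 32 * i + (2 * a.ctorIdx + 1)

theorem acell_inj {P : ℕ} {a b : Arr} {i j : ℕ} : acell P a i = acell P b j ↔ a = b ∧ i = j := by
  constructor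
  · intro h
    have h1 := arrIdx_lt a
    have h2 := arrIdx_lt b
    unfold acell at h
    obtain rfl : i = j := by omega
    exact ⟨arrIdx_inj (by omega), rfl⟩
  · rintro ⟨rfl, rfl⟩; rfl

/-- The machine state `s` represents the store `h`. -/
structure Rel (h : Store) (s : State) : Prop where
  P : s.reg 0 = h.P
  var : ∀ x, s.reg (vreg x) = h.var x
  cur : ∀ p, s.reg (creg p) = h.P + 2 * h.cur p
  io : ∀ i, i < h.P → s.mem i = h.io i
  tab : ∀ i, s.mem (h.P + 2 * i) = h.tab i
  arr : ∀ a i, s.mem (acell h.P a i) = h.arr a i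

/-- `s` and `s'` agree on the temporary registers below `d`. -/
def Keep (d : ℕ) (s s' : State) : Prop := ∀ d', d' < d → s'.reg (treg d') = s.reg (treg d')

theorem Keep.refl {d : ℕ} {s : State} : Keep d s s := fun _ _ => rfl

theorem Keep.trans {d : ℕ} {s s' s'' : State} (h : Keep d s s') (h' : Keep d s' s'') :
    Keep d s s'' := fun d' hd => (h' d' hd).trans (h d' hd)

theorem Keep.mono {d e : ℕ} {s s' : State} (h : Keep e s s') (hd : d ≤ e) : Keep d s s' :=
  fun d' hd' => h d' (hd'.trans_le hd)

/-- `s` with the temporary register `d` set to `k`. -/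
def setT (s : State) (d k : ℕ) : State := { s with reg := Function.update s.reg (treg d) k }

@[simp] theorem setT_reg_self (s : State) (d k : ℕ) : (setT s d k).reg (treg d) = k := by
  simp [setT]

theorem setT_reg_treg (s : State) (d d' k : ℕ) :
    (setT s d k).reg (treg d') = if d' = d then k else s.reg (treg d') := by
  simp [setT, Function.update_apply, treg]

theorem setT_reg_ne (s : State) {d k i : ℕ} (h : i ≠ treg d) : (setT s d k).reg i = s.reg i := by
  simp [setT, h]

@[simp] theorem setT_reg_vreg (s : State) (d k : ℕ) (x : Var) :
    (setT s d k).reg (vreg x) = s.reg (vreg x) :=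
  setT_reg_ne s (by unfold vreg treg; omega)

@[simp] theorem setT_reg_creg (s : State) (d k : ℕ) (p : Fin 3) :
    (setT s d k).reg (creg p) = s.reg (creg p) :=
  setT_reg_ne s (by unfold creg treg; omega)

@[simp] theorem setT_reg_zero (s : State) (d k : ℕ) : (setT s d k).reg 0 = s.reg 0 :=
  setT_reg_ne s (by unfold treg; omega)

theorem Rel.setT {h : Store} {s : State} (H : Rel h s) (d k : ℕ) : Rel h (setT s d k) where
  P := by simp [H.P]
  var x := by simp [H.var]
  cur p := by simp [H.cur]
  io := H.io
  tab := H.tab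
  arr := H.arr

theorem Keep.setT {d e k : ℕ} {s s' : State} (h : Keep d s s') (hd : d ≤ e) :
    Keep d s (setT s' e k) := fun d' hd' => by
  rw [setT_reg_treg, if_neg (by omega), h d' hd']

theorem Rel.setVar {h : Store} {s : State} (H : Rel h s) (x : Var) (k : ℕ) :
    Rel (h.setVar x k) { s with reg := Function.update s.reg (vreg x) k } where
  P := by
    exact (Function.update_of_ne (show 0 ≠ vreg x by unfold vreg; omega) k s.reg).trans H.P
  var y := by
    simp only [Function.update_apply, vreg_inj, Store.setVar, H.var]
  cur p := by
    simp only [Function.update_apply, Store.setVar, H.cur]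
    rw [if_neg (by unfold vreg creg; omega)]
  io := H.io
  tab := H.tab
  arr := H.arr

theorem keep_setVar (d : ℕ) (s : State) (x : Var) (k : ℕ) :
    Keep d s { s with reg := Function.update s.reg (vreg x) k } := fun d' _ => by
  exact Function.update_of_ne (by unfold treg vreg; omega) _ _

theorem Rel.setArr {h : Store} {s : State} (H : Rel h s) (a : Arr) (i k : ℕ) :
    Rel (h.setArr a i k) { s with mem := Function.update s.mem (acell h.P a i) k } where
  P := H.P
  var := H.var
  cur := H.cur
  io j hj := by
    have : j < h.P := hj
    show Function.update s.mem _ k j = _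
    rw [Function.update_of_ne (by unfold acell; omega), H.io j hj]; rfl
  tab j := by
    show Function.update s.mem _ k (h.P + 2 * j) = _
    rw [Function.update_of_ne (by unfold acell; omega), H.tab j]; rfl
  arr b j := by
    show Function.update s.mem _ k (acell h.P b j) =
      Function.update h.arr a (Function.update (h.arr a) i k) b j
    simp only [Function.update_apply, acell_inj]
    split_ifs with h1 h2 h2
    · simp [h1.2]
    · exact absurd h1.1 h2
    · subst h2
      rw [H.arr, Function.update_of_ne (fun h3 => h1 ⟨rfl, h3⟩)]
    · exact H.arr b j

/-! #### Macros on temporary registers -/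

def clampT (d : ℕ) : Program :=
  .ite (.lt 0 (treg d)) (.instr (.copy (treg d) 0)) (.instr (.copy (treg d) (treg d)))

theorem clampT_spec {h : Store} {s : State} (H : Rel h s) (d : ℕ) :
    Ex (clampT d) s 2 (fun s' => s' = setT s d (min (s.reg (treg d)) h.P)) := by
  refine Ex.ite (fun hb => Ex.instr ?_) (fun hb => Ex.instr ?_)
  · have hb : s.reg 0 < s.reg (treg d) := hb
    rw [H.P] at hb
    simp only [Instr.apply, setT, H.P, min_eq_right hb.le]
  · have hb : ¬ s.reg 0 < s.reg (treg d) := hb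
    rw [H.P, not_lt] at hb
    simp only [Instr.apply, setT, min_eq_left hb]

/-- Increase register `i` by `k`. -/
def succs (i : ℕ) : ℕ → Program
  | 0 => .instr (.copy i i)
  | k + 1 => .seq (.instr (.succ i)) (succs i k)

theorem succs_spec (i k : ℕ) (s : State) :
    Ex (succs i k) s (k + 1)
      (fun s' => s' = { s with reg := Function.update s.reg i (s.reg i + k) }) := by
  induction k generalizing s with
  | zero => exact Ex.instr (by simp [Instr.apply])
  | succ k ih =>
    rw [show k + 1 + 1 = 1 + (k + 1) by ring]
    refine Ex.seq (Ex.instr rfl) ?_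
    rintro _ rfl
    refine (ih _).mono le_rfl ?_
    rintro _ rfl
    simp [Instr.apply, add_assoc, add_comm 1 k]

/-- Increase the temporary register `a` by `k` times the temporary register `b`. -/
def addMulT (a b c k : ℕ) : Program :=
  .seq (.instr (.const (treg c) 0))
    (.whileDo (.lt (treg c) (treg b)) (.seq (succs (treg a) k) (.instr (.succ (treg c)))))

theorem addMulT_spec {a b c k : ℕ} (hab : a ≠ b) (hac : a ≠ c) (hbc : b ≠ c) (s : State) :
    Ex (addMulT a b c k) s (1 + ((k + 3) * s.reg (treg b) + 1))
      (fun s' => s' = setT (setT s c (s.reg (treg b))) a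
        (s.reg (treg a) + k * s.reg (treg b))) := by
  refine Ex.seq (Ex.instr rfl) ?_
  rintro _ rfl
  have := Ex.while_lt (body := .seq (succs (treg a) k) (.instr (.succ (treg c)))) (c := treg c)
    (b := treg b) (k := s.reg (treg b))
    (fun i s' => s' = setT (setT s c i) a (s.reg (treg a) + k * i)) (fun _ => (k + 1) + 1)
    (by
      rintro i _ rfl
      simp [setT_reg_treg, hac.symm, hab.symm, hbc])
    (by
      rintro i hi _ rfl
      refine Ex.seq (succs_spec _ _ _) ?_
      rintro _ rfl
      refine Ex.instr ?_
      have h1 : treg c ≠ treg a := by unfold treg; omega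
      simp only [Instr.apply, setT, Function.update_self, Function.update_of_ne h1]
      congr 1
      funext l
      simp only [Function.update_apply]
      split_ifs with h2 h3 <;> simp_all
      ring)
    (s := setT s c 0) (by
      simp only [Nat.mul_zero, Nat.add_zero]
      unfold setT
      congr 1
      funext l
      simp only [Function.update_apply]
      have h1 : treg c ≠ treg a := by unfold treg; omega
      split_ifs with h2 h3 <;> simp_all)
  refine this.mono ?_ (fun _ h => h)
  simp [Finset.sum_const, mul_comm]

/-! #### Expressions -/

def addrT (a : Arr) (d : ℕ) : Program :=
  .seq (clampT d) (.seq (.instr (.copy (treg (d + 1)) 0))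
    (.seq (addMulT (d + 1) d (d + 2) 32) (succs (treg (d + 1)) (2 * a.ctorIdx + 1))))

theorem addrT_spec {h : Store} {s : State} (H : Rel h s) (a : Arr) (d : ℕ) :
    Ex (addrT a d) s (35 * h.P + 38) (fun s' => Rel h s' ∧ Keep d s s' ∧
      s'.reg (treg (d + 1)) = acell h.P a (min (s.reg (treg d)) h.P)) := by
  have e : 2 + (1 + ((1 + ((32 + 3) * min (s.reg (treg d)) h.P + 1)) +
      (2 * a.ctorIdx + 1 + 1))) ≤ 35 * h.P + 38 := by
    have := arrIdx_lt a
    have : min (s.reg (treg d)) h.P ≤ h.P := min_le_right _ _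
    have : a.ctorIdx ≤ 15 := by omega
    omega
  refine Ex.mono ?_ e (fun _ h => h)
  refine Ex.seq (clampT_spec H d) ?_
  rintro _ rfl
  have H1 := H.setT d (min (s.reg (treg d)) h.P)
  have K1 : Keep d s (setT s d (min (s.reg (treg d)) h.P)) := Keep.refl.setT le_rfl
  refine Ex.seq (Ex.instr rfl) ?_
  rintro _ rfl
  have E1 : (Instr.copy (treg (d + 1)) 0).apply (setT s d (min (s.reg (treg d)) h.P)) =
      setT (setT s d (min (s.reg (treg d)) h.P)) (d + 1) h.P := by
    simp only [Instr.apply, H1.P]; rfl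
  rw [E1]
  have H2 := H1.setT (d + 1) h.P
  have K2 := K1.setT (e := d + 1) (k := h.P) (by omega)
  set s2 := setT (setT s d (min (s.reg (treg d)) h.P)) (d + 1) h.P with hs2
  have v1 : s2.reg (treg d) = min (s.reg (treg d)) h.P := by simp [hs2, setT_reg_treg]
  have v2 : s2.reg (treg (d + 1)) = h.P := by simp [hs2]
  have := addMulT_spec (a := d + 1) (b := d) (c := d + 2) (k := 32) (by omega) (by omega)
    (by omega) s2
  rw [v1, v2] at this
  refine Ex.seq this ?_
  rintro _ rfl
  refine (succs_spec _ _ _).mono le_rfl ?_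
  rintro _ rfl
  refine ⟨((H2.setT _ _).setT _ _).setT (d + 1) _,
    ((K2.setT (by omega)).setT (by omega)).setT (by omega), ?_⟩
  simp [acell]

/-- The parameter `d` is the height of a stack of temporary registers: code at height `d` leaves the
registers below `d` alone (`Keep d`) and returns its value in register `d`. -/
def Exp.code : ℕ → Exp → Program
  | d, .lit c => .instr (.const (treg d) c)
  | d, .var x => .instr (.copy (treg d) (vreg x))
  | d, .add a b => .seq (a.code d) (.seq (b.code (d + 1)) (.seq (clampT (d + 1))
      (addMulT d (d + 1) (d + 2) 1)))
  | d, .mul a b => .seq (a.code d) (.seq (b.code (d + 1)) (.seq (clampT d) (.seq (clampT (d + 1))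
      (.seq (.instr (.const (treg (d + 2)) 0)) (.seq (.instr (.const (treg (d + 3)) 0))
        (.seq (.whileDo (.lt (treg (d + 3)) (treg (d + 1)))
          (.seq (addMulT (d + 2) d (d + 4) 1) (.instr (.succ (treg (d + 3))))))
          (.instr (.copy (treg d) (treg (d + 2))))))))))
  | d, .arr a i => .seq (i.code d) (.seq (addrT a d) (.instr (.load (treg d) (treg (d + 1)))))
  | d, .io i => .seq (i.code d) (.ite (.lt (treg d) 0) (.instr (.load (treg d) (treg d)))
      (.instr (.const (treg d) 0)))

open RAM

theorem Exp.code_spec {h : Store} (e : Exp) : ∀ (d : ℕ) {s : State}, Rel h s →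
    Ex (e.code d) s (e.cost h.P)
      (fun s' => Rel h s' ∧ Keep d s s' ∧ s'.reg (treg d) = e.eval h) := by
  induction e with
  | lit c =>
    intro d s H
    exact Ex.instr ⟨H.setT d c, Keep.refl.setT le_rfl, setT_reg_self s d c⟩
  | var x =>
    intro d s H
    exact Ex.instr ⟨H.setT d _, Keep.refl.setT le_rfl, (setT_reg_self s d _).trans (H.var x)⟩
  | add a b iha ihb =>
    intro d s H
    have e1 : a.cost h.P + (b.cost h.P + (2 + (1 + ((1 + 3) * min (b.eval h) h.P + 1)))) ≤
        (Exp.add a b).cost h.P := by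
      have : min (b.eval h) h.P ≤ h.P := min_le_right _ _
      simp only [Exp.cost]; omega
    refine Ex.mono ?_ e1 (fun _ h => h)
    refine Ex.seq (iha d H) ?_
    rintro s1 ⟨H1, K1, v1⟩
    refine Ex.seq (ihb (d + 1) H1) ?_
    rintro s2 ⟨H2, K2, v2⟩
    refine Ex.seq (clampT_spec H2 (d + 1)) ?_
    rintro _ rfl
    have H3 := H2.setT (d + 1) (min (s2.reg (treg (d + 1))) h.P)
    have K3 : Keep d s (setT s2 (d + 1) (min (s2.reg (treg (d + 1))) h.P)) :=
      (K1.trans (K2.mono (by omega))).setT (by omega)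
    have v3 : (setT s2 (d + 1) (min (s2.reg (treg (d + 1))) h.P)).reg (treg (d + 1)) =
      min (b.eval h) h.P := by simp [v2]
    have v4 : (setT s2 (d + 1) (min (s2.reg (treg (d + 1))) h.P)).reg (treg d) = a.eval h := by
      rw [setT_reg_treg, if_neg (by omega), K2 d (by omega), v1]
    have := addMulT_spec (a := d) (b := d + 1) (c := d + 2) (k := 1) (by omega) (by omega)
      (by omega) (setT s2 (d + 1) (min (s2.reg (treg (d + 1))) h.P))
    rw [v3, v4] at this
    refine this.mono le_rfl ?_
    rintro _ rfl
    refine ⟨(H3.setT _ _).setT _ _, (K3.setT (by omega)).setT (by omega), ?_⟩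
    simp [Exp.eval]
  | mul a b iha ihb =>
    intro d s H
    set A := min (a.eval h) h.P with hA
    set B := min (b.eval h) h.P with hB
    have e1 : a.cost h.P + (b.cost h.P + (2 + (2 + (1 + (1 + ((∑ i ∈ Finset.range B,
        ((1 + ((1 + 3) * A + 1)) + 1 + 1) + 1) + 1)))))) ≤ (Exp.mul a b).cost h.P := by
      have : A ≤ h.P := min_le_right _ _
      have : B ≤ h.P := min_le_right _ _
      have : B * (1 + ((1 + 3) * A + 1) + 1 + 1) ≤ h.P * (4 * h.P + 4) :=
        Nat.mul_le_mul this (by omega)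
      simp only [Exp.cost, Finset.sum_const, Finset.card_range, smul_eq_mul]; omega
    refine Ex.mono ?_ e1 (fun _ h => h)
    refine Ex.seq (iha d H) ?_
    rintro s1 ⟨H1, K1, v1⟩
    refine Ex.seq (ihb (d + 1) H1) ?_
    rintro s2 ⟨H2, K2, v2⟩
    refine Ex.seq (clampT_spec H2 d) ?_
    rintro _ rfl
    rw [K2 d (by omega), v1]
    refine Ex.seq (clampT_spec (H2.setT d A) (d + 1)) ?_
    rintro _ rfl
    rw [setT_reg_treg, if_neg (by omega), v2]
    refine Ex.seq (Ex.instr rfl) ?_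
    rintro _ rfl
    refine Ex.seq (Ex.instr rfl) ?_
    rintro _ rfl
    have H3 := (((H2.setT d A).setT (d + 1) B).setT (d + 2) 0).setT (d + 3) 0
    have K3 : Keep d s (setT (setT (setT (setT s2 d A) (d + 1) B) (d + 2) 0) (d + 3) 0) :=
      ((((K1.trans (K2.mono (by omega))).setT (by omega)).setT (by omega)).setT
        (by omega)).setT (by omega)
    change Ex _ (setT (setT (setT (setT s2 d A) (d + 1) B) (d + 2) 0) (d + 3) 0) _ _
    refine Ex.seq (Ex.while_lt (k := B) (fun i s' => Rel h s' ∧ Keep d s s' ∧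
      s'.reg (treg d) = A ∧ s'.reg (treg (d + 1)) = B ∧ s'.reg (treg (d + 2)) = A * i ∧
      s'.reg (treg (d + 3)) = i) (fun _ => (1 + ((1 + 3) * A + 1)) + 1)
      (fun i s' h => ⟨h.2.2.2.2.2, h.2.2.2.1⟩) ?_
      ⟨H3, K3, by simp [setT_reg_treg], by simp [setT_reg_treg], by simp [setT_reg_treg],
        by simp⟩) ?_
    · rintro i hi s' ⟨Hr, Kr, w0, w1, w2, w3⟩
      have := addMulT_spec (a := d + 2) (b := d) (c := d + 4) (k := 1) (by omega) (by omega)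
        (by omega) s'
      rw [w0, w2] at this
      refine Ex.seq this ?_
      rintro _ rfl
      refine Ex.instr ⟨((Hr.setT _ _).setT _ _).setT (d + 3) _,
        ((Kr.setT (by omega)).setT (by omega)).setT (by omega), ?_, ?_, ?_, ?_⟩
      · change (setT _ (d + 3) _).reg _ = _
        simp [setT_reg_treg, w0]
      · change (setT _ (d + 3) _).reg _ = _
        simp [setT_reg_treg, w1]
      · change (setT _ (d + 3) _).reg _ = _
        simp [setT_reg_treg]; ring
      · change (setT _ (d + 3) _).reg _ = _
        simp [setT_reg_treg, w3]
    · rintro s' ⟨Hr, Kr, w0, w1, w2, w3⟩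
      exact Ex.instr ⟨Hr.setT d _, Kr.setT le_rfl, (setT_reg_self s' d _).trans w2⟩
  | arr a i ih =>
    intro d s H
    have e1 : i.cost h.P + ((35 * h.P + 38) + 1) ≤ (Exp.arr a i).cost h.P := by
      simp only [Exp.cost]; omega
    refine Ex.mono ?_ e1 (fun _ h => h)
    refine Ex.seq (ih d H) ?_
    rintro s1 ⟨H1, K1, v1⟩
    refine Ex.seq (addrT_spec H1 a d) ?_
    rintro s2 ⟨H2, K2, v2⟩
    refine Ex.instr ⟨H2.setT d _, (K1.trans K2).setT le_rfl, ?_⟩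
    refine (setT_reg_self s2 d _).trans ?_
    rw [v2, H2.arr, v1]; rfl
  | io i ih =>
    intro d s H
    refine Ex.seq (ih d H) ?_
    rintro s1 ⟨H1, K1, v1⟩
    refine Ex.ite (T := 1) (fun hb => Ex.instr ?_) (fun hb => Ex.instr ?_)
    · refine ⟨H1.setT d _, K1.setT le_rfl, (setT_reg_self s1 d _).trans ?_⟩
      simp only [Test.Holds, v1, H1.P] at hb
      rw [v1, H1.io _ hb, Exp.eval, if_pos hb]
    · refine ⟨H1.setT d _, K1.setT le_rfl, (setT_reg_self s1 d _).trans ?_⟩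
      simp only [Test.Holds, v1, H1.P] at hb
      rw [Exp.eval, if_neg hb]

/-! ### Compilation of conditions and commands -/

/-- Both branches are passed as continuations. A branch may occur several times in the code of a
conjunction or disjunction, but only one copy is executed, so the time is not affected. -/
def Cond.code (d : ℕ) : Cond → Program → Program → Program
  | .eq a b, p, q => .seq (a.code d) (.seq (b.code (d + 1)) (.ite (.eq (treg d) (treg (d + 1))) p q))
  | .lt a b, p, q => .seq (a.code d) (.seq (b.code (d + 1)) (.ite (.lt (treg d) (treg (d + 1))) p q))
  | .and a b, p, q => a.code d (b.code d p q) q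
  | .or a b, p, q => a.code d p (b.code d p q)
  | .not a, p, q => a.code d q p

theorem Cond.code_spec {h : Store} (b : Cond) : ∀ {d T : ℕ} {p q : Program} {s : State}
    {Q : State → Prop}, Rel h s →
    (∀ s', Rel h s' → Keep d s s' → b.eval h = true → Ex p s' T Q) →
    (∀ s', Rel h s' → Keep d s s' → b.eval h = false → Ex q s' T Q) →
    Ex (b.code d p q) s (b.cost h.P + T) Q := by
  induction b with
  | eq a b =>
    intro d T p q s Q H hp hq
    have e1 : a.cost h.P + (b.cost h.P + (T + 1)) ≤ (Cond.eq a b).cost h.P + T := by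
      simp only [Cond.cost]; omega
    refine Ex.mono ?_ e1 (fun _ h => h)
    refine Ex.seq (a.code_spec d H) ?_
    rintro s1 ⟨H1, K1, v1⟩
    refine Ex.seq (b.code_spec (d + 1) H1) ?_
    rintro s2 ⟨H2, K2, v2⟩
    refine Ex.ite (fun hb => hp _ H2 (K1.trans (K2.mono (by omega))) ?_)
      (fun hb => hq _ H2 (K1.trans (K2.mono (by omega))) ?_) <;>
    · simp only [Test.Holds, v2, K2 d (by omega), v1] at hb
      simpa [Cond.eval] using hb
  | lt a b =>
    intro d T p q s Q H hp hq
    have e1 : a.cost h.P + (b.cost h.P + (T + 1)) ≤ (Cond.eq a b).cost h.P + T := by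
      simp only [Cond.cost]; omega
    refine Ex.mono ?_ e1 (fun _ h => h)
    refine Ex.seq (a.code_spec d H) ?_
    rintro s1 ⟨H1, K1, v1⟩
    refine Ex.seq (b.code_spec (d + 1) H1) ?_
    rintro s2 ⟨H2, K2, v2⟩
    refine Ex.ite (fun hb => hp _ H2 (K1.trans (K2.mono (by omega))) ?_)
      (fun hb => hq _ H2 (K1.trans (K2.mono (by omega))) ?_) <;>
    · simp only [Test.Holds, v2, K2 d (by omega), v1] at hb
      simpa [Cond.eval] using hb
  | and a b iha ihb =>
    intro d T p q s Q H hp hq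
    have e1 : a.cost h.P + (b.cost h.P + T) ≤ (Cond.and a b).cost h.P + T := by
      simp only [Cond.cost]; omega
    refine Ex.mono ?_ e1 (fun _ h => h)
    refine iha H (fun s1 H1 K1 v1 => ihb H1 (fun s2 H2 K2 v2 => ?_) (fun s2 H2 K2 v2 => ?_))
      (fun s1 H1 K1 v1 => ?_)
    · exact hp _ H2 (K1.trans K2) (by simp [Cond.eval, v1, v2])
    · exact hq _ H2 (K1.trans K2) (by simp [Cond.eval, v2])
    · exact (hq _ H1 K1 (by simp [Cond.eval, v1])).mono (by omega) (fun _ h => h)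
  | or a b iha ihb =>
    intro d T p q s Q H hp hq
    have e1 : a.cost h.P + (b.cost h.P + T) ≤ (Cond.or a b).cost h.P + T := by
      simp only [Cond.cost]; omega
    refine Ex.mono ?_ e1 (fun _ h => h)
    refine iha H (fun s1 H1 K1 v1 => ?_)
      (fun s1 H1 K1 v1 => ihb H1 (fun s2 H2 K2 v2 => ?_) (fun s2 H2 K2 v2 => ?_))
    · exact (hp _ H1 K1 (by simp [Cond.eval, v1])).mono (by omega) (fun _ h => h)
    · exact hp _ H2 (K1.trans K2) (by simp [Cond.eval, v2])
    · exact hq _ H2 (K1.trans K2) (by simp [Cond.eval, v1, v2])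
  | not a ih =>
    intro d T p q s Q H hp hq
    exact ih H (fun s1 H1 K1 v1 => hq _ H1 K1 (by simp [Cond.eval, v1]))
      (fun s1 H1 K1 v1 => hp _ H1 K1 (by simp [Cond.eval, v1]))

/-- The loop with counter in the temporary register `d + 1` and bound in the temporary
register `d`. -/
def loopT (d : ℕ) (x : Var) (p : Program) : Program :=
  .seq (.instr (.const (treg (d + 1)) 0)) (.whileDo (.lt (treg (d + 1)) (treg d))
    (.seq (.instr (.copy (vreg x) (treg (d + 1)))) (.seq p (.instr (.succ (treg (d + 1)))))))

def Cmd.code : ℕ → Cmd → Program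
  | d, .skip => .instr (.const (treg d) 0)
  | d, .assign x e => .seq (e.code d) (.instr (.copy (vreg x) (treg d)))
  | d, .store a i e => .seq (e.code d) (.seq (i.code (d + 1)) (.seq (addrT a (d + 1))
      (.instr (.store (treg (d + 2)) (treg d)))))
  | d, .put i e => .seq (e.code d) (.seq (i.code (d + 1)) (.ite (.lt (treg (d + 1)) 0)
      (.instr (.store (treg (d + 1)) (treg d))) (.instr (.const (treg d) 0))))
  | d, .seq c c' => .seq (c.code d) (c'.code d)
  | d, .ite b c c' => b.code d (c.code d) (c'.code d)
  -- The body is compiled at height `d + 2`, so the bound in `d` and the counter in `d + 1` survive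
  -- it, even if the body overwrites the variable `x`.
  | d, .loop x e c => .seq (e.code d) (.seq (clampT d) (loopT d x (c.code (d + 2))))
  | d, .bigLoop x e c => .seq (e.code d) (loopT d x (c.code (d + 2)))
  | _, .rewind p => .instr (.copy (creg p) 0)
  | _, .read p x => .seq (.instr (.load (vreg x) (creg p))) (
      .seq (.instr (.succ (creg p))) (.instr (.succ (creg p))))
  | d, .append e => .seq (e.code d) (.seq (.instr (.store (creg 0) (treg d)))
      (.seq (.instr (.succ (creg 0))) (.instr (.succ (creg 0)))))

theorem Store.setVar_P (h : Store) (x : Var) (k : ℕ) : (h.setVar x k).P = h.P := rfl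

theorem iter_P {f : ℕ → Store → Store} (hf : ∀ i h, (f i h).P = h.P) (h : Store) (k : ℕ) :
    (iter f h k).P = h.P := by
  induction k with
  | zero => rfl
  | succ k ih => rw [iter, hf, ih]

theorem Cmd.run_P (c : Cmd) : ∀ h : Store, (c.run h).P = h.P := by
  induction c with
  | skip => intro h; rfl
  | assign x e => intro h; rfl
  | store a i e => intro h; rfl
  | put i e => intro h; simp only [Cmd.run]; split_ifs <;> rfl
  | seq c d ihc ihd => intro h; rw [Cmd.run, ihd, ihc]
  | ite b c d ihc ihd => intro h; simp only [Cmd.run]; split_ifs <;> simp [ihc, ihd]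
  | loop x e c ih =>
    intro h; exact iter_P (f := fun i h' => c.run (h'.setVar x i)) (fun i h => ih _) h _
  | bigLoop x e c ih =>
    intro h; exact iter_P (f := fun i h' => c.run (h'.setVar x i)) (fun i h => ih _) h _
  | rewind p => intro h; rfl
  | read p x => intro h; rfl
  | append e => intro h; rfl

theorem loopT_spec {c : Cmd} {d : ℕ} {x : Var}
    (ih : ∀ {h : Store} {s : State}, Rel h s → Ex (c.code (d + 2)) s (c.cost h)
      (fun s' => Rel (c.run h) s' ∧ Keep (d + 2) s s')) {h : Store} {s : State} (H : Rel h s)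
    {k : ℕ} (hk : s.reg (treg d) = k) :
    Ex (loopT d x (c.code (d + 2))) s
      (∑ i ∈ Finset.range k, (c.cost ((c.at_ x h i).setVar x i) + 3) + 2)
      (fun s' => Rel (c.at_ x h k) s' ∧ Keep d s s') := by
  have e1 : 1 + (∑ i ∈ Finset.range k, ((1 + (c.cost ((c.at_ x h i).setVar x i) + 1)) + 1) + 1) ≤
      ∑ i ∈ Finset.range k, (c.cost ((c.at_ x h i).setVar x i) + 3) + 2 := by
    have : ∀ i, (1 + (c.cost ((c.at_ x h i).setVar x i) + 1)) + 1 =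
      c.cost ((c.at_ x h i).setVar x i) + 3 := fun i => by ring
    simp only [this]; omega
  refine Ex.mono ?_ e1 (fun _ h => h)
  refine Ex.seq (Ex.instr rfl) ?_
  rintro _ rfl
  refine Ex.mono (Ex.while_lt (k := k) (fun i s' => Rel (c.at_ x h i) s' ∧ Keep d s s' ∧
    s'.reg (treg d) = k ∧ s'.reg (treg (d + 1)) = i)
    (fun i => 1 + (c.cost ((c.at_ x h i).setVar x i) + 1))
    (fun i s' h => ⟨h.2.2.2, h.2.2.1⟩) ?_
    ⟨H.setT (d + 1) 0, Keep.refl.setT (by omega), ?_, setT_reg_self s (d + 1) 0⟩) le_rfl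
    (fun s' h => ⟨h.1, h.2.1⟩)
  · rintro i hi s' ⟨Hr, Kr, w0, w1⟩
    refine Ex.seq (Ex.instr rfl) ?_
    rintro _ rfl
    have H1 : Rel ((c.at_ x h i).setVar x i)
        ((Instr.copy (vreg x) (treg (d + 1))).apply s') := by
      have := Hr.setVar x i
      simp only [Instr.apply, w1]
      exact this
    have K1 : Keep (d + 2) s' ((Instr.copy (vreg x) (treg (d + 1))).apply s') :=
      keep_setVar _ _ _ _
    refine Ex.seq (ih H1) ?_
    rintro s2 ⟨H2, K2⟩
    have v1 : s2.reg (treg (d + 1)) = i := by rw [K2 _ (by omega), K1 _ (by omega), w1]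
    have v0 : s2.reg (treg d) = k := by rw [K2 _ (by omega), K1 _ (by omega), w0]
    refine Ex.instr ⟨H2.setT (d + 1) _,
      (Kr.trans ((K1.trans K2).mono (by omega))).setT (by omega), ?_, ?_⟩
    · change (setT _ (d + 1) _).reg _ = _
      simp [setT_reg_treg, v0]
    · change (setT _ (d + 1) _).reg _ = _
      simp [v1]
  · change (setT _ (d + 1) _).reg _ = _
    simp [setT_reg_treg, hk]

theorem Rel.setCur {h : Store} {s : State} (H : Rel h s) (p : Fin 3) (k : ℕ) :
    Rel { h with cur := Function.update h.cur p k }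
      { s with reg := Function.update s.reg (creg p) (h.P + 2 * k) } where
  P := (Function.update_of_ne (show 0 ≠ creg p by unfold creg; omega) (h.P + 2 * k) s.reg).trans H.P
  var y := (Function.update_of_ne (show vreg y ≠ creg p by unfold creg vreg; omega) _ s.reg).trans
    (H.var y)
  cur q := by
    simp only [Function.update_apply, creg]
    by_cases hq : q = p
    · simp [hq]
    · have : (q : ℕ) ≠ p := fun h => hq (Fin.ext h)
      simp [hq, this, ← H.cur q, creg]
  io := H.io
  tab := H.tab
  arr := H.arr

theorem keep_setCur (d : ℕ) (s : State) (p : Fin 3) (k : ℕ) :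
    Keep d s { s with reg := Function.update s.reg (creg p) k } := fun d' _ => by
  exact Function.update_of_ne (by unfold treg creg; omega) _ _

theorem Cmd.code_spec (c : Cmd) : ∀ (d : ℕ) {h : Store} {s : State}, Rel h s →
    Ex (c.code d) s (c.cost h) (fun s' => Rel (c.run h) s' ∧ Keep d s s') := by
  induction c with
  | skip =>
    intro d h s H
    exact Ex.instr ⟨H.setT d 0, Keep.refl.setT le_rfl⟩
  | assign x e =>
    intro d h s H
    refine Ex.seq (e.code_spec d H) ?_
    rintro s1 ⟨H1, K1, v1⟩
    have := H1.setVar x (e.eval h)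
    refine Ex.instr ⟨?_, K1.trans (keep_setVar _ _ _ _)⟩
    simp only [Instr.apply, v1]
    exact this
  | store a i e =>
    intro d h s H
    have e1 : e.cost h.P + (i.cost h.P + ((35 * h.P + 38) + 1)) ≤ (Cmd.store a i e).cost h := by
      simp only [Cmd.cost]; omega
    refine Ex.mono ?_ e1 (fun _ h => h)
    refine Ex.seq (e.code_spec d H) ?_
    rintro s1 ⟨H1, K1, v1⟩
    refine Ex.seq (i.code_spec (d + 1) H1) ?_
    rintro s2 ⟨H2, K2, v2⟩
    refine Ex.seq (addrT_spec H2 a (d + 1)) ?_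
    rintro s3 ⟨H3, K3, v3⟩
    have := H3.setArr a (min (i.eval h) h.P) (e.eval h)
    refine Ex.instr ⟨?_, (K1.trans ((K2.trans K3).mono (by omega))).trans fun _ _ => rfl⟩
    simp only [Instr.apply, v3, v2]
    rw [K3 d (by omega), K2 d (by omega), v1]
    exact this
  | put i e =>
    intro d h s H
    have e1 : e.cost h.P + (i.cost h.P + (1 + 1)) ≤ (Cmd.put i e).cost h := by
      simp only [Cmd.cost]; omega
    refine Ex.mono ?_ e1 (fun _ h => h)
    refine Ex.seq (e.code_spec d H) ?_
    rintro s1 ⟨H1, K1, v1⟩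
    refine Ex.seq (i.code_spec (d + 1) H1) ?_
    rintro s2 ⟨H2, K2, v2⟩
    have v1' : s2.reg (treg d) = e.eval h := by rw [K2 d (by omega), v1]
    refine Ex.ite (fun hb => Ex.instr ⟨?_, (K1.trans (K2.mono (by omega))).trans fun _ _ => rfl⟩)
      (fun hb => Ex.instr ⟨?_, (K1.trans (K2.mono (by omega))).setT le_rfl⟩)
    · simp only [Test.Holds, v2, H2.P] at hb
      simp only [Instr.apply, v2, Cmd.run, if_pos hb, v1']
      refine ⟨H2.P, H2.var, H2.cur, ?_, ?_, ?_⟩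
      · intro j hj
        simp only [Function.update_apply]
        split_ifs
        · rfl
        · exact H2.io j hj
      · intro j
        simp only [Function.update_apply]
        rw [if_neg (by omega)]
        exact H2.tab j
      · intro b j
        simp only [Function.update_apply]
        rw [if_neg (by unfold acell; omega)]
        exact H2.arr b j
    · simp only [Test.Holds, v2, H2.P] at hb
      simp only [Cmd.run, if_neg hb]
      exact H2.setT d 0
  | seq c c' ihc ihc' =>
    intro d h s H
    refine Ex.seq (ihc d H) ?_
    rintro s1 ⟨H1, K1⟩
    exact (ihc' d H1).mono le_rfl fun s2 ⟨H2, K2⟩ => ⟨H2, K1.trans K2⟩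
  | ite b c c' ihc ihc' =>
    intro d h s H
    refine b.code_spec H (fun s1 H1 K1 hb => ?_) (fun s1 H1 K1 hb => ?_)
    · simp only [Cmd.run, hb, if_true]
      exact (ihc d H1).mono le_rfl fun s2 ⟨H2, K2⟩ => ⟨H2, K1.trans K2⟩
    · simp only [Cmd.run, hb, Bool.false_eq_true, if_false]
      exact (ihc' d H1).mono le_rfl fun s2 ⟨H2, K2⟩ => ⟨H2, K1.trans K2⟩
  | loop x e c ih =>
    intro d h s H
    refine Ex.seq (e.code_spec d H) ?_
    rintro s1 ⟨H1, K1, v1⟩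
    rw [add_comm _ 4, show 4 = 2 + 2 from rfl, add_assoc, add_comm 2 (∑ _ ∈ _, _)]
    refine Ex.seq (clampT_spec H1 d) ?_
    rintro _ rfl
    refine (loopT_spec (fun H => ih (d + 2) H) (H1.setT d _) (setT_reg_self _ _ _)).mono
      (by rw [v1]) ?_
    rintro s2 ⟨H2, K2⟩
    refine ⟨?_, (K1.setT le_rfl).trans K2⟩
    rw [v1] at H2
    exact H2
  | bigLoop x e c ih =>
    intro d h s H
    refine Ex.seq (e.code_spec d H) ?_
    rintro s1 ⟨H1, K1, v1⟩
    refine (loopT_spec (fun H => ih (d + 2) H) H1 v1).mono (by omega) ?_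
    rintro s2 ⟨H2, K2⟩
    exact ⟨H2, K1.trans K2⟩
  | rewind p =>
    intro d h s H
    refine Ex.instr ⟨?_, keep_setCur _ _ _ _⟩
    have := H.setCur p 0
    simp only [Instr.apply, H.P]
    exact this
  | read p x =>
    intro d h s H
    refine Ex.mono (T := 1 + (1 + 1)) ?_ le_rfl (fun _ h => h)
    refine Ex.seq (Ex.instr rfl) ?_
    rintro _ rfl
    refine Ex.seq (Ex.instr rfl) ?_
    rintro _ rfl
    have H1 := H.setVar x (h.tab (h.cur p))
    have e1 : (Instr.load (vreg x) (creg p)).apply s =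
        { s with reg := Function.update s.reg (vreg x) (h.tab (h.cur p)) } := by
      simp only [Instr.apply, H.cur, H.tab]
    rw [e1]
    have v1 := H1.cur p
    have K1 := keep_setVar d s x (h.tab (h.cur p))
    set s1 : State := { s with reg := Function.update s.reg (vreg x) (h.tab (h.cur p)) }
    have H2 := H1.setCur p (h.cur p + 1)
    have K2 := keep_setCur d s1 p (h.P + 2 * (h.cur p + 1))
    refine Ex.instr ?_
    have e2 : (Instr.succ (creg p)).apply ((Instr.succ (creg p)).apply s1) =
        { s1 with reg := Function.update s1.reg (creg p) (h.P + 2 * (h.cur p + 1)) } := by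
      simp only [Instr.apply, Function.update_self, Function.update_idem, v1]
      rfl
    rw [e2]
    exact ⟨H2, K1.trans K2⟩
  | append e =>
    intro d h s H
    refine Ex.mono (T := e.cost h.P + (1 + (1 + 1))) ?_ le_rfl (fun _ h => h)
    refine Ex.seq (e.code_spec d H) ?_
    rintro s1 ⟨H1, K1, v1⟩
    refine Ex.seq (Ex.instr rfl) ?_
    rintro _ rfl
    refine Ex.seq (Ex.instr rfl) ?_
    rintro _ rfl
    refine Ex.instr ?_
    have e1 : (Instr.store (creg 0) (treg d)).apply s1 =
        { s1 with mem := Function.update s1.mem (h.P + 2 * h.cur 0) (e.eval h) } := by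
      simp only [Instr.apply, H1.cur, v1]
    have H2 : Rel { h with tab := Function.update h.tab (h.cur 0) (e.eval h) }
        { s1 with mem := Function.update s1.mem (h.P + 2 * h.cur 0) (e.eval h) } := by
      refine ⟨H1.P, H1.var, H1.cur, ?_, ?_, ?_⟩
      · intro j hj
        have hj : j < h.P := hj
        exact (Function.update_of_ne (by omega) _ s1.mem).trans (H1.io j hj)
      · intro j
        simp only [Function.update_apply]
        by_cases hj : j = h.cur 0
        · simp [hj]
        · rw [if_neg (by omega), if_neg hj]; exact H1.tab j
      · intro b j
        exact (Function.update_of_ne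
          (show acell h.P b j ≠ h.P + 2 * h.cur 0 by unfold acell; omega) _ s1.mem).trans (H1.arr b j)
    rw [e1]
    have v2 := H2.cur 0
    set s2 : State := { s1 with mem := Function.update s1.mem (h.P + 2 * h.cur 0) (e.eval h) }
    have K2 : Keep d s1 s2 := fun _ _ => rfl
    have e2 : (Instr.succ (creg 0)).apply ((Instr.succ (creg 0)).apply s2) =
        { s2 with reg := Function.update s2.reg (creg 0) (h.P + 2 * (h.cur 0 + 1)) } := by
      simp only [Instr.apply, Function.update_self, Function.update_idem, v2]
      rfl
    rw [e2]
    exact ⟨H2.setCur 0 (h.cur 0 + 1), (K1.trans K2).trans (keep_setCur d s2 0 _)⟩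

/-! ### Reasoning about commands -/

namespace Store

variable (h : Store) (x : Var) (a : Arr) (i k : ℕ)

@[simp] theorem setVar_var (y : Var) :
    (h.setVar x k).var y = if y = x then k else h.var y := by
  simp [setVar, Function.update_apply]

@[simp] theorem setVar_arr : (h.setVar x k).arr = h.arr := rfl
@[simp] theorem setVar_io : (h.setVar x k).io = h.io := rfl
@[simp] theorem setVar_tab : (h.setVar x k).tab = h.tab := rfl
@[simp] theorem setVar_cur : (h.setVar x k).cur = h.cur := rfl
@[simp] theorem setVar_P' : (h.setVar x k).P = h.P := rfl

@[simp] theorem setArr_arr (b : Arr) (j : ℕ) :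
    (h.setArr a i k).arr b j = if b = a ∧ j = i then k else h.arr b j := by
  simp only [setArr, Function.update_apply]
  split_ifs with h1 h2 h2 <;> simp_all

@[simp] theorem setArr_var : (h.setArr a i k).var = h.var := rfl
@[simp] theorem setArr_P : (h.setArr a i k).P = h.P := rfl

end Store

namespace Cmd

/-- The variables that a command may change. -/
def wvar : Cmd → Var → Bool
  | .assign x _, y => y == x
  | .seq c d, y => c.wvar y || d.wvar y
  | .ite _ c d, y => c.wvar y || d.wvar y
  | .loop x _ c, y => y == x || c.wvar y
  | .bigLoop x _ c, y => y == x || c.wvar y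
  | .read _ x, y => y == x
  | _, _ => false

/-- The arrays that a command may change. -/
def warr : Cmd → Arr → Bool
  | .store a _ _, b => b == a
  | .seq c d, y => c.warr y || d.warr y
  | .ite _ c d, y => c.warr y || d.warr y
  | .loop _ _ c, y => c.warr y
  | .bigLoop _ _ c, y => c.warr y
  | _, _ => false

/-- The heads that a command may move. -/
def wcur : Cmd → Fin 3 → Bool
  | .seq c d, y => c.wcur y || d.wcur y
  | .ite _ c d, y => c.wcur y || d.wcur y
  | .loop _ _ c, y => c.wcur y
  | .bigLoop _ _ c, y => c.wcur y
  | .rewind p, y => y == p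
  | .read p _, y => y == p
  | .append _, y => y == 0
  | _, _ => false

/-- Whether a command may change `io`. -/
def wio : Cmd → Bool
  | .put _ _ => true
  | .seq c d => c.wio || d.wio
  | .ite _ c d => c.wio || d.wio
  | .loop _ _ c => c.wio
  | .bigLoop _ _ c => c.wio
  | _ => false

/-- Whether a command may change the tape. -/
def wtab : Cmd → Bool
  | .append _ => true
  | .seq c d => c.wtab || d.wtab
  | .ite _ c d => c.wtab || d.wtab
  | .loop _ _ c => c.wtab
  | .bigLoop _ _ c => c.wtab
  | _ => false

end Cmd

/-! ### Frames and loop invariants -/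

/-- `h` and `h'` differ only in what `c` may change. -/
structure Frame (c : Cmd) (h h' : Store) : Prop where
  P : h'.P = h.P
  var : ∀ y, c.wvar y = false → h'.var y = h.var y
  arr : ∀ a, c.warr a = false → h'.arr a = h.arr a
  cur : ∀ p, c.wcur p = false → h'.cur p = h.cur p
  io : c.wio = false → h'.io = h.io
  tab : c.wtab = false → h'.tab = h.tab

theorem Frame.refl (c : Cmd) (h : Store) : Frame c h h :=
  ⟨rfl, fun _ _ => rfl, fun _ _ => rfl, fun _ _ => rfl, fun _ => rfl, fun _ => rfl⟩

theorem Frame.trans {c : Cmd} {h h' h'' : Store} (H : Frame c h h') (H' : Frame c h' h'') :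
    Frame c h h'' :=
  ⟨H'.P.trans H.P, fun y hy => (H'.var y hy).trans (H.var y hy),
    fun y hy => (H'.arr y hy).trans (H.arr y hy), fun y hy => (H'.cur y hy).trans (H.cur y hy),
    fun hy => (H'.io hy).trans (H.io hy), fun hy => (H'.tab hy).trans (H.tab hy)⟩

theorem frame_at_of {c : Cmd} (ih : ∀ h, Frame c h (c.run h)) (x : Var) (e : Exp) (h : Store)
    (k : ℕ) : Frame (.loop x e c) h (c.at_ x h k) := by
  induction k with
  | zero => exact Frame.refl _ _
  | succ k hk =>
    refine hk.trans ?_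
    have := ih ((c.at_ x h k).setVar x k)
    refine ⟨this.P, fun y hy => ?_, this.arr, this.cur, this.io, this.tab⟩
    simp only [Cmd.wvar, Bool.or_eq_false_iff, beq_eq_false_iff_ne] at hy
    refine (this.var y hy.2).trans ?_
    simp [hy.1]

theorem Frame.run (c : Cmd) : ∀ h, Frame c h (c.run h) := by
  induction c with
  | skip => intro h; exact Frame.refl _ _
  | assign x e =>
    intro h
    refine ⟨rfl, fun y hy => ?_, fun _ _ => rfl, fun _ _ => rfl, fun _ => rfl, fun _ => rfl⟩
    simp only [Cmd.wvar, beq_eq_false_iff_ne] at hy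
    simp [Cmd.run, hy]
  | store a i e =>
    intro h
    refine ⟨rfl, fun _ _ => rfl, fun b hb => ?_, fun _ _ => rfl, fun _ => rfl, fun _ => rfl⟩
    simp only [Cmd.warr, beq_eq_false_iff_ne] at hb
    funext j
    simp [Cmd.run, hb]
  | put i e =>
    intro h
    simp only [Cmd.run]
    split_ifs
    · exact ⟨rfl, fun _ _ => rfl, fun _ _ => rfl, fun _ _ => rfl, (fun h => by cases h),
        fun _ => rfl⟩
    · exact Frame.refl _ _
  | seq c d ihc ihd =>
    intro h
    have H := ihc h
    have H' := ihd (c.run h)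
    refine ⟨H'.P.trans H.P, fun y hy => ?_, fun y hy => ?_, fun y hy => ?_, fun hy => ?_,
      fun hy => ?_⟩
    · simp only [Cmd.wvar, Bool.or_eq_false_iff] at hy
      exact (H'.var y hy.2).trans (H.var y hy.1)
    · simp only [Cmd.warr, Bool.or_eq_false_iff] at hy
      exact (H'.arr y hy.2).trans (H.arr y hy.1)
    · simp only [Cmd.wcur, Bool.or_eq_false_iff] at hy
      exact (H'.cur y hy.2).trans (H.cur y hy.1)
    · simp only [Cmd.wio, Bool.or_eq_false_iff] at hy
      exact (H'.io hy.2).trans (H.io hy.1)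
    · simp only [Cmd.wtab, Bool.or_eq_false_iff] at hy
      exact (H'.tab hy.2).trans (H.tab hy.1)
  | ite b c d ihc ihd =>
    intro h
    have H : Frame c h (c.run h) := ihc h
    have H' : Frame d h (d.run h) := ihd h
    refine ⟨Cmd.run_P _ _, fun y hy => ?_, fun y hy => ?_, fun y hy => ?_, fun hy => ?_,
      fun hy => ?_⟩
    · simp only [Cmd.wvar, Bool.or_eq_false_iff] at hy
      simp only [Cmd.run]; split_ifs; exacts [H.var y hy.1, H'.var y hy.2]
    · simp only [Cmd.warr, Bool.or_eq_false_iff] at hy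
      simp only [Cmd.run]; split_ifs; exacts [H.arr y hy.1, H'.arr y hy.2]
    · simp only [Cmd.wcur, Bool.or_eq_false_iff] at hy
      simp only [Cmd.run]; split_ifs; exacts [H.cur y hy.1, H'.cur y hy.2]
    · simp only [Cmd.wio, Bool.or_eq_false_iff] at hy
      simp only [Cmd.run]; split_ifs; exacts [H.io hy.1, H'.io hy.2]
    · simp only [Cmd.wtab, Bool.or_eq_false_iff] at hy
      simp only [Cmd.run]; split_ifs; exacts [H.tab hy.1, H'.tab hy.2]
  | loop x e c ih => intro h; exact frame_at_of ih x e h _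
  | bigLoop x e c ih =>
    intro h
    have := frame_at_of ih x e h (e.eval h)
    exact ⟨this.P, this.var, this.arr, this.cur, this.io, this.tab⟩
  | rewind p =>
    intro h
    refine ⟨rfl, fun _ _ => rfl, fun _ _ => rfl, fun q hq => ?_, fun _ => rfl, fun _ => rfl⟩
    simp only [Cmd.wcur, beq_eq_false_iff_ne] at hq
    simp [Cmd.run, hq]
  | read p x =>
    intro h
    refine ⟨rfl, fun y hy => ?_, fun _ _ => rfl, fun q hq => ?_, fun _ => rfl, fun _ => rfl⟩
    · simp only [Cmd.wvar, beq_eq_false_iff_ne] at hy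
      simp [Cmd.run, Store.setVar, hy]
    · simp only [Cmd.wcur, beq_eq_false_iff_ne] at hq
      simp [Cmd.run, hq]
  | append e =>
    intro h
    refine ⟨rfl, fun _ _ => rfl, fun _ _ => rfl, fun q hq => ?_, fun _ => rfl,
      fun h => by cases h⟩
    simp only [Cmd.wcur, beq_eq_false_iff_ne] at hq
    simp [Cmd.run, hq]

/-- The write set of a loop depends neither on its bound nor on its kind, hence a frame stated with
`loop` and an arbitrary `e` serves `bigLoop` as well. -/
theorem frame_at (c : Cmd) (x : Var) (e : Exp) (h : Store) (k : ℕ) :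
    Frame (.loop x e c) h (c.at_ x h k) := frame_at_of (Frame.run c) x e h k

/-- Each round is given the frame relative to the state before the whole loop, so an invariant need
only mention what the body really changes. -/
theorem run_loop {x : Var} {e : Exp} {c : Cmd} {h : Store} {k : ℕ}
    (hk : min (e.eval h) h.P = k) (I : ℕ → Store → Prop) (h0 : I 0 h)
    (hs : ∀ i h', i < k → Frame (.loop x e c) h h' → I i h' → I (i + 1) (c.run (h'.setVar x i))) :
    I k ((Cmd.loop x e c).run h) := by
  have key : ∀ i, i ≤ k → I i (c.at_ x h i) := by
    intro i
    induction i with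
    | zero => intro _; exact h0
    | succ i ih => intro hi; exact hs i _ (by omega) (frame_at c x e h i) (ih (by omega))
  subst hk
  exact key _ le_rfl

/-- Correctness and cost are proved together because the cost of a body that contains another
`bigLoop` can be bounded only with the help of the invariant. -/
theorem run_bigLoop {x : Var} {e : Exp} {c : Cmd} {h : Store} {k : ℕ}
    (hk : e.eval h = k) (I : ℕ → Store → Prop) {B : ℕ} (h0 : I 0 h)
    (hs : ∀ i h', i < k → Frame (.loop x e c) h h' → I i h' →
      I (i + 1) (c.run (h'.setVar x i)) ∧ c.cost (h'.setVar x i) ≤ B) :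
    I k ((Cmd.bigLoop x e c).run h) ∧
      (Cmd.bigLoop x e c).cost h ≤ e.cost h.P + k * (B + 3) + 4 := by
  have key : ∀ i, i ≤ k → I i (c.at_ x h i) := by
    intro i
    induction i with
    | zero => intro _; exact h0
    | succ i ih => intro hi; exact (hs i _ (by omega) (frame_at c x e h i) (ih (by omega))).1
  subst hk
  refine ⟨key _ le_rfl, ?_⟩
  have : ∑ i ∈ Finset.range (e.eval h), (c.cost ((c.at_ x h i).setVar x i) + 3) ≤
      ∑ i ∈ Finset.range (e.eval h), (B + 3) :=
    Finset.sum_le_sum fun i hi => by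
      have hi := Finset.mem_range.1 hi
      have := (hs i _ hi (frame_at c x e h i) (key i hi.le)).2
      omega
  simp only [Finset.sum_const, Finset.card_range, smul_eq_mul] at this
  simp only [Cmd.cost]
  omega

/-- The cost of a loop whose body has bounded cost. -/
theorem cost_loop_le {x : Var} {e : Exp} {c : Cmd} {h : Store} {k : ℕ}
    (hk : min (e.eval h) h.P = k) (I : ℕ → Store → Prop) {B : ℕ} (h0 : I 0 h)
    (hs : ∀ i h', i < k → Frame (.loop x e c) h h' → I i h' →
      I (i + 1) (c.run (h'.setVar x i)) ∧ c.cost (h'.setVar x i) ≤ B) :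
    I k ((Cmd.loop x e c).run h) ∧
      (Cmd.loop x e c).cost h ≤ e.cost h.P + k * (B + 3) + 4 := by
  have key : ∀ i, i ≤ k → I i (c.at_ x h i) := by
    intro i
    induction i with
    | zero => intro _; exact h0
    | succ i ih => intro hi; exact (hs i _ (by omega) (frame_at c x e h i) (ih (by omega))).1
  subst hk
  refine ⟨key _ le_rfl, ?_⟩
  have : ∑ i ∈ Finset.range (min (e.eval h) h.P), (c.cost ((c.at_ x h i).setVar x i) + 3) ≤
      ∑ i ∈ Finset.range (min (e.eval h) h.P), (B + 3) :=
    Finset.sum_le_sum fun i hi => by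
      have hi := Finset.mem_range.1 hi
      have := (hs i _ hi (frame_at c x e h i) (key i hi.le)).2
      omega
  simp only [Finset.sum_const, Finset.card_range, smul_eq_mul] at this
  simp only [Cmd.cost]
  omega

/-- A loop that writes `f i` to cell `i` of array `a` in round `i`. -/
theorem run_loop_fill {x : Var} {e : Exp} {c : Cmd} {h : Store} {k : ℕ}
    (hk : min (e.eval h) h.P = k) (a : Arr) (f : ℕ → ℕ)
    (hs : ∀ i h', i < k → Frame (.loop x e c) h h' →
      (c.run (h'.setVar x i)).arr a i = f i ∧
        ∀ j, j ≠ i → (c.run (h'.setVar x i)).arr a j = h'.arr a j) :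
    ∀ j, ((Cmd.loop x e c).run h).arr a j = if j < k then f j else h.arr a j := by
  refine run_loop hk (fun i h' => ∀ j, h'.arr a j = if j < i then f j else h.arr a j)
    (by simp) ?_
  intro i h' hi hf ih j
  obtain ⟨h1, h2⟩ := hs i h' hi hf
  by_cases hj : j = i
  · subst hj; rw [h1, if_pos (by omega)]
  · rw [h2 j hj, ih j]
    by_cases hj' : j < i
    · rw [if_pos hj', if_pos (by omega)]
    · rw [if_neg hj', if_neg (by omega)]

/-- A loop that increases `y` by `f i` in round `i`. -/
theorem run_loop_sum {x : Var} {e : Exp} {c : Cmd} {h : Store} {k : ℕ}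
    (hk : min (e.eval h) h.P = k) (y : Var) (f : ℕ → ℕ)
    (hs : ∀ i h', i < k → Frame (.loop x e c) h h' →
      (c.run (h'.setVar x i)).var y = h'.var y + f i) :
    ((Cmd.loop x e c).run h).var y = h.var y + ∑ i ∈ Finset.range k, f i := by
  refine run_loop hk (fun i h' => h'.var y = h.var y + ∑ i ∈ Finset.range i, f i) (by simp) ?_
  intro i h' hi hf ih
  rw [hs i h' hi hf, ih, Finset.sum_range_succ, add_assoc]

open Classical in
/-- A loop that sets `y` to `b` in the rounds `i` with `p i`. -/
theorem run_loop_flag {x : Var} {e : Exp} {c : Cmd} {h : Store} {k : ℕ}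
    (hk : min (e.eval h) h.P = k) (y : Var) (b : ℕ) (p : ℕ → Prop)
    (hs : ∀ i h', i < k → Frame (.loop x e c) h h' →
      (c.run (h'.setVar x i)).var y = if p i then b else h'.var y) :
    ((Cmd.loop x e c).run h).var y = if ∃ i, i < k ∧ p i then b else h.var y := by
  refine run_loop hk (fun i h' => h'.var y = if ∃ j, j < i ∧ p j then b else h.var y)
    (by simp) ?_
  intro i h' hi hf ih
  rw [hs i h' hi hf, ih]
  by_cases hp : p i
  · rw [if_pos hp, if_pos ⟨i, by omega, hp⟩]
  · rw [if_neg hp]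
    congr 1
    apply propext
    constructor
    · rintro ⟨j, hj, hpj⟩; exact ⟨j, by omega, hpj⟩
    · rintro ⟨j, hj, hpj⟩
      rcases Nat.lt_succ_iff_lt_or_eq.1 hj with h1 | rfl
      · exact ⟨j, h1, hpj⟩
      · exact absurd hpj hp

/-! ### Polynomial cost -/

/-- `f` is bounded by a polynomial. -/
def PolyBdd (f : ℕ → ℕ) : Prop := ∃ a b : ℕ, ∀ P, f P ≤ a * (P + 1) ^ b

theorem PolyBdd.const (c : ℕ) : PolyBdd fun _ => c := ⟨c, 0, fun P => by simp⟩

theorem PolyBdd.id : PolyBdd fun P => P := ⟨1, 1, fun P => by simp⟩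

theorem PolyBdd.add {f g : ℕ → ℕ} (hf : PolyBdd f) (hg : PolyBdd g) :
    PolyBdd fun P => f P + g P := by
  obtain ⟨a, b, hab⟩ := hf
  obtain ⟨a', b', hab'⟩ := hg
  refine ⟨a + a', b + b', fun P => ?_⟩
  have h1 : (P + 1) ^ b ≤ (P + 1) ^ (b + b') := Nat.pow_le_pow_right (by omega) (by omega)
  have h2 : (P + 1) ^ b' ≤ (P + 1) ^ (b + b') := Nat.pow_le_pow_right (by omega) (by omega)
  calc f P + g P ≤ a * (P + 1) ^ b + a' * (P + 1) ^ b' := add_le_add (hab P) (hab' P)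
    _ ≤ a * (P + 1) ^ (b + b') + a' * (P + 1) ^ (b + b') := by gcongr
    _ = (a + a') * (P + 1) ^ (b + b') := by ring

theorem PolyBdd.mul {f g : ℕ → ℕ} (hf : PolyBdd f) (hg : PolyBdd g) :
    PolyBdd fun P => f P * g P := by
  obtain ⟨a, b, hab⟩ := hf
  obtain ⟨a', b', hab'⟩ := hg
  refine ⟨a * a', b + b', fun P => ?_⟩
  calc f P * g P ≤ (a * (P + 1) ^ b) * (a' * (P + 1) ^ b') := Nat.mul_le_mul (hab P) (hab' P)
    _ = a * a' * (P + 1) ^ (b + b') := by ring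

theorem Exp.cost_polyBdd (e : Exp) : PolyBdd fun P => e.cost P := by
  induction e with
  | lit c => exact .const 1
  | var x => exact .const 1
  | add a b iha ihb => exact (iha.add ihb).add (((PolyBdd.const 4).mul .id).add (.const 4))
  | mul a b iha ihb =>
    exact (iha.add ihb).add ((PolyBdd.id.mul (((PolyBdd.const 4).mul .id).add (.const 4))).add
      (.const 8))
  | arr a i ih => exact ih.add (((PolyBdd.const 35).mul .id).add (.const 40))
  | io i ih => exact ih.add (.const 2)

theorem Cond.cost_polyBdd (b : Cond) : PolyBdd fun P => b.cost P := by
  induction b with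
  | eq a b => exact (a.cost_polyBdd.add b.cost_polyBdd).add (.const 1)
  | lt a b => exact (a.cost_polyBdd.add b.cost_polyBdd).add (.const 1)
  | and a b iha ihb => exact iha.add ihb
  | or a b iha ihb => exact iha.add ihb
  | not a ih => exact ih

namespace Cmd

/-- A command without `bigLoop`. -/
def isPoly : Cmd → Bool
  | .seq c d => c.isPoly && d.isPoly
  | .ite _ c d => c.isPoly && d.isPoly
  | .loop _ _ c => c.isPoly
  | .bigLoop _ _ _ => false
  | _ => true

/-- A bound for the cost of a command without `bigLoop`. -/
def pcost (P : ℕ) : Cmd → ℕ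
  | .skip => 1
  | .assign _ e => e.cost P + 1
  | .store _ i e => i.cost P + e.cost P + (35 * P + 40)
  | .put i e => i.cost P + e.cost P + 2
  | .seq c d => c.pcost P + d.pcost P
  | .ite b c d => b.cost P + (c.pcost P + d.pcost P)
  | .loop _ e c => e.cost P + (P * (c.pcost P + 3) + 4)
  -- A junk value: `cost_le_pcost` excludes these commands.
  | .bigLoop _ _ _ => 0
  | .rewind _ => 1
  | .read _ _ => 3
  | .append e => e.cost P + 3

theorem pcost_polyBdd (c : Cmd) : PolyBdd fun P => c.pcost P := by
  induction c with
  | skip => exact .const 1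
  | assign x e => exact e.cost_polyBdd.add (.const 1)
  | store a i e =>
    exact (i.cost_polyBdd.add e.cost_polyBdd).add (((PolyBdd.const 35).mul .id).add (.const 40))
  | put i e => exact (i.cost_polyBdd.add e.cost_polyBdd).add (.const 2)
  | seq c d ihc ihd => exact ihc.add ihd
  | ite b c d ihc ihd => exact b.cost_polyBdd.add (ihc.add ihd)
  | loop x e c ih => exact e.cost_polyBdd.add ((PolyBdd.id.mul (ih.add (.const 3))).add (.const 4))
  | bigLoop x e c ih => exact .const 0
  | rewind p => exact .const 1
  | read p x => exact .const 3
  | append e => exact e.cost_polyBdd.add (.const 3)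

theorem cost_le_pcost (c : Cmd) (hc : c.isPoly = true) : ∀ h : Store, c.cost h ≤ c.pcost h.P := by
  induction c with
  | skip => intro h; exact le_rfl
  | assign x e => intro h; exact le_rfl
  | store a i e => intro h; exact le_rfl
  | put i e => intro h; exact le_rfl
  | seq c d ihc ihd =>
    intro h
    simp only [isPoly, Bool.and_eq_true] at hc
    have := ihd hc.2 (c.run h)
    rw [run_P] at this
    exact add_le_add (ihc hc.1 h) this
  | ite b c d ihc ihd =>
    intro h
    simp only [isPoly, Bool.and_eq_true] at hc
    have h1 := ihc hc.1 h
    have h2 := ihd hc.2 h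
    simp only [cost, pcost]
    split_ifs <;> omega
  | loop x e c ih =>
    intro h
    have h1 : ∑ i ∈ Finset.range (min (e.eval h) h.P), (c.cost ((c.at_ x h i).setVar x i) + 3) ≤
        ∑ i ∈ Finset.range (min (e.eval h) h.P), (c.pcost h.P + 3) :=
      Finset.sum_le_sum fun i _ => by
        have := ih hc ((c.at_ x h i).setVar x i)
        rw [Store.setVar_P, (frame_at c x e h i).P] at this
        omega
    have h2 : ∑ i ∈ Finset.range (min (e.eval h) h.P), (c.pcost h.P + 3) ≤
        h.P * (c.pcost h.P + 3) := by
      simp only [Finset.sum_const, Finset.card_range, smul_eq_mul]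
      exact Nat.mul_le_mul_right _ (min_le_right _ _)
    simp only [cost, pcost]
    omega
  | bigLoop x e c ih => cases hc
  | rewind p => intro h; exact le_rfl
  | read p x => intro h; exact le_rfl
  | append e => intro h; exact le_rfl

end Cmd

end Imp
end SMWidth

set_option linter.unusedSectionVars false

namespace SMWidth

/-! ### Canonical vertex covers of cuts -/

section Cuts

variable {V : Type*} [Fintype V] [DecidableEq V] (G : SimpleGraph V)

/-- `C` covers all edges between `A` and its complement. -/
def IsCover (A C : Finset V) : Prop := ∀ u ∈ A, ∀ v, v ∉ A → G.Adj u v → u ∈ C ∨ v ∈ C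

/-- `C` is a minimum vertex cover of the cut `A` with as few vertices outside `A` as possible. -/
structure IsCanonical (A C : Finset V) : Prop where
  cover : IsCover G A C
  card_le : ∀ C', IsCover G A C' → C.card ≤ C'.card
  outer_le : ∀ C', IsCover G A C' → C'.card = C.card → (C \ A).card ≤ (C' \ A).card

open Classical in
/-- The vertices of `X` with a neighbour in `S`. -/
noncomputable def nbrs (S X : Finset V) : Finset V := X.filter fun x => ∃ s ∈ S, G.Adj s x

variable {G}

theorem mem_nbrs {S X : Finset V} {x : V} : x ∈ nbrs G S X ↔ x ∈ X ∧ ∃ s ∈ S, G.Adj s x := by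
  simp [nbrs]

theorem card_swap_le (C S N : Finset V) (hS : S ⊆ C) :
    ((C \ S) ∪ N).card + S.card ≤ C.card + N.card := by
  have h1 := Finset.card_union_le (C \ S) N
  have h2 := Finset.card_sdiff_add_card_eq_card hS
  omega

/-- Exchanging `S` for its uncovered neighbours in `A` gives another cover. If there were at most
`|S|` of them, it would be no larger than `C` and have fewer vertices outside `A`. The strictness
comes from the tie-breaking rule. -/
theorem IsCanonical.lt_card_nbrs {A C S : Finset V} (h : IsCanonical G A C) (hS : S ⊆ C \ A)
    (hne : S.Nonempty) : S.card < (nbrs G S (A \ C)).card := by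
  by_contra! hle
  have hSC : S ⊆ C := hS.trans Finset.sdiff_subset
  have hcov : IsCover G A ((C \ S) ∪ nbrs G S (A \ C)) := by
    intro u hu v hv huv
    simp only [Finset.mem_union, Finset.mem_sdiff, mem_nbrs]
    by_cases huC : u ∈ C
    · exact Or.inl (Or.inl ⟨huC, fun hus => (Finset.mem_sdiff.1 (hS hus)).2 hu⟩)
    · have hvC := (h.cover u hu v hv huv).resolve_left huC
      by_cases hvS : v ∈ S
      · exact Or.inl (Or.inr ⟨⟨hu, huC⟩, v, hvS, huv.symm⟩)
      · exact Or.inr (Or.inl ⟨hvC, hvS⟩)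
  have h1 := card_swap_le C S (nbrs G S (A \ C)) hSC
  have h2 := h.card_le _ hcov
  have h3 := h.outer_le _ hcov (by omega)
  have h4 : ((C \ S) ∪ nbrs G S (A \ C)) \ A ⊆ (C \ A) \ S := by
    intro x hx
    simp only [Finset.mem_union, Finset.mem_sdiff, mem_nbrs] at hx ⊢
    tauto
  have h5 := Finset.card_le_card h4
  have h6 := Finset.card_sdiff_add_card_eq_card hS
  have h7 := hne.card_pos
  omega

/-- The same exchange from the inside to the outside; only the minimality of the cover is available
here, so the inequality is not strict. -/
theorem IsCanonical.card_le_card_nbrs {A C S : Finset V} (h : IsCanonical G A C)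
    (hS : S ⊆ C ∩ A) : S.card ≤ (nbrs G S (Aᶜ \ C)).card := by
  by_contra! hlt
  have hSC : S ⊆ C := hS.trans Finset.inter_subset_left
  have hcov : IsCover G A ((C \ S) ∪ nbrs G S (Aᶜ \ C)) := by
    intro u hu v hv huv
    simp only [Finset.mem_union, Finset.mem_sdiff, mem_nbrs, Finset.mem_compl]
    by_cases hvC : v ∈ C
    · exact Or.inr (Or.inl ⟨hvC, fun hvs => hv (Finset.mem_inter.1 (hS hvs)).2⟩)
    · have huC := (h.cover u hu v hv huv).resolve_right hvC
      by_cases huS : u ∈ S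
      · exact Or.inr (Or.inr ⟨⟨hv, hvC⟩, u, huS, huv⟩)
      · exact Or.inl (Or.inl ⟨huC, huS⟩)
  have h1 := card_swap_le C S (nbrs G S (Aᶜ \ C)) hSC
  have h2 := h.card_le _ hcov
  omega

/-- Canonical covers of nested cuts are compatible. -/
theorem IsCanonical.compat {A B C E : Finset V} (hA : IsCanonical G A C) (hB : IsCanonical G B E)
    (hBA : B ⊆ A) : E \ A ⊆ C ∧ C ∩ B ⊆ E := by
  -- `U` and `W` are the two possible violations. A neighbour of `W` in `B \ E` has to be in `C`,
  -- hence in `U`; a neighbour of `U` outside `A ∪ C` has to be in `E`, hence in `W`. The exchange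
  -- inequalities give `|U| ≤ |W|`, and `|W| < |U|` unless `W` is empty.
  set U := (C ∩ B) \ E with hU
  set W := (E \ A) \ C with hW
  have h1 : nbrs G W (B \ E) ⊆ U := by
    intro x hx
    obtain ⟨hx1, w, hw, hwx⟩ := mem_nbrs.1 hx
    simp only [hU, hW, Finset.mem_sdiff, Finset.mem_inter] at hx1 hw ⊢
    exact ⟨⟨(hA.cover x (hBA hx1.1) w hw.1.2 hwx.symm).resolve_right hw.2, hx1.1⟩, hx1.2⟩
  have h2 : nbrs G U (Aᶜ \ C) ⊆ W := by
    intro x hx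
    obtain ⟨hx1, w, hw, hwx⟩ := mem_nbrs.1 hx
    simp only [hU, hW, Finset.mem_sdiff, Finset.mem_inter, Finset.mem_compl] at hx1 hw ⊢
    exact ⟨⟨(hB.cover w hw.1.2 x (fun h => hx1.1 (hBA h)) hwx).resolve_left hw.2, hx1.1⟩, hx1.2⟩
  have h3 : U.card ≤ W.card := (hA.card_le_card_nbrs (fun x hx => by
    simp only [hU, Finset.mem_sdiff, Finset.mem_inter] at hx ⊢
    exact ⟨hx.1.1, hBA hx.1.2⟩)).trans (Finset.card_le_card h2)
  have h4 : W = ∅ := by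
    by_contra hne
    have := hB.lt_card_nbrs (S := W) (fun x hx => by
      simp only [hW, Finset.mem_sdiff] at hx ⊢
      exact ⟨hx.1.1, fun h => hx.1.2 (hBA h)⟩) (Finset.nonempty_iff_ne_empty.2 hne)
    have := Finset.card_le_card h1
    omega
  have h5 : U = ∅ := by
    rw [h4, Finset.card_empty, Nat.le_zero, Finset.card_eq_zero] at h3
    exact h3
  exact ⟨Finset.sdiff_eq_empty_iff_subset.1 h4, Finset.sdiff_eq_empty_iff_subset.1 h5⟩

/-- A nonempty outer part would have at least two neighbours in `A`. -/
theorem IsCanonical.outer_eq_empty {A C : Finset V} (h : IsCanonical G A C) (hA : A.card ≤ 1) :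
    C \ A = ∅ := by
  by_contra hne
  have h1 := h.lt_card_nbrs (S := C \ A) subset_rfl (Finset.nonempty_iff_ne_empty.2 hne)
  have h2 : (nbrs G (C \ A) (A \ C)).card ≤ A.card :=
    Finset.card_le_card fun x hx => (Finset.mem_sdiff.1 (mem_nbrs.1 hx).1).1
  have h3 := Finset.card_pos.2 (Finset.nonempty_iff_ne_empty.2 hne)
  omega

theorem exists_hall {S X : Finset V} (h : ∀ S' ⊆ S, S'.card ≤ (nbrs G S' X).card) :
    ∃ f : S → V, Function.Injective f ∧ ∀ s, f s ∈ X ∧ G.Adj s (f s) := by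
  obtain ⟨f, hf, hf'⟩ := (Finset.all_card_le_biUnion_card_iff_exists_injective
    (fun s : S => nbrs G {(s : V)} X)).1 (by
      intro T
      have h1 := h (T.map (Function.Embedding.subtype _)) (by
        intro x hx
        obtain ⟨y, -, rfl⟩ := Finset.mem_map.1 hx
        exact y.2)
      rw [Finset.card_map] at h1
      refine h1.trans (Finset.card_le_card ?_)
      intro x hx
      obtain ⟨hx1, s, hs, hsx⟩ := mem_nbrs.1 hx
      obtain ⟨y, hy, rfl⟩ := Finset.mem_map.1 hs
      exact Finset.mem_biUnion.2 ⟨y, hy, mem_nbrs.2 ⟨hx1, y, by simp, hsx⟩⟩)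
  refine ⟨f, hf, fun s => ?_⟩
  obtain ⟨h1, t, ht, h2⟩ := mem_nbrs.1 (hf' s)
  rw [Finset.mem_singleton] at ht
  exact ⟨h1, ht ▸ h2⟩

/-- König's argument: the exchange inequalities are Hall's condition for matching `C ∩ A` into the
uncovered vertices outside `A`, and `C \ A` into the uncovered vertices of `A`. Together this is a
matching of the cut that saturates `C`. -/
theorem IsCanonical.card_le_mm {A C : Finset V} (h : IsCanonical G A C) :
    C.card ≤ mm G (A : Set V) := by
  obtain ⟨f, hf, hf'⟩ := exists_hall (G := G) (S := C ∩ A) (X := Aᶜ \ C)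
    fun S hS => h.card_le_card_nbrs hS
  obtain ⟨g, hg, hg'⟩ := exists_hall (G := G) (S := C \ A) (X := A \ C) fun S hS => by
    rcases S.eq_empty_or_nonempty with rfl | hne
    · simp
    · exact (h.lt_card_nbrs hS hne).le
  have hφ : ∀ c : C, ∃ x : V, (∃ hc : (c : V) ∈ C ∩ A, x = f ⟨c, hc⟩) ∨
      (∃ hc : (c : V) ∈ C \ A, x = g ⟨c, hc⟩) := by
    intro c
    by_cases hc : (c : V) ∈ A
    · exact ⟨_, Or.inl ⟨Finset.mem_inter.2 ⟨c.2, hc⟩, rfl⟩⟩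
    · exact ⟨_, Or.inr ⟨Finset.mem_sdiff.2 ⟨c.2, hc⟩, rfl⟩⟩
  choose φ hφ using hφ
  have hinj : Function.Injective φ := by
    intro c c' hcc
    rcases hφ c with ⟨h1, e1⟩ | ⟨h1, e1⟩ <;> rcases hφ c' with ⟨h2, e2⟩ | ⟨h2, e2⟩
    · have := hf (e1.symm.trans (hcc.trans e2))
      exact Subtype.ext (by simpa using this)
    · have h3 := (hf' ⟨c, h1⟩).1
      have h4 := (hg' ⟨c', h2⟩).1
      rw [← e1, hcc, e2] at h3
      simp only [Finset.mem_sdiff, Finset.mem_compl] at h3 h4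
      exact absurd h4.1 h3.1
    · have h3 := (hg' ⟨c, h1⟩).1
      have h4 := (hf' ⟨c', h2⟩).1
      rw [← e1, hcc, e2] at h3
      simp only [Finset.mem_sdiff, Finset.mem_compl] at h3 h4
      exact absurd h3.1 h4.1
    · have := hg (e1.symm.trans (hcc.trans e2))
      exact Subtype.ext (by simpa using this)
  -- Every matching edge has exactly one end in `C`, so edges from different vertices of `C` are
  -- distinct and disjoint.
  have hnot : ∀ c, φ c ∉ C := by
    intro c
    rcases hφ c with ⟨h1, e1⟩ | ⟨h1, e1⟩ <;> rw [e1]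
    · exact (Finset.mem_sdiff.1 (hf' ⟨c, h1⟩).1).2
    · exact (Finset.mem_sdiff.1 (hg' ⟨c, h1⟩).1).2
  have hadj : ∀ c : C, (G.between (A : Set V) (A : Set V)ᶜ).Adj c (φ c) := by
    intro c
    rw [SimpleGraph.between_adj]
    rcases hφ c with ⟨h1, e1⟩ | ⟨h1, e1⟩ <;> rw [e1]
    · have := hf' ⟨c, h1⟩
      simp only [Finset.mem_sdiff, Finset.mem_compl, Finset.mem_inter] at this h1
      exact ⟨this.2, Or.inl ⟨h1.2, this.1.1⟩⟩
    · have := hg' ⟨c, h1⟩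
      simp only [Finset.mem_sdiff] at this h1
      exact ⟨this.2, Or.inr ⟨h1.2, this.1.1⟩⟩
  have hM := SimpleGraph.Subgraph.IsMatching.iSup
    (f := fun c : C => (G.between (A : Set V) (A : Set V)ᶜ).subgraphOfAdj (hadj c))
    (fun c => SimpleGraph.Subgraph.IsMatching.subgraphOfAdj (hadj c)) (by
      intro c c' hcc
      have h1 : (c : V) ≠ c' := fun h => hcc (Subtype.ext h)
      have h2 : φ c ≠ φ c' := fun h => hcc (hinj h)
      have h3 : (c : V) ≠ φ c' := fun h => hnot c' (h ▸ c.2)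
      have h4 : φ c ≠ c' := fun h => hnot c (h ▸ c'.2)
      simp only [SimpleGraph.support_subgraphOfAdj]
      rw [Set.disjoint_left]
      rintro x (rfl | rfl) <;> simp_all)
  have hcard : (⨆ c : C, (G.between (A : Set V) (A : Set V)ᶜ).subgraphOfAdj
      (hadj c)).edgeSet.ncard = C.card := by
    rw [SimpleGraph.Subgraph.edgeSet_iSup]
    have : (⋃ c : C, ((G.between (A : Set V) (A : Set V)ᶜ).subgraphOfAdj (hadj c)).edgeSet) =
        Set.range fun c : C => s((c : V), φ c) := by
      ext e
      simp [eq_comm]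
    rw [this, ← Set.image_univ, Set.ncard_image_of_injective, Set.ncard_univ]
    · simp
    · intro c c' hcc
      simp only [Sym2.eq_iff] at hcc
      rcases hcc with h1 | h1
      · exact Subtype.ext h1.1
      · exact absurd c.2 (h1.1 ▸ hnot c')
  refine le_csSup ?_ ⟨_, hM, hcard⟩
  exact ⟨(Set.univ : Set (Sym2 V)).ncard, by
    rintro r ⟨M, -, rfl⟩
    exact Set.ncard_le_ncard (Set.subset_univ _)⟩

end Cuts

end SMWidth

namespace SMWidth

/-! ### Partial cuts and their states -/

section Partial

variable {V : Type*} [Fintype V] [DecidableEq V] (G : SimpleGraph V)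

open Classical in
/-- The number of edges inside `X` that are cut by `L`. -/
noncomputable def innerCut (L X : Finset V) : ℕ :=
  ∑ u ∈ X, ∑ v ∈ X, if G.Adj u v ∧ u ∈ L ∧ v ∉ L then 1 else 0

open Classical in
/-- The number of edges between `Y` and `Z` that are cut by `L`. -/
noncomputable def crossCut (L Y Z : Finset V) : ℕ :=
  ∑ y ∈ Y, ∑ z ∈ Z, if G.Adj y z ∧ (y ∈ L ↔ z ∉ L) then 1 else 0

/-- The edges that a partial solution for the cut `A` with cover `C` accounts for: those inside `A`
and those between `A` and the outer part of the cover. -/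
noncomputable def partialCut (A C L : Finset V) : ℕ := innerCut G L A + crossCut G L (C \ A) A

open Classical in
/-- The number of neighbours of `v` in `L ∩ X`. -/
noncomputable def degIn (L X : Finset V) (v : V) : ℕ := (X.filter fun x => G.Adj v x ∧ x ∈ L).card

/-- `L` and `L'` have the same state at the cut `A` with cover `C`. -/
def SameState (A C L L' : Finset V) : Prop :=
  (∀ v, v ∉ A → v ∉ C → degIn G L A v = degIn G L' A v) ∧
    ∀ u ∈ A, degIn G L (C \ A) u = degIn G L' (C \ A) u

/-- The labelling that agrees with `L` on `A` and with `L'` outside. -/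
def glue (A L L' : Finset V) : Finset V := (L ∩ A) ∪ (L' \ A)

variable {G}

theorem mem_glue {A L L' : Finset V} {v : V} :
    v ∈ glue A L L' ↔ if v ∈ A then v ∈ L else v ∈ L' := by
  simp only [glue, Finset.mem_union, Finset.mem_inter, Finset.mem_sdiff]
  split_ifs with h <;> simp [h]

theorem degIn_congr {L L' X : Finset V} {v : V} (h : ∀ x ∈ X, x ∈ L ↔ x ∈ L') :
    degIn G L X v = degIn G L' X v := by
  classical
  unfold degIn
  congr 1
  refine Finset.filter_congr fun x hx => ?_
  rw [h x hx]

theorem SameState.symm {A C L L' : Finset V} (h : SameState G A C L L') : SameState G A C L' L :=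
  ⟨fun v h1 h2 => (h.1 v h1 h2).symm, fun u hu => (h.2 u hu).symm⟩

theorem SameState.trans {A C L L' L'' : Finset V} (h : SameState G A C L L')
    (h' : SameState G A C L' L'') : SameState G A C L L'' :=
  ⟨fun v h1 h2 => (h.1 v h1 h2).trans (h'.1 v h1 h2), fun u hu => (h.2 u hu).trans (h'.2 u hu)⟩

theorem SameState.rfl {A C L : Finset V} : SameState G A C L L :=
  ⟨fun _ _ _ => Eq.refl _, fun _ _ => Eq.refl _⟩

theorem innerCut_congr {L L' X : Finset V} (h : ∀ x ∈ X, x ∈ L ↔ x ∈ L') :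
    innerCut G L X = innerCut G L' X := by
  classical
  unfold innerCut
  refine Finset.sum_congr rfl fun u hu => Finset.sum_congr rfl fun v hv => ?_
  exact if_congr (and_congr_right fun _ => by rw [h u hu, h v hv]) rfl rfl

theorem crossCut_comm (L Y Z : Finset V) : crossCut G L Y Z = crossCut G L Z Y := by
  unfold crossCut
  rw [Finset.sum_comm]
  refine Finset.sum_congr rfl fun u _ => Finset.sum_congr rfl fun v _ => ?_
  congr 1
  rw [G.adj_comm]
  apply propext
  tauto

theorem crossCut_union_left {L Y Y' Z : Finset V} (h : Disjoint Y Y') :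
    crossCut G L (Y ∪ Y') Z = crossCut G L Y Z + crossCut G L Y' Z :=
  Finset.sum_union h

theorem crossCut_union_right {L Y Z Z' : Finset V} (h : Disjoint Z Z') :
    crossCut G L Y (Z ∪ Z') = crossCut G L Y Z + crossCut G L Y Z' := by
  rw [crossCut_comm, crossCut_union_left h, crossCut_comm L Z, crossCut_comm L Z']

/-- An unlabelled `y` contributes its number of labelled neighbours in `Z`, a labelled one the rest
of its degree in `Z`. So the label of `y` and this number suffice. -/
theorem crossCut_congr {L L' Y Z : Finset V} (hY : ∀ y ∈ Y, y ∈ L ↔ y ∈ L')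
    (hZ : ∀ y ∈ Y, degIn G L Z y = degIn G L' Z y) : crossCut G L Y Z = crossCut G L' Y Z := by
  classical
  unfold crossCut
  refine Finset.sum_congr rfl fun y hy => ?_
  have key : ∀ M : Finset V, (Z.filter fun z => G.Adj y z ∧ z ∉ M).card + degIn G M Z y =
      (Z.filter fun z => G.Adj y z).card := by
    intro M
    unfold degIn
    rw [← Finset.card_filter_add_card_filter_not (s := Z.filter fun z => G.Adj y z)
      (fun z => z ∉ M), Finset.filter_filter, Finset.filter_filter]
    congr 2
    ext z
    simp
  simp only [← Finset.card_filter]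
  have h1 := key L
  have h2 := key L'
  have h3 := hZ y hy
  by_cases hyL : y ∈ L
  · have hyL' := (hY y hy).1 hyL
    simp only [hyL, hyL', true_iff]
    omega
  · have hyL' : y ∉ L' := fun h => hyL ((hY y hy).2 h)
    simp only [hyL, hyL', false_iff, not_not]
    exact h3

theorem innerCut_union {L X Y : Finset V} (h : Disjoint X Y) :
    innerCut G L (X ∪ Y) = innerCut G L X + innerCut G L Y + crossCut G L Y X := by
  classical
  have h1 : innerCut G L (X ∪ Y) = innerCut G L X + innerCut G L Y +
      ((∑ u ∈ X, ∑ v ∈ Y, if G.Adj u v ∧ u ∈ L ∧ v ∉ L then 1 else 0) +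
        ∑ u ∈ Y, ∑ v ∈ X, if G.Adj u v ∧ u ∈ L ∧ v ∉ L then 1 else 0) := by
    unfold innerCut
    rw [Finset.sum_union h]
    simp only [Finset.sum_union h, Finset.sum_add_distrib]
    ring
  rw [h1, Finset.sum_comm (s := X) (t := Y), ← Finset.sum_add_distrib]
  congr 1
  unfold crossCut
  refine Finset.sum_congr rfl fun u _ => ?_
  rw [← Finset.sum_add_distrib]
  refine Finset.sum_congr rfl fun v _ => ?_
  rw [G.adj_comm v u]
  by_cases h1 : G.Adj u v <;> by_cases h2 : u ∈ L <;> by_cases h3 : v ∈ L <;> simp [h1, h2, h3]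

/-- Replacing the labelling outside a cut by one with the same state. -/
theorem SameState.glue_right {A C L M : Finset V} (h : SameState G A C L M) :
    SameState G A C (glue A L M) M ∧ partialCut G A C (glue A L M) = partialCut G A C L := by
  have hin : ∀ x ∈ A, x ∈ glue A L M ↔ x ∈ L := fun x hx => by simp [mem_glue, hx]
  have hout : ∀ x ∈ C \ A, x ∈ glue A L M ↔ x ∈ M := fun x hx => by
    simp [mem_glue, (Finset.mem_sdiff.1 hx).2]
  refine ⟨⟨fun v h1 h2 => (degIn_congr hin).trans (h.1 v h1 h2), fun u hu => degIn_congr hout⟩, ?_⟩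
  unfold partialCut
  -- The edges to `C \ A` are counted from the side of `A`, where the labels agree with `L` and the
  -- second half of the state gives the numbers of labelled neighbours.
  rw [innerCut_congr hin, crossCut_comm, crossCut_comm L, crossCut_congr hin]
  exact fun u hu => (degIn_congr hout).trans (h.2 u hu).symm

/-- Replacing the labelling inside a nested cut by a better one with the same state. -/
theorem SameState.exchange {A B C E L M : Finset V} (hA : IsCanonical G A C)
    (hB : IsCanonical G B E) (hBA : B ⊆ A) (h : SameState G B E M L)
    (hle : partialCut G B E L ≤ partialCut G B E M) :
    SameState G A C (glue B M L) L ∧ partialCut G A C L ≤ partialCut G A C (glue B M L) := by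
  obtain ⟨hEA, hCB⟩ := hA.compat hB hBA
  obtain ⟨hs, hc⟩ := h.glue_right
  rw [← hc] at hle
  have hoff : ∀ x, x ∉ B → (x ∈ glue B M L ↔ x ∈ L) := fun x hx => by simp [mem_glue, hx]
  clear hc h
  -- From here on only three facts about the glued labelling matter: it agrees with `L` off `B`, has
  -- the state of `L` at `B`, and is at least as good there.
  generalize glue B M L = M at *
  have hsplit : ∀ N : Finset V, ∀ v, degIn G N A v = degIn G N B v + degIn G N (A \ B) v := by
    classical
    intro N v
    unfold degIn
    rw [← Finset.card_union_of_disjoint, ← Finset.filter_union, Finset.union_sdiff_of_subset hBA]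
    exact Finset.disjoint_filter_filter Finset.disjoint_sdiff
  refine ⟨⟨fun v h1 h2 => ?_, fun u hu => ?_⟩, ?_⟩
  · rw [hsplit, hsplit, hs.1 v (fun h => h1 (hBA h))
      (fun h => h2 (hEA (Finset.mem_sdiff.2 ⟨h, h1⟩)))]
    congr 1
    exact degIn_congr fun x hx => hoff x (Finset.mem_sdiff.1 hx).2
  · exact degIn_congr fun x hx => hoff x fun hx' => (Finset.mem_sdiff.1 hx).2 (hBA hx')
  · set Q := (A \ B) ∪ (C \ A) with hQ
    have dQ : Disjoint (A \ B) (C \ A) :=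
      Finset.disjoint_left.2 fun x h1 h2 => (Finset.mem_sdiff.1 h2).2 (Finset.mem_sdiff.1 h1).1
    -- `E \ B ⊆ Q` is where the compatibility `E \ A ⊆ C` enters: every edge counted at `B` is
    -- counted at `A`.
    have hQE : Q = (E \ B) ∪ (Q \ E) := by
      ext x
      have h1 := @hEA x
      have h2 := @hBA x
      simp only [hQ, Finset.mem_union, Finset.mem_sdiff] at h1 ⊢
      tauto
    have dE : Disjoint (E \ B) (Q \ E) :=
      Finset.disjoint_left.2 fun x h1 h2 => (Finset.mem_sdiff.1 h2).2 (Finset.mem_sdiff.1 h1).1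
    have hAB : B ∪ (A \ B) = A := Finset.union_sdiff_of_subset hBA
    -- The summands after the partial cut at `B` do not see the change inside `B`: two avoid `B`
    -- altogether, and edges from `Q \ E` to `B` are counted through the state at `B`.
    have dec : ∀ N : Finset V, partialCut G A C N = partialCut G B E N + (innerCut G N (A \ B) +
        crossCut G N (C \ A) (A \ B) + crossCut G N (Q \ E) B) := by
      intro N
      have e1 : innerCut G N A = innerCut G N B + innerCut G N (A \ B) + crossCut G N (A \ B) B := by
        conv_lhs => rw [← hAB]
        exact innerCut_union Finset.disjoint_sdiff
      have e2 : crossCut G N (C \ A) A = crossCut G N (C \ A) B + crossCut G N (C \ A) (A \ B) := by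
        have := crossCut_union_right (G := G) (L := N) (Y := C \ A)
          (Finset.disjoint_sdiff (s := B) (t := A))
        rwa [hAB] at this
      have e3 : crossCut G N (A \ B) B + crossCut G N (C \ A) B = crossCut G N Q B :=
        (crossCut_union_left dQ).symm
      have e4 : crossCut G N Q B = crossCut G N (E \ B) B + crossCut G N (Q \ E) B := by
        conv_lhs => rw [hQE]
        exact crossCut_union_left dE
      unfold partialCut
      omega
    have hQB : ∀ x ∈ Q, x ∉ B := by
      intro x hx hxB
      have := hBA hxB
      simp only [hQ, Finset.mem_union, Finset.mem_sdiff] at hx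
      tauto
    rw [dec L, dec M]
    have f1 : innerCut G M (A \ B) = innerCut G L (A \ B) :=
      innerCut_congr fun x hx => hoff x (Finset.mem_sdiff.1 hx).2
    have f2 : crossCut G M (C \ A) (A \ B) = crossCut G L (C \ A) (A \ B) :=
      crossCut_congr (fun x hx => hoff x fun hx' => (Finset.mem_sdiff.1 hx).2 (hBA hx'))
        fun y _ => degIn_congr fun x hx => hoff x (Finset.mem_sdiff.1 hx).2
    have f3 : crossCut G M (Q \ E) B = crossCut G L (Q \ E) B :=
      crossCut_congr (fun x hx => hoff x (hQB x (Finset.mem_sdiff.1 hx).1))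
        fun y hy => hs.1 y (hQB y (Finset.mem_sdiff.1 hy).1) (Finset.mem_sdiff.1 hy).2
    omega

/-- A labelling that is the same on the cover has the same state. -/
theorem IsCover.sameState {A C L L' : Finset V} (h : IsCover G A C)
    (hL : ∀ x ∈ C, x ∈ L ↔ x ∈ L') : SameState G A C L L' := by
  classical
  refine ⟨fun v h1 h2 => ?_, fun u _ => degIn_congr fun x hx => hL x (Finset.mem_sdiff.1 hx).1⟩
  unfold degIn
  congr 1
  refine Finset.filter_congr fun x hx => ?_
  -- A neighbour in `A` of a vertex outside `A ∪ C` must belong to the cover.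
  refine and_congr_right fun hvx => hL x ?_
  exact (h x hx v h1 hvx.symm).resolve_right h2

/-! ### Cuts of rank one -/

variable (G) in
/-- The vertices with a neighbour on the other side of the cut `A`. -/
def IsFrontier (A : Finset V) (v : V) : Prop := ∃ w, G.Adj v w ∧ ¬(v ∈ A ↔ w ∈ A)

variable (G) in
/-- The cut has rank at most one: its frontiers are completely joined. -/
def IsRankOne (A : Finset V) : Prop :=
  ∀ u ∈ A, ∀ v, v ∉ A → IsFrontier G A u → IsFrontier G A v → G.Adj u v

open Classical in
variable (G) in
/-- The smaller side of the frontier of a cut. -/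
noncomputable def smallSide (A : Finset V) : Finset V :=
  if (A.filter (IsFrontier G A)).card ≤ (Aᶜ.filter (IsFrontier G A)).card then
    A.filter (IsFrontier G A) else Aᶜ.filter (IsFrontier G A)

/-- The cut is a complete bipartite graph between the two frontiers, apart from isolated vertices. A
cover that misses a vertex of either frontier must contain all of the other one. -/
theorem IsRankOne.isCanonical {A : Finset V} (h : IsRankOne G A) :
    IsCanonical G A (smallSide G A) := by
  classical
  have hfr : ∀ u ∈ A, ∀ v, v ∉ A → G.Adj u v → IsFrontier G A u ∧ IsFrontier G A v :=
    fun u hu v hv huv => ⟨⟨v, huv, by simp [hu, hv]⟩, ⟨u, huv.symm, by simp [hu, hv]⟩⟩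
  have hcov : IsCover G A (smallSide G A) := by
    intro u hu v hv huv
    obtain ⟨h1, h2⟩ := hfr u hu v hv huv
    unfold smallSide
    split_ifs
    · exact Or.inl (Finset.mem_filter.2 ⟨hu, h1⟩)
    · exact Or.inr (Finset.mem_filter.2 ⟨Finset.mem_compl.2 hv, h2⟩)
  have hor : ∀ C', IsCover G A C' → A.filter (IsFrontier G A) ⊆ C' ∨
      Aᶜ.filter (IsFrontier G A) ⊆ C' := by
    intro C' hC'
    by_contra! hcon
    obtain ⟨⟨u, hu, hu'⟩, ⟨v, hv, hv'⟩⟩ := And.imp Finset.not_subset.1 Finset.not_subset.1 hcon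
    rw [Finset.mem_filter] at hu hv
    have hvA := Finset.mem_compl.1 hv.1
    rcases hC' u hu.1 v hvA (h u hu.1 v hvA hu.2 hv.2) with h1 | h1
    · exact hu' h1
    · exact hv' h1
  refine ⟨hcov, fun C' hC' => ?_, fun C' hC' hcard => ?_⟩
  · rcases hor C' hC' with h1 | h1 <;> have := Finset.card_le_card h1 <;> unfold smallSide <;>
      split_ifs <;> omega
  -- In a tie the inner frontier is chosen, which has no outer vertices. Otherwise the outer
  -- frontier is strictly smaller, and then every cover of the same size is equal to it.
  · by_cases hle : (A.filter (IsFrontier G A)).card ≤ (Aᶜ.filter (IsFrontier G A)).card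
    · have : smallSide G A \ A = ∅ := by
        rw [smallSide, if_pos hle, Finset.sdiff_eq_empty_iff_subset]
        exact Finset.filter_subset _ _
      simp [this]
    · have e : smallSide G A = Aᶜ.filter (IsFrontier G A) := by rw [smallSide, if_neg hle]
      rw [e] at hcard ⊢
      rcases hor C' hC' with h1 | h1
      · have := Finset.card_le_card h1
        omega
      · rw [Finset.eq_of_subset_of_card_le h1 hcard.le]

/-- At a cut of rank one the state is determined by the number of labels in the cover. -/
theorem IsRankOne.sameState {A L L' : Finset V} (h : IsRankOne G A)
    (hL : (L ∩ smallSide G A).card = (L' ∩ smallSide G A).card) :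
    SameState G A (smallSide G A) L L' := by
  classical
  by_cases hle : (A.filter (IsFrontier G A)).card ≤ (Aᶜ.filter (IsFrontier G A)).card
  · have e : smallSide G A = A.filter (IsFrontier G A) := by rw [smallSide, if_pos hle]
    rw [e] at hL ⊢
    refine ⟨fun v h1 h2 => ?_, fun u _ => ?_⟩
    · by_cases hv : IsFrontier G A v
      -- A frontier vertex sees the whole opposite frontier, so its number of labelled neighbours is
      -- the number of labels there.
      · have key : ∀ M : Finset V, degIn G M A v = (M ∩ A.filter (IsFrontier G A)).card := by
          intro M
          unfold degIn
          congr 1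
          ext x
          simp only [Finset.mem_filter, Finset.mem_inter]
          constructor
          · rintro ⟨hx, hvx, hxM⟩
            exact ⟨hxM, hx, v, hvx.symm, by simp [hx, h1]⟩
          · rintro ⟨hxM, hx, hxF⟩
            exact ⟨hx, (h x hx v h1 hxF hv).symm, hxM⟩
        rw [key, key, hL]
      · have key : ∀ M : Finset V, degIn G M A v = 0 := by
          intro M
          unfold degIn
          rw [Finset.card_eq_zero, Finset.filter_eq_empty_iff]
          rintro x hx ⟨hvx, -⟩
          exact hv ⟨x, hvx, by simp [hx, h1]⟩
        rw [key, key]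
    · have : A.filter (IsFrontier G A) \ A = ∅ :=
        Finset.sdiff_eq_empty_iff_subset.2 (Finset.filter_subset _ _)
      rw [this]; rfl
  · have e : smallSide G A = Aᶜ.filter (IsFrontier G A) := by rw [smallSide, if_neg hle]
    rw [e] at hL ⊢
    have e2 : Aᶜ.filter (IsFrontier G A) \ A = Aᶜ.filter (IsFrontier G A) := by
      rw [Finset.sdiff_eq_self_iff_disjoint, Finset.disjoint_left]
      intro x hx
      exact Finset.mem_compl.1 (Finset.mem_filter.1 hx).1
    rw [SameState, e2]
    refine ⟨fun v h1 h2 => ?_, fun u hu => ?_⟩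
    · have hv : ¬ IsFrontier G A v := fun hv =>
        h2 (Finset.mem_filter.2 ⟨Finset.mem_compl.2 h1, hv⟩)
      have key : ∀ M : Finset V, degIn G M A v = 0 := by
        intro M
        unfold degIn
        rw [Finset.card_eq_zero, Finset.filter_eq_empty_iff]
        rintro x hx ⟨hvx, -⟩
        exact hv ⟨x, hvx, by simp [hx, h1]⟩
      rw [key, key]
    · by_cases hu' : IsFrontier G A u
      · have key : ∀ M : Finset V, degIn G M (Aᶜ.filter (IsFrontier G A)) u =
            (M ∩ Aᶜ.filter (IsFrontier G A)).card := by
          intro M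
          unfold degIn
          congr 1
          ext x
          simp only [Finset.mem_filter, Finset.mem_inter, Finset.mem_compl]
          constructor
          · rintro ⟨hx, hux, hxM⟩
            exact ⟨hxM, hx⟩
          · rintro ⟨hxM, hx, hxF⟩
            exact ⟨⟨hx, hxF⟩, h u hu x hx hu' hxF, hxM⟩
        rw [key, key, hL]
      · have key : ∀ M : Finset V, degIn G M (Aᶜ.filter (IsFrontier G A)) u = 0 := by
          intro M
          unfold degIn
          rw [Finset.card_eq_zero, Finset.filter_eq_empty_iff]
          rintro x hx ⟨hux, -⟩
          rw [Finset.mem_filter, Finset.mem_compl] at hx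
          exact hu' ⟨x, hux, by simp [hu, hx.1]⟩
        rw [key, key]

/-- A split is a cut of rank one. -/
theorem IsSplit.isRankOne {A : Finset V} (h : IsSplit G (A : Set V)) : IsRankOne G A := by
  rintro u hu v hv ⟨w, huw, hw⟩ ⟨x, hvx, hx⟩
  have hw' : w ∉ A := by simpa [hu] using hw
  have hx' : x ∈ A := by
    by_contra hx'
    exact hx (by simp [hv, hx'])
  have := h.2.2 u hu x hx' ⟨w, huw, hw'⟩ ⟨v, hvx.symm, hv⟩
  have hmem : v ∈ G.neighborSet x ∩ (A : Set V)ᶜ := ⟨hvx.symm, hv⟩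
  rw [← this] at hmem
  exact hmem.1

/-- Such a cut is not a split, so `sm` is its matching number. This is the only place where the
definition of the width enters the size of the tables. -/
theorem card_le_sm {A C : Finset V} (h : IsCanonical G A C) (hr : ¬ IsRankOne G A) :
    C.card ≤ sm G (A : Set V) := by
  rw [sm, if_neg fun hs => hr (IsSplit.isRankOne hs)]
  exact h.card_le_mm

/-- With all vertices inside, the partial cut is the cut. -/
theorem partialCut_univ (L : Finset V) : partialCut G Finset.univ ∅ L = cutSize G (L : Set V) := by
  classical
  have h1 : crossCut G L (∅ \ Finset.univ) Finset.univ = 0 := by simp [crossCut]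
  rw [partialCut, h1, add_zero, innerCut, ← Finset.sum_product', ← Finset.card_filter, cutSize]
  rw [← Set.ncard_coe_finset]
  refine Set.ncard_congr (fun p _ => s(p.1, p.2)) ?_ ?_ ?_
  · rintro ⟨u, v⟩ h
    simp only [Finset.coe_filter, Set.mem_ofPred_eq] at h
    exact ⟨h.2.1, Or.inl ⟨h.2.2.1, h.2.2.2⟩⟩
  · rintro ⟨u, v⟩ ⟨u', v'⟩ h h' he
    simp only [Finset.coe_filter, Set.mem_ofPred_eq] at h h'
    rcases Sym2.eq_iff.1 he with ⟨h1, h2⟩ | ⟨h1, h2⟩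
    · exact Prod.ext h1 h2
    · exact absurd h.2.2.1 (by simp only at h1; rw [h1]; exact h'.2.2.2)
  · intro e
    induction e using Sym2.ind with
    | _ u v =>
      rintro ⟨huv, ⟨h1, h2⟩ | ⟨h1, h2⟩⟩
      · exact ⟨(u, v), by simpa using ⟨huv, h1, h2⟩, rfl⟩
      · exact ⟨(v, u), by simpa using ⟨huv.symm, h2, h1⟩, Sym2.eq_swap⟩

/-- Allows the label of the root vertex to be fixed. -/
theorem partialCut_compl (L : Finset V) :
    partialCut G Finset.univ ∅ Lᶜ = partialCut G Finset.univ ∅ L := by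
  rw [partialCut_univ, partialCut_univ, cutSize, cutSize, Finset.coe_compl, compl_compl,
    SimpleGraph.between_comm]

end Partial

end SMWidth

namespace SMWidth

/-! ### Components of a tree minus an edge -/

section Trees

variable {N : Type*} {T : SimpleGraph N} {x y z w r : N}

/-- The component of `x` in `T - xy`. -/
def comp (T : SimpleGraph N) (x y : N) : Set N := {w | (T.deleteEdges {s(x, y)}).Reachable x w}

theorem self_mem_comp : x ∈ comp T x y := SimpleGraph.Reachable.refl _

/-- Along a walk from `w` to `x`, read backwards, the component changes only at the edge `xy`, and
its ends lie in the two components. -/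
theorem mem_comp_or (hT : T.IsTree) (w : N) : w ∈ comp T x y ∨ w ∈ comp T y x := by
  obtain ⟨p⟩ := hT.connected.preconnected w x
  have key : ∀ (a b : N) (p : T.Walk a b), b = x → a ∈ comp T x y ∨ a ∈ comp T y x := by
    intro a b p
    induction p with
    | nil => rintro rfl; exact Or.inl self_mem_comp
    | @cons a c b h p ih =>
      intro hb
      by_cases he : s(a, c) = s(x, y)
      · rcases Sym2.eq_iff.1 he with ⟨rfl, -⟩ | ⟨rfl, -⟩
        · exact Or.inl self_mem_comp
        · exact Or.inr self_mem_comp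
      · have h1 : (T.deleteEdges {s(x, y)}).Adj c a := by
          rw [SimpleGraph.deleteEdges_adj]
          exact ⟨h.symm, by rw [Sym2.eq_swap (a := c)]; exact he⟩
        have h2 : (T.deleteEdges {s(y, x)}).Adj c a := by
          rw [Sym2.eq_swap (a := y)]; exact h1
        exact (ih hb).imp (fun h => SimpleGraph.Reachable.trans h h1.reachable)
          (fun h => SimpleGraph.Reachable.trans h h2.reachable)
  exact key w x p rfl

theorem not_mem_comp_both (hT : T.IsTree) (h : T.Adj x y) (h1 : w ∈ comp T x y)
    (h2 : w ∈ comp T y x) : False := by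
  have hb := SimpleGraph.isAcyclic_iff_forall_adj_isBridge.1 hT.isAcyclic h
  rw [SimpleGraph.isBridge_iff] at hb
  unfold comp at h2
  rw [Sym2.eq_swap] at h2
  exact hb (SimpleGraph.Reachable.trans h1 (SimpleGraph.Reachable.symm h2))

theorem mem_comp_iff (hT : T.IsTree) (h : T.Adj x y) : w ∈ comp T x y ↔ w ∉ comp T y x :=
  ⟨fun h1 h2 => not_mem_comp_both hT h h1 h2, fun h1 => (mem_comp_or hT w).resolve_right h1⟩

theorem not_mem_comp (hT : T.IsTree) (h : T.Adj x y) : y ∉ comp T x y := fun h1 =>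
  not_mem_comp_both hT h h1 self_mem_comp

theorem exists_mem_comp (hT : T.IsTree) (hw : w ≠ x) : ∃ z, T.Adj x z ∧ w ∈ comp T z x := by
  obtain ⟨p, hp⟩ := hT.connected.exists_isPath x w
  cases p with
  | nil => exact absurd rfl hw
  | @cons _ z _ h q =>
    refine ⟨z, h, ?_⟩
    rw [SimpleGraph.Walk.cons_isPath_iff] at hp
    refine ⟨q.toDeleteEdge s(z, x) fun he => hp.2 ?_⟩
    exact SimpleGraph.Walk.snd_mem_support_of_mem_edges _ he

/-- The component of `z` in `T - zx` avoids `x`, so none of its edges is deleted together with an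
edge at `x`. -/
theorem reachable_of_mem_comp (hT : T.IsTree) (hz : T.Adj x z) (h : w ∈ comp T z x) (y : N) :
    (T.deleteEdges {s(x, y)}).Reachable z w := by
  obtain ⟨p⟩ := h
  have key : ∀ (a b : N) (p : (T.deleteEdges {s(z, x)}).Walk a b), a ∈ comp T z x →
      (T.deleteEdges {s(x, y)}).Reachable a b := by
    intro a b p
    induction p with
    | nil => intro _; exact SimpleGraph.Reachable.refl _
    | @cons a c b h p ih =>
      intro ha
      have hc : c ∈ comp T z x := SimpleGraph.Reachable.trans ha h.reachable
      have hax : a ≠ x := fun e => not_mem_comp hT hz.symm (e ▸ ha)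
      have hcx : c ≠ x := fun e => not_mem_comp hT hz.symm (e ▸ hc)
      refine SimpleGraph.Reachable.trans (SimpleGraph.Adj.reachable ?_) (ih hc)
      rw [SimpleGraph.deleteEdges_adj] at h ⊢
      refine ⟨h.1, fun he => ?_⟩
      rcases Sym2.eq_iff.1 he with ⟨h1, -⟩ | ⟨-, h1⟩
      · exact hax h1
      · exact hcx h1
  exact key z w p self_mem_comp

theorem comp_unique (hT : T.IsTree) (hz : T.Adj x z) (hy : T.Adj x y) (h1 : w ∈ comp T z x)
    (h2 : w ∈ comp T y x) : z = y := by
  by_contra hne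
  have h3 := reachable_of_mem_comp hT hz h1 y
  have h4 : z ∈ comp T y x := by
    unfold comp at h2 ⊢
    rw [Sym2.eq_swap] at h2 ⊢
    exact SimpleGraph.Reachable.trans h2 h3.symm
  refine not_mem_comp hT hy.symm (SimpleGraph.Reachable.trans h4 (SimpleGraph.Adj.reachable ?_))
  rw [SimpleGraph.deleteEdges_adj]
  refine ⟨hz.symm, fun he => ?_⟩
  rcases Sym2.eq_iff.1 he with ⟨h1, -⟩ | ⟨h1, h1'⟩
  · exact hne h1
  · exact hz.ne h1.symm

/-- The recursion of the dynamic programming: what lies below `x` is `x` itself and what lies below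
its other neighbours. -/
theorem mem_comp_iff_exists (hT : T.IsTree) (hy : T.Adj x y) :
    w ∈ comp T x y ↔ w = x ∨ ∃ z, T.Adj x z ∧ z ≠ y ∧ w ∈ comp T z x := by
  constructor
  · intro h
    by_cases hw : w = x
    · exact Or.inl hw
    · obtain ⟨z, hz, hwz⟩ := exists_mem_comp hT hw
      exact Or.inr ⟨z, hz, fun e => not_mem_comp_both hT hy h (e ▸ hwz), hwz⟩
  · rintro (rfl | ⟨z, hz, hne, hwz⟩)
    · exact self_mem_comp
    · rw [mem_comp_iff hT hy]
      exact fun h => hne (comp_unique hT hz hy hwz h)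

/-! ### Parents in the rooted tree -/

/-- `y` is the parent of `x` in the tree `T` with root `r`. -/
def IsParent (T : SimpleGraph N) (r x y : N) : Prop := T.Adj x y ∧ r ∈ comp T y x

theorem exists_isParent (hT : T.IsTree) (h : x ≠ r) : ∃ y, IsParent T r x y :=
  exists_mem_comp hT h.symm

theorem IsParent.unique (hT : T.IsTree) (hy : IsParent T r x y) (hz : IsParent T r x z) : y = z :=
  comp_unique hT hy.1 hz.1 hy.2 hz.2

theorem isParent_of_not (hT : T.IsTree) (hz : T.Adj x z) (h : ¬ IsParent T r x z) :
    IsParent T r z x :=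
  ⟨hz.symm, (mem_comp_or hT r).resolve_right fun h' => h ⟨hz, h'⟩⟩

theorem IsParent.not_swap (hT : T.IsTree) (h : IsParent T r x y) : ¬ IsParent T r y x := fun h' =>
  not_mem_comp_both hT h.1 h'.2 h.2

theorem IsParent.ne_root (hT : T.IsTree) (h : IsParent T r x y) : x ≠ r := by
  rintro rfl
  exact not_mem_comp hT h.1.symm h.2

theorem IsParent.comp_ssubset (hT : T.IsTree) (hx : IsParent T r x y) (hz : IsParent T r z x) :
    comp T z x ⊂ comp T x y := by
  have hne : z ≠ y := by
    rintro rfl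
    exact hx.not_swap hT hz
  refine ⟨fun w hw => (mem_comp_iff_exists hT hx.1).2 (Or.inr ⟨z, hz.1.symm, hne, hw⟩), fun h => ?_⟩
  exact not_mem_comp hT hz.1 (h self_mem_comp)

/-- A set of nodes that is closed under parents and contains a node other than the root has a
node other than the root all of whose children are outside. -/
theorem exists_outermost [Finite N] (hT : T.IsTree) (S : Set N)
    (hne : ∃ x ∈ S, x ≠ r) :
    ∃ x ∈ S, x ≠ r ∧ ∀ z ∈ S, T.Adj x z → IsParent T r x z := by
  classical
  obtain ⟨x0, hx0, hxr0⟩ := hne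
  obtain ⟨y0, hy0⟩ := exists_isParent hT hxr0
  -- Descend to a child in `S` as long as there is one; the subtree below becomes strictly smaller.
  have key : ∀ (k : ℕ) (x y : N), x ∈ S → IsParent T r x y → (comp T x y).ncard = k →
      ∃ x ∈ S, x ≠ r ∧ ∀ z ∈ S, T.Adj x z → IsParent T r x z := by
    intro k
    induction k using Nat.strong_induction_on with
    | _ k ih =>
      intro x y hx hy hk
      by_cases h : ∀ z ∈ S, T.Adj x z → IsParent T r x z
      · exact ⟨x, hx, hy.ne_root hT, h⟩
      · push Not at h
        obtain ⟨z, hz, hxz, hnp⟩ := h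
        have hp := isParent_of_not hT hxz hnp
        exact ih _ (hk ▸ Set.ncard_lt_ncard (hy.comp_ssubset hT hp) (Set.toFinite _)) z x hz hp rfl
  exact key _ x0 y0 hx0 hy0 rfl

end Trees

/-! ### Branch decompositions -/

section Decomposition

variable {V N : Type*}

theorem BranchDecomposition.mem_side (D : BranchDecomposition V N) {x y : N} {v : V} :
    v ∈ D.side x y ↔ (D.δ.symm v : N) ∈ comp D.tree x y := Iff.rfl

theorem BranchDecomposition.sm_le [Finite N] (D : BranchDecomposition V N) (G : SimpleGraph V)
    {x y : N} (h : D.tree.Adj x y) : sm G (D.side x y) ≤ D.smWidth G := by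
  refine le_csSup (Set.Finite.bddAbove ?_) ⟨x, y, h, rfl⟩
  refine (Set.finite_range fun p : N × N => sm G (D.side p.1 p.2)).subset ?_
  rintro _ ⟨a, b, -, rfl⟩
  exact ⟨(a, b), rfl⟩

/-- Every finite tree has a leaf, counting the node of a one-node tree. Thus there is a vertex whose
leaf can serve as the root. -/
theorem BranchDecomposition.nonempty [Finite N] (D : BranchDecomposition V N) : Nonempty V := by
  classical
  have := Fintype.ofFinite N
  obtain ⟨x⟩ := D.isTree.connected.nonempty
  rcases subsingleton_or_nontrivial N with h | h
  · exact ⟨D.δ ⟨x, by simp⟩⟩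
  · obtain ⟨v, hv⟩ := D.isTree.exists_vert_degree_one_of_nontrivial
    refine ⟨D.δ ⟨v, ?_⟩⟩
    rw [← SimpleGraph.card_neighborSet_eq_degree] at hv
    rw [Set.encard_eq_coe_toFinset_card, Set.toFinset_card, hv]
    simp

end Decomposition

end SMWidth

namespace SMWidth
namespace Imp

/-! ### The program -/

infixr:60 ";;" => Cmd.seq

def whenDo (b : Cond) (c : Cmd) : Cmd := .ite b c .skip

def inc (x : Var) : Cmd := .assign x (.add (.var x) (.lit 1))

def isOne (a : Arr) (x : Var) : Cond := .eq (.arr a (.var x)) (.lit 1)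

/-- `x` and `y` are adjacent in the graph. -/
def adjC (x y : Var) : Cond :=
  .eq (.io (.add (.add (.lit 2) (.mul (.var x) (.var .n))) (.var y))) (.lit 1)

/-- `x` and `y` are adjacent in the tree. -/
def treeC (x y : Var) : Cond :=
  .eq (.io (.add (.add (.var .tO) (.mul (.var x) (.var .m))) (.var y))) (.lit 1)

/-- `for v < n` -/
def forV (c : Cmd) : Cmd := .loop .v (.var .n) c

/-- `for u < n` -/
def forU (c : Cmd) : Cmd := .loop .u (.var .n) c

def setAll (a : Arr) (e : Exp) : Cmd := forV (.store a (.var .v) e)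

/-- Double the variable `x`. -/
def double (x : Var) : Cmd :=
  -- `mul` would cut `x` off at `P`, but the numbers doubled here are powers of two that may exceed
  -- it.
  .assign .e2 (.lit 0) ;; .bigLoop .w (.var x) (.assign .e2 (.add (.var .e2) (.lit 2))) ;;
    .assign x (.var .e2)

/-- Compute the partial cut of the labelling `L`. -/
def countCmd (L : Arr) : Cmd :=
  .assign .cv (.lit 0) ;; forU (forV (whenDo (.and (adjC .u .v) (isOne .inA .v))
    (.ite (isOne .inA .u)
      (whenDo (.and (isOne L .u) (.not (isOne L .v))) (inc .cv))
      (whenDo (.and (isOne .inC .u) (.or (.and (isOne L .u) (.not (isOne L .v)))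
        (.and (.not (isOne L .u)) (isOne L .v)))) (inc .cv)))))

/-- Compare the states of the labellings `L` and `s`. -/
def checkCmd : Cmd :=
  .assign .ok (.lit 1) ;; forV (whenDo (.and (.not (isOne .inA .v)) (.not (isOne .inC .v)))
    (.assign .a (.lit 0) ;; .assign .b (.lit 0) ;;
      forU (whenDo (.and (isOne .inA .u) (adjC .v .u))
        (whenDo (isOne .L .u) (inc .a) ;; whenDo (isOne .s .u) (inc .b))) ;;
      whenDo (.not (.eq (.var .a) (.var .b))) (.assign .ok (.lit 0))))

/-- Combine the labellings of the children and of the current state. -/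
def mergeCmd : Cmd :=
  forV (.ite (.eq (.arr .top (.var .v)) (.var .c1)) (.store .L (.var .v) (.arr .l1 (.var .v)))
    (.ite (.eq (.arr .top (.var .v)) (.var .c2)) (.store .L (.var .v) (.arr .l2 (.var .v)))
      (.store .L (.var .v) (.arr .s (.var .v)))))

/-- Pass to the next labelling of the vertices in the array `M`. -/
def nextCmd (f M : Arr) : Cmd :=
  .assign .carry (.lit 1) ;; forV (whenDo (.and (.eq (.var .carry) (.lit 1)) (isOne M .v))
    (.ite (isOne f .v)
      -- In the binary enumeration a one with a carry becomes zero. At cuts of rank one nothing is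
      -- reset, so each call just adds one label.
      (whenDo (.not (.eq (.var .rk) (.lit 1))) (.store f (.var .v) (.lit 0)))
      (.store f (.var .v) (.lit 1) ;; .assign .carry (.lit 0))))

/-- Read a record from the tape. -/
def readRec (p : Fin 3) (x : Var) (f : Arr) : Cmd :=
  .read p x ;; forV (.read p .tmp ;; .store f (.var .v) (.var .tmp))

/-- Append a record to the tape. -/
def writeRec (e : Exp) (f : Arr) : Cmd :=
  .append e ;; forV (.append (.arr f (.var .v))) ;; inc .R

/-- Update the best labelling by the combination of two records. -/
def tryCmd : Cmd :=
  mergeCmd ;; checkCmd ;; whenDo (.eq (.var .ok) (.lit 1))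
    (countCmd .L ;; whenDo (.lt (.var .bv) (.var .cv))
      (.assign .bv (.var .cv) ;; setAll .best (.arr .L (.var .v))))

/-- The tape holds the tables of all processed nodes, and records of other nodes are skipped by
their type. Scanning the whole tape costs only a polynomial factor. -/
def innerLoop : Cmd :=
  .rewind 2 ;; .bigLoop .j2 (.var .R) (readRec 2 .id2 .l2 ;;
    whenDo (.eq (.var .id2) (.var .c2)) tryCmd)

def outerLoop : Cmd :=
  .rewind 1 ;; .bigLoop .j1 (.var .R) (readRec 1 .id1 .l1 ;;
    whenDo (.eq (.var .id1) (.var .c1)) innerLoop)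

/-- Find the best labelling for the state of `s` and store it. -/
def stateCmd : Cmd :=
  setAll .best (.arr .s (.var .v)) ;; countCmd .best ;; .assign .bv (.var .cv) ;; outerLoop ;;
    writeRec (.var .x) .best ;; nextCmd .s .inC

/-- `ns` becomes `|C| + 1` at a cut of rank one and `2 ^ |C|` otherwise; `s` runs through one subset
of `C` for each of these values. -/
def tableCmd : Cmd :=
  .assign .ns (.lit 1) ;;
  forV (whenDo (isOne .inC .v) (.ite (.eq (.var .rk) (.lit 1)) (inc .ns) (double .ns))) ;;
  setAll .s (.lit 0) ;; .bigLoop .j (.var .ns) stateCmd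

/-- Choose one endpoint of each uncovered edge of the cut as prescribed by the bits `bt`. -/
def greedyStep : Cmd :=
  whenDo (.and (.and (isOne .inA .u) (.not (isOne .inA .v))) (.and (adjC .u .v)
      (.and (.not (isOne .cov .u)) (.not (isOne .cov .v)))))
    (.ite (.lt (.var .i) (.var .K))
      (.ite (isOne .bt .i) (.store .cov (.var .u) (.lit 1)) (.store .cov (.var .v) (.lit 1)) ;;
        inc .i)
      (.assign .fail (.lit 1)))

def greedyCmd : Cmd :=
  setAll .cov (.lit 0) ;; .assign .i (.lit 0) ;; .assign .fail (.lit 0) ;; forU (forV greedyStep)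

/-- Of all covers reached so far it keeps one with the fewest vertices outside `A`. Failure means
that `K` bits were not enough to cover all edges. -/
def branchBody : Cmd :=
  greedyCmd ;;
  whenDo (.eq (.var .fail) (.lit 0))
    (.assign .o (.lit 0) ;; forV (whenDo (.and (isOne .cov .v) (.not (isOne .inA .v))) (inc .o)) ;;
      whenDo (.or (.eq (.var .found) (.lit 0)) (.lt (.var .o) (.var .out)))
        (.assign .found (.lit 1) ;; .assign .out (.var .o) ;;
          setAll .inC (.arr .cov (.var .v)))) ;;
  nextCmd .bt .mk

/-- The first `K` for which some bit vector succeeds is the minimum size of a cover. The array `mk`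
marks `K` positions, so that `nextCmd` counts through the `e = 2 ^ K` bit vectors. -/
def branchCmd : Cmd :=
  .assign .found (.lit 0) ;; .assign .e (.lit 1) ;;
  .loop .K (.add (.var .n) (.lit 1)) (whenDo (.eq (.var .found) (.lit 0))
    (setAll .bt (.lit 0) ;;
      forV (.ite (.lt (.var .v) (.var .K)) (.store .mk (.var .v) (.lit 1))
        (.store .mk (.var .v) (.lit 0))) ;;
      .bigLoop .j (.var .e) branchBody ;; double .e))

/-- Compute the frontier of the cut. -/
def frontierCmd : Cmd :=
  forU (.store .fr (.var .u) (.lit 0) ;; forV (whenDo (.and (adjC .u .v)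
    (.or (.and (isOne .inA .u) (.not (isOne .inA .v)))
      (.and (.not (isOne .inA .u)) (isOne .inA .v)))) (.store .fr (.var .u) (.lit 1))))

/-- Test whether the cut has rank one. -/
def rankCmd : Cmd :=
  .assign .rk (.lit 1) ;; forU (forV (whenDo (.and (.and (isOne .inA .u) (.not (isOne .inA .v)))
    (.and (.and (isOne .fr .u) (isOne .fr .v)) (.not (adjC .u .v)))) (.assign .rk (.lit 0))))

/-- Choose the smaller side of the frontier. -/
def smallCmd : Cmd :=
  .assign .a (.lit 0) ;; .assign .b (.lit 0) ;;
  forV (whenDo (isOne .fr .v) (.ite (isOne .inA .v) (inc .a) (inc .b))) ;;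
  forV (.ite (.and (isOne .fr .v) (.or (.and (isOne .inA .v) (.not (.lt (.var .b) (.var .a))))
    (.and (.not (isOne .inA .v)) (.lt (.var .b) (.var .a)))))
    (.store .inC (.var .v) (.lit 1)) (.store .inC (.var .v) (.lit 0)))

def coverCmd : Cmd :=
  frontierCmd ;; rankCmd ;; .ite (.eq (.var .rk) (.lit 1)) smallCmd branchCmd

/-- Find a node with at most one living neighbour. -/
def findCmd : Cmd :=
  .assign .x (.var .m) ;; .loop .y (.var .m)
    -- The root may have a single living neighbour long before its turn, so it is admitted only in
    -- the last round.
    (whenDo (.and (.not (isOne .dead .y)) (.or (.not (.eq (.var .y) (.var .r)))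
        (.eq (.add (.var .rnd) (.lit 1)) (.var .m))))
      (.assign .d (.lit 0) ;; .loop .z (.var .m)
          (whenDo (.and (treeC .y .z) (.not (isOne .dead .z))) (inc .d)) ;;
        whenDo (.lt (.var .d) (.lit 2)) (.assign .x (.var .y))))

/-- Find the children of the node `x`. -/
def childrenCmd : Cmd :=
  -- `m` stands for a missing child: no vertex has it as its `top`, and the dummy record on the tape
  -- has this type.
  .assign .c1 (.var .m) ;; .assign .c2 (.var .m) ;; .loop .z (.var .m)
    (whenDo (.and (treeC .x .z) (isOne .dead .z))
      (.ite (.eq (.var .c1) (.var .m)) (.assign .c1 (.var .z)) (.assign .c2 (.var .z))))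

/-- Compute the vertices below `x`. -/
def insideCmd : Cmd :=
  forV (.ite (.or (.eq (.arr .top (.var .v)) (.var .x)) (.or (.eq (.arr .top (.var .v)) (.var .c1))
    (.eq (.arr .top (.var .v)) (.var .c2))))
    (.store .inA (.var .v) (.lit 1)) (.store .inA (.var .v) (.lit 0)))

/-- `top` maps each vertex to its leaf while the leaf is unprocessed, and from then on to the
topmost processed node above the leaf. -/
def closeCmd : Cmd :=
  forV (whenDo (isOne .inA .v) (.store .top (.var .v) (.var .x))) ;;
  .store .dead (.var .x) (.lit 1)

def nodeCmd : Cmd :=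
  findCmd ;; childrenCmd ;; insideCmd ;; coverCmd ;; tableCmd ;; closeCmd

/-- The root is the leaf of vertex `0`, the first entry of the encoding of `δ`. The last command
writes the dummy record for missing children. -/
def initCmd : Cmd :=
  .assign .n (.io (.lit 0)) ;; .assign .m (.io (.lit 1)) ;;
  .assign .tO (.add (.lit 2) (.mul (.var .n) (.var .n))) ;;
  .assign .dO (.add (.var .tO) (.mul (.var .m) (.var .m))) ;;
  .assign .r (.io (.var .dO)) ;;
  setAll .top (.io (.add (.var .dO) (.var .v))) ;;
  writeRec (.var .m) .s

def outputCmd : Cmd :=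
  forV (.ite (isOne .best .v) (.put (.var .v) (.lit 1)) (.put (.var .v) (.lit 0))) ;;
  .put (.var .n) (.var .bv)

def mainCmd : Cmd := initCmd ;; .loop .rnd (.var .m) nodeCmd ;; outputCmd

/-! ### The context of the program -/

/-- Adjacency of numbers as vertices of `G`. -/
def NAdj {n : ℕ} (G : SimpleGraph (Fin n)) (u v : ℕ) : Prop :=
  ∃ (hu : u < n) (hv : v < n), G.Adj ⟨u, hu⟩ ⟨v, hv⟩

/-- The parameters and the input that stay fixed during the main part of the program. -/
structure Ctx {n m : ℕ} (G : SimpleGraph (Fin n)) (T : SimpleGraph (Fin m)) (h : Store) : Prop where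
  hP : h.P = 2 + n * n + m * m + n
  hn : h.var .n = n
  hm : h.var .m = m
  htO : h.var .tO = 2 + n * n
  adj : ∀ u v, u < n → v < n → (h.io (2 + u * n + v) = 1 ↔ NAdj G u v)
  tree : ∀ x y, x < m → y < m → (h.io (2 + n * n + x * m + y) = 1 ↔ NAdj T x y)

/-- The command does not change the context. -/
def Cmd.keeps (c : Cmd) : Bool := !c.wvar .n && !c.wvar .m && !c.wvar .tO && !c.wio

def isLocal (x : Var) : Bool := x != .n && x != .m && x != .tO

section

variable {n m : ℕ} {G : SimpleGraph (Fin n)} {T : SimpleGraph (Fin m)} {h h' : Store} {c : Cmd}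

theorem Ctx.frame (H : Ctx G T h) (F : Frame c h h') (hc : c.keeps = true) : Ctx G T h' := by
  simp only [Cmd.keeps, Bool.and_eq_true, Bool.not_eq_true'] at hc
  obtain ⟨⟨⟨h1, h2⟩, h3⟩, h4⟩ := hc
  exact ⟨F.P.trans H.hP, (F.var _ h1).trans H.hn, (F.var _ h2).trans H.hm, (F.var _ h3).trans H.htO,
    by rw [F.io h4]; exact H.adj, by rw [F.io h4]; exact H.tree⟩

theorem Ctx.run (H : Ctx G T h) (c : Cmd) (hc : c.keeps = true) : Ctx G T (c.run h) :=
  H.frame (Frame.run c h) hc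

theorem Ctx.setVar (H : Ctx G T h) (x : Var) (k : ℕ) (hx : isLocal x = true) :
    Ctx G T (h.setVar x k) := by
  simp only [isLocal, Bool.and_eq_true, bne_iff_ne] at hx
  exact ⟨H.hP, by simp [hx.1.1.symm, H.hn], by simp [hx.1.2.symm, H.hm], by simp [hx.2.symm, H.htO],
    H.adj, H.tree⟩

theorem Ctx.n_le (H : Ctx G T h) : n + 2 ≤ h.P := by rw [H.hP]; omega

theorem Ctx.m_le (H : Ctx G T h) : m + 2 ≤ h.P := by
  rw [H.hP]; have := Nat.le_mul_self m; omega

theorem Ctx.forN (H : Ctx G T h) : min ((Exp.var .n).eval h) h.P = n := by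
  have := H.n_le
  simp only [Exp.eval, H.hn]; omega

theorem Ctx.forM (H : Ctx G T h) : min ((Exp.var .m).eval h) h.P = m := by
  have := H.m_le
  simp only [Exp.eval, H.hm]; omega

theorem mul_add_lt {n u v : ℕ} (hu : u < n) (hv : v < n) : u * n + v < n * n := by
  calc u * n + v < u * n + n := by omega
    _ = (u + 1) * n := by ring
    _ ≤ n * n := Nat.mul_le_mul_right _ hu

theorem Ctx.adjC (H : Ctx G T h) {x y : Var} (hx : h.var x < n) (hy : h.var y < n) :
    (adjC x y).eval h = true ↔ NAdj G (h.var x) (h.var y) := by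
  rw [← H.adj _ _ hx hy]
  have h1 := mul_add_lt hx hy
  have h2 : n ≤ n * n := Nat.le_mul_self n
  have hP := H.hP
  simp only [Imp.adjC, Cond.eval, Exp.eval, H.hn, beq_iff_eq]
  rw [min_eq_left (a := h.var x) (by omega), min_eq_left (a := n) (by omega),
    min_eq_left (a := h.var x * n) (by omega), min_eq_left (a := h.var y) (by omega),
    if_pos (by omega)]

theorem Ctx.treeC (H : Ctx G T h) {x y : Var} (hx : h.var x < m) (hy : h.var y < m) :
    (treeC x y).eval h = true ↔ NAdj T (h.var x) (h.var y) := by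
  rw [← H.tree _ _ hx hy]
  have h1 := mul_add_lt hx hy
  have h2 : m ≤ m * m := Nat.le_mul_self m
  have hP := H.hP
  simp only [Imp.treeC, Cond.eval, Exp.eval, H.hm, H.htO, beq_iff_eq]
  rw [min_eq_left (a := h.var x) (by omega), min_eq_left (a := m) (by omega),
    min_eq_left (a := h.var x * m) (by omega), min_eq_left (a := h.var y) (by omega),
    if_pos (by omega)]

theorem isOne_eval {a : Arr} {x : Var} (hx : h.var x ≤ h.P) :
    (isOne a x).eval h = true ↔ h.arr a (h.var x) = 1 := by
  simp [isOne, Cond.eval, Exp.eval, min_eq_left hx]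

theorem Ctx.isOne (H : Ctx G T h) {a : Arr} {x : Var} (hx : h.var x < n) :
    (isOne a x).eval h = true ↔ h.arr a (h.var x) = 1 :=
  isOne_eval (by have := H.n_le; omega)

theorem Ctx.isOneM (H : Ctx G T h) {a : Arr} {x : Var} (hx : h.var x < m) :
    (Imp.isOne a x).eval h = true ↔ h.arr a (h.var x) = 1 :=
  isOne_eval (by have := H.m_le; omega)

/-- The set with the characteristic function `f`. -/
def arrSet (n : ℕ) (f : ℕ → ℕ) : Finset (Fin n) := Finset.univ.filter fun v => f v = 1

@[simp] theorem mem_arrSet {f : ℕ → ℕ} {v : Fin n} : v ∈ arrSet n f ↔ f v = 1 := by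
  simp [arrSet]

theorem nadj_iff {u v : Fin n} : NAdj G u v ↔ G.Adj u v :=
  ⟨fun ⟨_, _, h⟩ => h, fun h => ⟨u.2, v.2, h⟩⟩

@[simp] theorem Cond.eval_and (a b : Cond) :
    (Cond.and a b).eval h = true ↔ a.eval h = true ∧ b.eval h = true := by simp [Cond.eval]

@[simp] theorem Cond.eval_or (a b : Cond) :
    (Cond.or a b).eval h = true ↔ a.eval h = true ∨ b.eval h = true := by simp [Cond.eval]

@[simp] theorem Cond.eval_not (a : Cond) :
    (Cond.not a).eval h = true ↔ ¬ a.eval h = true := by simp [Cond.eval]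

@[simp] theorem Cond.eval_eq (a b : Exp) :
    (Cond.eq a b).eval h = true ↔ a.eval h = b.eval h := by simp [Cond.eval]

@[simp] theorem Cond.eval_lt (a b : Exp) :
    (Cond.lt a b).eval h = true ↔ a.eval h < b.eval h := by simp [Cond.eval]

theorem run_seq (c d : Cmd) : (c ;; d).run h = d.run (c.run h) := rfl

theorem run_ite (b : Cond) (c d : Cmd) :
    (Cmd.ite b c d).run h = if b.eval h = true then c.run h else d.run h := rfl

theorem run_whenDo (b : Cond) (c : Cmd) :
    (whenDo b c).run h = if b.eval h = true then c.run h else h := rfl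

theorem run_assign (x : Var) (e : Exp) : (Cmd.assign x e).run h = h.setVar x (e.eval h) := rfl

theorem run_store (a : Arr) (i e : Exp) :
    (Cmd.store a i e).run h = h.setArr a (min (i.eval h) h.P) (e.eval h) := rfl

theorem Ctx.run_inc (H : Ctx G T h) (x : Var) : (inc x).run h = h.setVar x (h.var x + 1) := by
  have := H.n_le
  simp only [inc, run_assign, Exp.eval]
  rw [min_eq_left (by omega)]

/-! ### Specifications of the parts -/

theorem setAll_arr (H : Ctx G T h) {a : Arr} {e : Exp} (f : ℕ → ℕ)
    (hf : ∀ i h', i < n → Frame (setAll a e) h h' → e.eval (h'.setVar .v i) = f i) (j : ℕ) :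
    ((setAll a e).run h).arr a j = if j < n then f j else h.arr a j := by
  refine run_loop_fill H.forN a f ?_ j
  intro i h' hi F
  have h1 := hf i h' hi F
  have h2 := (F.P ▸ H.n_le : n + 2 ≤ h'.P)
  rw [run_store, h1]
  have h3 : min ((Exp.var .v).eval (h'.setVar .v i)) (h'.setVar .v i).P = i := by
    simp [Exp.eval]; omega
  rw [h3]
  refine ⟨by simp, fun j hj => by simp [hj]⟩

end

section

variable {n m : ℕ} {G : SimpleGraph (Fin n)} {T : SimpleGraph (Fin m)} {h h' : Store}

open Classical in
-- A single sum over all ordered pairs of vertices, in the shape of the double loop of `countCmd`.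
theorem partialCut_eq_sum {V : Type*} [Fintype V] [DecidableEq V] (G : SimpleGraph V)
    (A C L : Finset V) : partialCut G A C L = ∑ u : V, ∑ v : V,
      if G.Adj u v ∧ v ∈ A ∧ (u ∈ A ∧ u ∈ L ∧ v ∉ L ∨ u ∉ A ∧ u ∈ C ∧ (u ∈ L ↔ v ∉ L))
        then 1 else 0 := by
  have h1 : innerCut G L A = ∑ u : V, ∑ v : V,
      if u ∈ A then (if v ∈ A then (if G.Adj u v ∧ u ∈ L ∧ v ∉ L then 1 else 0) else 0) else 0 := by
    unfold innerCut
    rw [← Finset.sum_subset (Finset.subset_univ A)]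
    · refine Finset.sum_congr rfl fun u hu => ?_
      simp [hu, Finset.sum_ite_mem]
    · intro u _ hu
      simp [hu]
  have h2 : crossCut G L (C \ A) A = ∑ u : V, ∑ v : V,
      if u ∈ C \ A then (if v ∈ A then (if G.Adj u v ∧ (u ∈ L ↔ v ∉ L) then 1 else 0) else 0)
        else 0 := by
    unfold crossCut
    rw [← Finset.sum_subset (Finset.subset_univ (C \ A))]
    · refine Finset.sum_congr rfl fun u hu => ?_
      simp only [hu, if_true, Finset.sum_ite_mem, Finset.univ_inter]
    · intro u _ hu
      simp [hu]
  rw [partialCut, h1, h2, ← Finset.sum_add_distrib]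
  refine Finset.sum_congr rfl fun u _ => ?_
  rw [← Finset.sum_add_distrib]
  refine Finset.sum_congr rfl fun v _ => ?_
  by_cases a1 : u ∈ A <;> by_cases a2 : v ∈ A <;> by_cases a3 : u ∈ C <;>
    by_cases a4 : G.Adj u v <;> simp [a1, a2, a3, a4]

theorem count_spec (H : Ctx G T h) (L : Arr) : ((countCmd L).run h).var .cv =
    partialCut G (arrSet n (h.arr .inA)) (arrSet n (h.arr .inC)) (arrSet n (h.arr L)) := by
  classical
  rw [partialCut_eq_sum]
  have H0 : Ctx G T (h.setVar .cv 0) := H.setVar _ _ rfl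
  have key := run_loop_sum (c := forV (whenDo (.and (adjC .u .v) (isOne .inA .v))
    (.ite (isOne .inA .u)
      (whenDo (.and (isOne L .u) (.not (isOne L .v))) (inc .cv))
      (whenDo (.and (isOne .inC .u) (.or (.and (isOne L .u) (.not (isOne L .v)))
        (.and (.not (isOne L .u)) (isOne L .v)))) (inc .cv))))) (x := .u) H0.forN .cv
    (fun u => ∑ v ∈ Finset.range n, if NAdj G u v ∧ h.arr .inA v = 1 ∧
      (h.arr .inA u = 1 ∧ h.arr L u = 1 ∧ h.arr L v ≠ 1 ∨
        h.arr .inA u ≠ 1 ∧ h.arr .inC u = 1 ∧ (h.arr L u = 1 ↔ h.arr L v ≠ 1)) then 1 else 0) ?_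
  · refine key.trans ?_
    simp only [Store.setVar_var, if_true, zero_add, Finset.sum_range, mem_arrSet, nadj_iff, ne_eq]
  · intro i h1 hi F
    have H1 : Ctx G T (h1.setVar .u i) := (H0.frame F rfl).setVar _ _ rfl
    have e1 : ∀ a, h1.arr a = h.arr a := fun a => F.arr a rfl
    refine run_loop_sum H1.forN .cv _ ?_
    intro j h2 hj F2
    have H2 : Ctx G T (h2.setVar .v j) := (H1.frame F2 rfl).setVar _ _ rfl
    have e2 : ∀ a, h2.arr a = h.arr a := fun a => (F2.arr a rfl).trans (e1 a)
    have eu : (h2.setVar .v j).var .u = i := by simp [F2.var .u rfl]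
    have ev : (h2.setVar .v j).var .v = j := by simp
    have hu := eu.trans_lt hi
    have hv := ev.trans_lt hj
    simp only [run_whenDo, run_ite, H2.run_inc, Cond.eval_and, Cond.eval_or, Cond.eval_not,
      H2.adjC hu hv, H2.isOne hu, H2.isOne hv]
    simp only [eu, ev, Store.setVar_arr, e2]
    by_cases a1 : NAdj G i j <;> by_cases a2 : h.arr .inA j = 1 <;>
      by_cases a3 : h.arr .inA i = 1 <;> by_cases a4 : h.arr .inC i = 1 <;>
      by_cases a5 : h.arr L i = 1 <;> by_cases a6 : h.arr L j = 1 <;>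
      simp [a1, a2, a3, a4, a5, a6]

theorem merge_spec (H : Ctx G T h) (j : ℕ) (hj : j < n) : (mergeCmd.run h).arr .L j =
    if h.arr .top j = h.var .c1 then h.arr .l1 j else
      if h.arr .top j = h.var .c2 then h.arr .l2 j else h.arr .s j := by
  refine (run_loop_fill (c := .ite (.eq (.arr .top (.var .v)) (.var .c1))
    (.store .L (.var .v) (.arr .l1 (.var .v)))
    (.ite (.eq (.arr .top (.var .v)) (.var .c2)) (.store .L (.var .v) (.arr .l2 (.var .v)))
      (.store .L (.var .v) (.arr .s (.var .v))))) H.forN .L (fun j =>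
    if h.arr .top j = h.var .c1 then h.arr .l1 j else
      if h.arr .top j = h.var .c2 then h.arr .l2 j else h.arr .s j) ?_ j).trans (if_pos hj)
  intro i h1 hi F
  have H1 : Ctx G T (h1.setVar .v i) := (H.frame F rfl).setVar _ _ rfl
  have hP : min i h1.P = i := by have := F.P; have := H.n_le; omega
  simp only [run_ite, Cond.eval_eq, Exp.eval, run_store, Store.setVar_var, Store.setVar_arr,
    Store.setVar_P', if_true, hP, F.arr .top rfl, F.arr .l1 rfl, F.arr .l2 rfl, F.arr .s rfl,
    reduceCtorEq, if_false, F.var .c1 rfl, F.var .c2 rfl]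
  refine ⟨?_, fun j hj => ?_⟩ <;> split_ifs <;> simp_all

theorem degIn_eq_sum (A L : ℕ → ℕ) (v : Fin n) [∀ u, Decidable (NAdj G v u)] :
    degIn G (arrSet n L) (arrSet n A) v = ∑ u ∈ Finset.range n,
      if (A u = 1 ∧ NAdj G v u) ∧ L u = 1 then 1 else 0 := by
  classical
  rw [Finset.sum_range, ← Finset.card_filter, degIn]
  congr 1
  ext u
  simp [nadj_iff, and_assoc]

theorem check_spec (H : Ctx G T h) : (checkCmd.run h).var .ok = 1 ↔
    ∀ v, v ∉ arrSet n (h.arr .inA) → v ∉ arrSet n (h.arr .inC) →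
      degIn G (arrSet n (h.arr .L)) (arrSet n (h.arr .inA)) v =
        degIn G (arrSet n (h.arr .s)) (arrSet n (h.arr .inA)) v := by
  classical
  have H0 : Ctx G T (h.setVar .ok 1) := H.setVar _ _ rfl
  set dg : Arr → ℕ → ℕ := fun a v => ∑ u ∈ Finset.range n,
      if (h.arr .inA u = 1 ∧ NAdj G v u) ∧ h.arr a u = 1 then 1 else 0 with hdg
  have key := run_loop_flag (h := h.setVar .ok 1) (c :=
    whenDo (.and (.not (isOne .inA .v)) (.not (isOne .inC .v)))
    (.assign .a (.lit 0) ;; .assign .b (.lit 0) ;;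
      forU (whenDo (.and (isOne .inA .u) (adjC .v .u))
        (whenDo (isOne .L .u) (inc .a) ;; whenDo (isOne .s .u) (inc .b))) ;;
      whenDo (.not (.eq (.var .a) (.var .b))) (.assign .ok (.lit 0)))) (x := .v) H0.forN .ok 0
    (fun v => h.arr .inA v ≠ 1 ∧ h.arr .inC v ≠ 1 ∧ dg .L v ≠ dg .s v) ?_
  · have key' : (checkCmd.run h).var .ok = _ := key
    rw [key']
    simp only [mem_arrSet, degIn_eq_sum]
    split_ifs with hc
    · obtain ⟨i, hi, h1, h2, h3⟩ := hc
      simp only [false_iff]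
      exact fun hall => h3 (hall ⟨i, hi⟩ h1 h2)
    · simp only [Store.setVar_var, if_true, true_iff]
      intro v h1 h2
      by_contra h3
      exact hc ⟨v, v.2, h1, h2, h3⟩
  · intro i h1 hi F
    have H1 : Ctx G T (h1.setVar .v i) := (H0.frame F rfl).setVar _ _ rfl
    have e1 : ∀ a, h1.arr a = h.arr a := fun a => F.arr a rfl
    have ev : (h1.setVar .v i).var .v = i := by simp
    simp only [run_whenDo, Cond.eval_and, Cond.eval_not, H1.isOne (ev.trans_lt hi), run_seq,
      run_assign]
    simp only [ev, Store.setVar_arr, e1]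
    by_cases a1 : h.arr .inA i = 1
    · simp [a1]
    by_cases a2 : h.arr .inC i = 1
    · simp [a2]
    simp only [a1, a2, not_false_eq_true, and_self, if_true, ne_eq, true_and]
    set h3 := ((h1.setVar .v i).setVar .a (Exp.eval (h1.setVar .v i) (.lit 0))).setVar .b
      (Exp.eval ((h1.setVar .v i).setVar .a (Exp.eval (h1.setVar .v i) (.lit 0))) (.lit 0)) with hh3
    have H3 : Ctx G T h3 := (H1.setVar _ _ rfl).setVar _ _ rfl
    have step : ∀ j h4, j < n → Frame (forU (whenDo (.and (isOne .inA .u) (adjC .v .u))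
        (whenDo (isOne .L .u) (inc .a) ;; whenDo (isOne .s .u) (inc .b)))) h3 h4 →
        ((whenDo (.and (isOne .inA .u) (adjC .v .u)) (whenDo (isOne .L .u) (inc .a) ;;
          whenDo (isOne .s .u) (inc .b))).run (h4.setVar .u j)).var .a = h4.var .a +
            (if (h.arr .inA j = 1 ∧ NAdj G i j) ∧ h.arr .L j = 1 then 1 else 0) ∧
        ((whenDo (.and (isOne .inA .u) (adjC .v .u)) (whenDo (isOne .L .u) (inc .a) ;;
          whenDo (isOne .s .u) (inc .b))).run (h4.setVar .u j)).var .b = h4.var .b +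
            (if (h.arr .inA j = 1 ∧ NAdj G i j) ∧ h.arr .s j = 1 then 1 else 0) := by
      intro j h4 hj F4
      have H4 : Ctx G T (h4.setVar .u j) := (H3.frame F4 rfl).setVar _ _ rfl
      have e4 : ∀ a, h4.arr a = h.arr a := fun a => (F4.arr a rfl).trans (e1 a)
      have eu : (h4.setVar .u j).var .u = j := by simp
      have ev4 : (h4.setVar .u j).var .v = i := by simp [F4.var .v rfl, hh3]
      have H5 : Ctx G T ((h4.setVar .u j).setVar .a ((h4.setVar .u j).var .a + 1)) :=
        H4.setVar _ _ rfl
      have eu5 : ((h4.setVar .u j).setVar .a ((h4.setVar .u j).var .a + 1)).var .u = j := by simp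
      simp only [run_whenDo, run_seq, Cond.eval_and, H4.isOne (eu.trans_lt hj),
        H4.adjC (ev4.trans_lt hi) (eu.trans_lt hj), H4.run_inc]
      simp only [eu, ev4, Store.setVar_arr, e4]
      by_cases b1 : h.arr .inA j = 1 <;> by_cases b2 : NAdj G i j <;>
        by_cases b3 : h.arr .L j = 1 <;> by_cases b4 : h.arr .s j = 1 <;>
        simp only [b1, b2, b3, b4, and_self, and_true, and_false, if_true, if_false, H5.isOne (eu5.trans_lt hj), eu5, H5.run_inc, H4.isOne (eu.trans_lt hj), eu,
          Store.setVar_arr, e4, H4.run_inc] <;> simp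
    have ra := run_loop_sum H3.forN .a _ fun j h4 hj F4 => (step j h4 hj F4).1
    have rb := run_loop_sum H3.forN .b _ fun j h4 hj F4 => (step j h4 hj F4).2
    have ra' : ((forU (whenDo (.and (isOne .inA .u) (adjC .v .u)) (whenDo (isOne .L .u) (inc .a) ;;
          whenDo (isOne .s .u) (inc .b)))).run h3).var .a = dg .L i :=
      ra.trans (by simp [hh3, hdg, Exp.eval])
    have rb' : ((forU (whenDo (.and (isOne .inA .u) (adjC .v .u)) (whenDo (isOne .L .u) (inc .a) ;;
          whenDo (isOne .s .u) (inc .b)))).run h3).var .b = dg .s i :=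
      rb.trans (by simp [hh3, hdg, Exp.eval])
    have rk := (Frame.run (forU (whenDo (.and (isOne .inA .u) (adjC .v .u))
      (whenDo (isOne .L .u) (inc .a) ;; whenDo (isOne .s .u) (inc .b)))) h3).var .ok rfl
    have rk' := rk.trans (show h3.var .ok = h1.var .ok by simp [hh3])
    simp only [Cond.eval_eq, Exp.eval, ra', rb']
    by_cases b : dg .L i = dg .s i
    · simp [b, rk']
    · simp [b]

end

/-! ### Enumeration of labellings -/

section Enumeration

/-- The number of vertices below `k` in the set with characteristic function `M`. -/
def rank (M : ℕ → ℕ) (k : ℕ) : ℕ := ((Finset.range k).filter fun v => M v = 1).card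

theorem rank_succ (M : ℕ → ℕ) (k : ℕ) :
    rank M (k + 1) = rank M k + if M k = 1 then 1 else 0 := by
  unfold rank
  rw [Finset.range_add_one, Finset.filter_insert]
  split_ifs <;> simp

theorem rank_eq_card (M : ℕ → ℕ) (n : ℕ) : rank M n = (arrSet n M).card := by
  rw [rank, Finset.card_filter, Finset.sum_range, ← Finset.card_filter, arrSet]

/-- The weight of a vertex: one if we count labels, and otherwise a power of two. -/
def weight (b : Bool) (M : ℕ → ℕ) (v : ℕ) : ℕ := if b then 1 else 2 ^ rank M v

/-- The number that encodes the labelling `f` of the first `k` vertices. -/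
def code (b : Bool) (M f : ℕ → ℕ) (k : ℕ) : ℕ :=
  ∑ v ∈ Finset.range k, if M v = 1 ∧ f v = 1 then weight b M v else 0

/-- The largest code. -/
def maxCode (b : Bool) (M : ℕ → ℕ) (k : ℕ) : ℕ := if b then rank M k else 2 ^ rank M k - 1

variable {b : Bool} {M f g : ℕ → ℕ} {k : ℕ}

theorem maxCode_succ : maxCode b M (k + 1) = maxCode b M k + if M k = 1 then weight b M k else 0 := by
  unfold maxCode weight
  rw [rank_succ]
  have := Nat.one_le_two_pow (n := rank M k)
  cases b <;> by_cases h : M k = 1 <;> simp [h, pow_succ]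
  omega

theorem code_succ : code b M f (k + 1) = code b M f k +
    if M k = 1 ∧ f k = 1 then weight b M k else 0 := Finset.sum_range_succ _ _

theorem code_eq_maxCode (h : ∀ v, v < k → M v = 1 → f v = 1) : code b M f k = maxCode b M k := by
  induction k with
  | zero => cases b <;> simp [code, maxCode, rank]
  | succ k ih =>
    rw [code_succ, maxCode_succ, ih fun v hv => h v (by omega)]
    by_cases hk : M k = 1
    · simp [hk, h k (by omega) hk]
    · simp [hk]

theorem code_le_maxCode : code b M f k ≤ maxCode b M k := by
  induction k with
  | zero => simp [code]
  | succ k ih =>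
    rw [code_succ, maxCode_succ]
    split_ifs <;> simp_all
    omega

theorem code_update {k i c : ℕ} (hi : i < k) (hM : M i = 1) (hg : ∀ v, v ≠ i → g v = f v)
    (hc : g i = c) : code b M g k + (if f i = 1 then weight b M i else 0) =
      code b M f k + if c = 1 then weight b M i else 0 := by
  have hm := Finset.mem_range.2 hi
  unfold code
  rw [← Finset.add_sum_erase _ _ hm, ← Finset.add_sum_erase _ (fun v =>
    if M v = 1 ∧ f v = 1 then weight b M v else 0) hm]
  have : ∑ v ∈ (Finset.range k).erase i, (if M v = 1 ∧ g v = 1 then weight b M v else 0) =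
      ∑ v ∈ (Finset.range k).erase i, (if M v = 1 ∧ f v = 1 then weight b M v else 0) :=
    Finset.sum_congr rfl fun v hv => by rw [hg v (Finset.ne_of_mem_erase hv)]
  simp only [this, hM, hc, true_and]
  ring

/-- Binary digits: the weights of all lower marked vertices add up to less than the weight of the
next one, so the top digit can be read off. -/
theorem code_inj (h : code false M f k = code false M g k) :
    ∀ v, v < k → M v = 1 → (f v = 1 ↔ g v = 1) := by
  induction k with
  | zero => intro v hv; omega
  | succ k ih =>
    rw [code_succ, code_succ] at h
    have h1 : code false M f k < 2 ^ rank M k := by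
      have := code_le_maxCode (b := false) (M := M) (f := f) (k := k)
      have := Nat.one_le_two_pow (n := rank M k)
      simp [maxCode] at *; omega
    have h2 : code false M g k < 2 ^ rank M k := by
      have := code_le_maxCode (b := false) (M := M) (f := g) (k := k)
      have := Nat.one_le_two_pow (n := rank M k)
      simp [maxCode] at *; omega
    by_cases hM : M k = 1
    · simp only [hM, true_and, weight, Bool.false_eq_true, if_false] at h
      have hk : (f k = 1 ↔ g k = 1) ∧ code false M f k = code false M g k := by
        by_cases hf : f k = 1 <;> by_cases hg : g k = 1 <;> simp [hf, hg] at h ⊢ <;> omega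
      intro v hv hMv
      rcases Nat.lt_succ_iff_lt_or_eq.1 hv with h3 | rfl
      · exact ih hk.2 v h3 hMv
      · exact hk.1
    · simp only [hM, false_and, if_false, add_zero] at h
      intro v hv hMv
      rcases Nat.lt_succ_iff_lt_or_eq.1 hv with h3 | rfl
      · exact ih h v h3 hMv
      · exact absurd hMv hM

theorem code_true_eq_card {n : ℕ} :
    code true M f n = (arrSet n f ∩ arrSet n M).card := by
  rw [code, Finset.sum_range]
  simp only [weight, if_true]
  rw [← Finset.card_filter]
  congr 1
  ext v
  simp [and_comm]

end Enumeration

section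

variable {n m : ℕ} {G : SimpleGraph (Fin n)} {T : SimpleGraph (Fin m)} {h h' : Store}

/-- While the carry is alive, all marked vertices seen so far had label one. In binary they have
been reset, which lowers the code by the largest code of the prefix; the digit set next weighs one
more than this. In the unary case nothing is reset and the new label weighs one. A carry that
survives to the end means that the code was maximal, which is excluded. -/
theorem next_spec (H : Ctx G T h) (f M : Arr) (hfM : f ≠ M) {b : Bool}
    (hb : h.var .rk = 1 ↔ b = true)
    (hne : code b (h.arr M) (h.arr f) n < maxCode b (h.arr M) n) :
    code b (h.arr M) (((nextCmd f M).run h).arr f) n = code b (h.arr M) (h.arr f) n + 1 ∧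
      ∀ v, h.arr M v ≠ 1 → ((nextCmd f M).run h).arr f v = h.arr f v := by
  have H0 : Ctx G T (h.setVar .carry 1) := H.setVar _ _ rfl
  set μ := h.arr M with hμ
  set φ := h.arr f with hφ
  have key := run_loop (x := .v) (c := whenDo (.and (.eq (.var .carry) (.lit 1)) (isOne M .v))
    (.ite (isOne f .v)
      (whenDo (.not (.eq (.var .rk) (.lit 1))) (.store f (.var .v) (.lit 0)))
      (.store f (.var .v) (.lit 1) ;; .assign .carry (.lit 0)))) H0.forN
    (fun i h' => h'.arr M = μ ∧ (∀ v, μ v ≠ 1 → h'.arr f v = φ v) ∧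
      ((h'.var .carry = 1 ∧ (∀ v, v < i → μ v = 1 → φ v = 1) ∧ (∀ v, i ≤ v → h'.arr f v = φ v) ∧
        code b μ (h'.arr f) n + (if b then 0 else maxCode b μ i) = code b μ φ n) ∨
      (h'.var .carry ≠ 1 ∧ code b μ (h'.arr f) n = code b μ φ n + 1))) ?_ ?_
  · have key' : _ ∧ _ ∧ _ := key
    obtain ⟨-, h2, ⟨-, h3, -⟩ | ⟨-, h3⟩⟩ := key'
    · rw [code_eq_maxCode h3] at hne
      exact absurd hne (lt_irrefl _)
    · exact ⟨h3, h2⟩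
  · refine ⟨rfl, fun v _ => rfl, Or.inl ⟨by simp, by omega, fun v _ => rfl, ?_⟩⟩
    cases b <;> simp [maxCode, rank, hφ]
  · intro i h1 hi F ⟨eM, ef, hor⟩
    have H1 : Ctx G T (h1.setVar .v i) := (H0.frame F rfl).setVar _ _ rfl
    have ev : (h1.setVar .v i).var .v = i := by simp
    have erk : h1.var .rk = h.var .rk := (F.var .rk rfl).trans (by simp)
    have hP : min i h1.P = i := by have := F.P; have := H0.n_le; omega
    simp only [run_whenDo, run_ite, run_seq, run_assign, run_store, Cond.eval_and, Cond.eval_not,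
      Cond.eval_eq, H1.isOne (ev.trans_lt hi)]
    simp only [ev, Store.setVar_arr, Exp.eval, Store.setVar_var, Store.setVar_P', reduceCtorEq,
      if_false, eM, hP, erk, hb]
    rcases hor with ⟨hc, hones, hrest, hcode⟩ | ⟨hc, hcode⟩
    · by_cases hM : μ i = 1
      · simp only [hc, hM, true_and, if_true]
        have hfi := hrest i le_rfl
        by_cases hf1 : φ i = 1
        · rw [hfi, if_pos hf1]
          have hones' : ∀ v, v < i + 1 → μ v = 1 → φ v = 1 := fun v hv hv' => by
            rcases Nat.lt_succ_iff_lt_or_eq.1 hv with h3 | rfl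
            exacts [hones v h3 hv', hf1]
          cases hbb : b with
          | true =>
            simp only [not_true, if_false]
            refine ⟨eM, ef, Or.inl ⟨by simpa using hc, hones', fun v hv => hrest v (by omega), ?_⟩⟩
            simpa [hbb] using hcode
          | false =>
            simp only [Bool.false_eq_true, not_false_eq_true, if_true]
            refine ⟨?_, ?_, Or.inl ⟨by simpa using hc, hones', ?_, ?_⟩⟩
            · funext v; simp [hfM.symm, eM]
            · intro v hv
              have : v ≠ i := by rintro rfl; exact hv hM
              simp [this, ef v hv]
            · intro v hv
              have : v ≠ i := by omega
              simp [this, hrest v (by omega)]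
            · have e1 := code_update (b := false) (M := μ) (f := h1.arr f)
                (g := ((h1.setVar .v i).setArr f i 0).arr f) hi hM (fun v hv => by simp [hv])
                (c := 0) (by simp)
              simp only [hfi, hf1, if_true, zero_ne_one, if_false, add_zero] at e1
              rw [hbb] at hcode
              simp only [Bool.false_eq_true, if_false] at hcode ⊢
              rw [maxCode_succ, if_pos hM]
              omega
        · rw [hfi, if_neg hf1]
          refine ⟨?_, ?_, Or.inr ⟨by simp, ?_⟩⟩
          · funext v; simp [hfM.symm, eM]
          · intro v hv
            have : v ≠ i := by rintro rfl; exact hv hM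
            simp [this, ef v hv]
          · have e1 := code_update (b := b) (M := μ) (f := h1.arr f)
              (g := ((h1.setVar .v i).setArr f i 1).arr f) hi hM (fun v hv => by simp [hv])
              (c := 1) (by simp)
            simp only [hfi, hf1, if_true, if_false, add_zero] at e1
            rw [Store.setVar_arr, e1]
            cases b with
            | true => simp [weight] at hcode ⊢; exact hcode
            | false =>
              have := Nat.one_le_two_pow (n := rank μ i)
              simp [weight, maxCode] at hcode ⊢
              omega
      · simp only [hM, and_false, if_false]
        refine ⟨eM, ef, Or.inl ⟨by simpa using hc, fun v hv hv' => ?_,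
          fun v hv => hrest v (by omega), ?_⟩⟩
        · rcases Nat.lt_succ_iff_lt_or_eq.1 hv with h3 | rfl
          exacts [hones v h3 hv', absurd hv' hM]
        · rw [maxCode_succ, if_neg hM, add_zero]; exact hcode
    · simp only [hc, false_and, if_false]
      exact ⟨eM, ef, Or.inr ⟨by simpa using hc, hcode⟩⟩

theorem double_spec (H : Ctx G T h) (x : Var) (hx : x ≠ .e2) :
    ((double x).run h).var x = 2 * h.var x ∧ (double x).cost h ≤ (4 * h.P + 10) * (h.var x + 1) := by
  have hn := H.n_le
  obtain ⟨h1, h2⟩ := run_bigLoop (x := .w) (e := .var x)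
    (c := .assign .e2 (.add (.var .e2) (.lit 2))) (h := h.setVar .e2 0) (k := h.var x) (by simp [Exp.eval, hx])
    (fun i h' => h'.var .e2 = 2 * i) (B := 4 * h.P + 7) (by simp) (by
      intro i h' hi F ih
      have : h'.P = h.P := F.P
      refine ⟨?_, ?_⟩
      · simp [run_assign, Exp.eval, ih, this]; omega
      · simp only [Cmd.cost, Exp.cost, Store.setVar_P', this]; omega)
  refine ⟨?_, ?_⟩
  · show (Store.setVar _ x _).var x = _
    simp only [Store.setVar_var, if_true]
    exact h1
  · have e1 : (double x).cost h = 1 + 1 + ((Cmd.bigLoop .w (.var x)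
        (.assign .e2 (.add (.var .e2) (.lit 2)))).cost (h.setVar .e2 0) + (1 + 1)) := rfl
    rw [e1]
    simp only [Exp.cost] at h2
    nlinarith

end

/-! ### Computation of the covers -/

section

variable {n m : ℕ} {G : SimpleGraph (Fin n)} {T : SimpleGraph (Fin m)} {h h' : Store}

theorem frontier_spec (H : Ctx G T h) (u : Fin n) :
    (frontierCmd.run h).arr .fr u = 1 ↔ IsFrontier G (arrSet n (h.arr .inA)) u := by
  classical
  set q : ℕ → ℕ → Prop := fun u v => NAdj G u v ∧ ((h.arr .inA u = 1 ∧ h.arr .inA v ≠ 1) ∨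
    (h.arr .inA u ≠ 1 ∧ h.arr .inA v = 1)) with hq
  have key := run_loop_fill (x := .u) (c := .store .fr (.var .u) (.lit 0) ;;
    forV (whenDo (.and (adjC .u .v) (.or (.and (isOne .inA .u) (.not (isOne .inA .v)))
      (.and (.not (isOne .inA .u)) (isOne .inA .v)))) (.store .fr (.var .u) (.lit 1)))) H.forN .fr
    (fun u => if ∃ v, v < n ∧ q u v then 1 else 0) ?_ u
  · have key' : (frontierCmd.run h).arr .fr u = _ := key
    rw [key', if_pos u.2]
    simp only [hq, IsFrontier, mem_arrSet]
    constructor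
    · intro h1
      obtain ⟨v, hv, h2, h3⟩ : ∃ v, v < n ∧ q u v := by
        by_contra hcon
        rw [if_neg hcon] at h1
        exact absurd h1 (by simp)
      exact ⟨⟨v, hv⟩, nadj_iff.1 h2, by simp only; tauto⟩
    · rintro ⟨v, h2, h3⟩
      rw [if_pos ⟨v, v.2, nadj_iff.2 h2, by tauto⟩]
  · intro i h1 hi F
    have H1 : Ctx G T (h1.setVar .u i) := (H.frame F rfl).setVar _ _ rfl
    have hP : min i h1.P = i := by have := F.P; have := H.n_le; omega
    set h2 := (h1.setVar .u i).setArr .fr i 0 with hh2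
    have e2 : (Cmd.store .fr (.var .u) (.lit 0)).run (h1.setVar .u i) = h2 := by
      simp [run_store, Exp.eval, hP, hh2]
    have H2 : Ctx G T h2 := e2 ▸ H1.run _ rfl
    rw [run_seq, e2]
    refine run_loop (x := .v) H2.forN (fun j h3 => h3.arr .fr i =
      (if ∃ v, v < j ∧ q i v then 1 else 0) ∧ ∀ l, l ≠ i → h3.arr .fr l = h1.arr .fr l)
      ⟨by simp [hh2], fun l hl => by simp [hh2, hl]⟩ ?_
    intro j h3 hj F3 ⟨ih1, ih2⟩
    have H3 : Ctx G T (h3.setVar .v j) := (H2.frame F3 rfl).setVar _ _ rfl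
    have eA : h3.arr .inA = h.arr .inA := (F3.arr .inA rfl).trans (by
      funext l; simp [hh2, F.arr .inA rfl])
    have eu : (h3.setVar .v j).var .u = i := by simp [F3.var .u rfl, hh2]
    have ev : (h3.setVar .v j).var .v = j := by simp
    have hu := eu.trans_lt hi
    have hv := ev.trans_lt hj
    have hP3 : min i h3.P = i := by have := H3.n_le; simp at this; omega
    simp only [run_whenDo, run_store, Cond.eval_and, Cond.eval_or, Cond.eval_not,
      H3.adjC hu hv, H3.isOne hu, H3.isOne hv]
    simp only [eu, ev, Store.setVar_arr, eA, Exp.eval, Store.setVar_P', hP3]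
    by_cases hqq : q i j
    · rw [if_pos (by exact hqq), if_pos ⟨j, by omega, hqq⟩]
      exact ⟨by simp, fun l hl => by simp [hl, ih2 l hl]⟩
    · rw [if_neg (by exact hqq)]
      refine ⟨?_, ih2⟩
      simp only [Store.setVar_arr, ih1]
      congr 1
      apply propext
      constructor
      · rintro ⟨v, hv, hv'⟩; exact ⟨v, by omega, hv'⟩
      · rintro ⟨v, hv, hv'⟩
        rcases Nat.lt_succ_iff_lt_or_eq.1 hv with h4 | rfl
        exacts [⟨v, h4, hv'⟩, absurd hv' hqq]

theorem rank_spec (H : Ctx G T h)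
    (hfr : ∀ u : Fin n, h.arr .fr u = 1 ↔ IsFrontier G (arrSet n (h.arr .inA)) u) :
    (rankCmd.run h).var .rk = 1 ↔ IsRankOne G (arrSet n (h.arr .inA)) := by
  classical
  have H0 : Ctx G T (h.setVar .rk 1) := H.setVar _ _ rfl
  set q : ℕ → ℕ → Prop := fun u v => (h.arr .inA u = 1 ∧ h.arr .inA v ≠ 1) ∧
    (h.arr .fr u = 1 ∧ h.arr .fr v = 1) ∧ ¬ NAdj G u v with hq
  have key := run_loop_flag (x := .u) (c := forV (whenDo (.and (.and (isOne .inA .u)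
    (.not (isOne .inA .v))) (.and (.and (isOne .fr .u) (isOne .fr .v)) (.not (adjC .u .v))))
    (.assign .rk (.lit 0)))) H0.forN .rk 0 (fun u => ∃ v, v < n ∧ q u v) ?_
  · have key' : (rankCmd.run h).var .rk = _ := key
    rw [key']
    split_ifs with hc
    · obtain ⟨u, hu, v, hv, h1, h2, h3⟩ := hc
      simp only [false_iff]
      intro hr
      refine h3 ⟨hu, hv, hr _ ?_ _ ?_ ?_ ?_⟩
      · simpa using h1.1
      · simpa using h1.2
      · exact (hfr ⟨u, hu⟩).1 h2.1
      · exact (hfr ⟨v, hv⟩).1 h2.2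
    · simp only [Store.setVar_var, if_true, true_iff]
      intro u hu v hv h1 h2
      by_contra h3
      refine hc ⟨u, u.2, v, v.2, ⟨by simpa using hu, by simpa using hv⟩,
        ⟨(hfr u).2 h1, (hfr v).2 h2⟩, fun h4 => h3 (nadj_iff.1 h4)⟩
  · intro i h1 hi F
    have H1 : Ctx G T (h1.setVar .u i) := (H0.frame F rfl).setVar _ _ rfl
    have e1 : ∀ a, h1.arr a = h.arr a := fun a => F.arr a rfl
    refine (run_loop_flag (x := .v) H1.forN .rk 0 (q i) ?_).trans (by simp)
    intro j h2 hj F2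
    have H2 : Ctx G T (h2.setVar .v j) := (H1.frame F2 rfl).setVar _ _ rfl
    have e2 : ∀ a, h2.arr a = h.arr a := fun a => (F2.arr a rfl).trans (e1 a)
    have eu : (h2.setVar .v j).var .u = i := by simp [F2.var .u rfl]
    have ev : (h2.setVar .v j).var .v = j := by simp
    have hu := eu.trans_lt hi
    have hv := ev.trans_lt hj
    simp only [run_whenDo, run_assign, Cond.eval_and, Cond.eval_not, H2.adjC hu hv, H2.isOne hu,
      H2.isOne hv]
    simp only [eu, ev, Store.setVar_arr, e2]
    by_cases hqq : q i j
    · rw [if_pos (by exact hqq), if_pos hqq]; simp [Exp.eval]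
    · rw [if_neg (by exact hqq), if_neg hqq]; simp

theorem small_spec (H : Ctx G T h)
    (hfr : ∀ u : Fin n, h.arr .fr u = 1 ↔ IsFrontier G (arrSet n (h.arr .inA)) u) :
    arrSet n ((smallCmd.run h).arr .inC) = smallSide G (arrSet n (h.arr .inA)) := by
  classical
  set h0 := (h.setVar .a 0).setVar .b 0 with hh0
  have H0 : Ctx G T h0 := (H.setVar _ _ rfl).setVar _ _ rfl
  set c1 : Cmd := forV (whenDo (isOne .fr .v) (.ite (isOne .inA .v) (inc .a) (inc .b))) with hc1
  have step : ∀ i h1, i < n → Frame c1 h0 h1 →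
      ((whenDo (isOne .fr .v) (.ite (isOne .inA .v) (inc .a) (inc .b))).run (h1.setVar .v i)).var .a
        = h1.var .a + (if h.arr .fr i = 1 ∧ h.arr .inA i = 1 then 1 else 0) ∧
      ((whenDo (isOne .fr .v) (.ite (isOne .inA .v) (inc .a) (inc .b))).run (h1.setVar .v i)).var .b
        = h1.var .b + (if h.arr .fr i = 1 ∧ h.arr .inA i ≠ 1 then 1 else 0) := by
    intro i h1 hi F
    have H1 : Ctx G T (h1.setVar .v i) := (H0.frame F rfl).setVar _ _ rfl
    have e1 : ∀ a, h1.arr a = h.arr a := fun a => F.arr a rfl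
    have ev : (h1.setVar .v i).var .v = i := by simp
    simp only [run_whenDo, run_ite, H1.isOne (ev.trans_lt hi), H1.run_inc]
    simp only [ev, Store.setVar_arr, e1]
    by_cases b1 : h.arr .fr i = 1 <;> by_cases b2 : h.arr .inA i = 1 <;> simp [b1, b2]
  have ra := run_loop_sum H0.forN .a _ fun j h4 hj F4 => (step j h4 hj F4).1
  have rb := run_loop_sum H0.forN .b _ fun j h4 hj F4 => (step j h4 hj F4).2
  have ra' : (c1.run h0).var .a =
      ((arrSet n (h.arr .inA)).filter (IsFrontier G (arrSet n (h.arr .inA)))).card := by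
    refine ra.trans ?_
    rw [Finset.sum_range, ← Finset.card_filter]
    simp only [hh0, Store.setVar_var, reduceCtorEq, if_false, if_true, zero_add]
    congr 1
    ext u
    simp [← hfr, and_comm]
  have rb' : (c1.run h0).var .b =
      ((arrSet n (h.arr .inA))ᶜ.filter (IsFrontier G (arrSet n (h.arr .inA)))).card := by
    refine rb.trans ?_
    rw [Finset.sum_range, ← Finset.card_filter]
    simp only [hh0, Store.setVar_var, if_true, zero_add]
    congr 1
    ext u
    simp [← hfr, and_comm]
  have F1 := Frame.run c1 h0
  set h2 := c1.run h0 with hh2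
  have H2 : Ctx G T h2 := H0.frame F1 rfl
  have key := run_loop_fill (x := .v) (h := h2) (c := .ite (.and (isOne .fr .v)
    (.or (.and (isOne .inA .v) (.not (.lt (.var .b) (.var .a))))
    (.and (.not (isOne .inA .v)) (.lt (.var .b) (.var .a)))))
    (.store .inC (.var .v) (.lit 1)) (.store .inC (.var .v) (.lit 0))) H2.forN .inC
    (fun v => if h.arr .fr v = 1 ∧ ((h.arr .inA v = 1 ∧ ¬ h2.var .b < h2.var .a) ∨
      (¬ h.arr .inA v = 1 ∧ h2.var .b < h2.var .a)) then 1 else 0) ?_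
  · ext v
    have key' : (smallCmd.run h).arr .inC v = _ := key v
    rw [mem_arrSet, key', if_pos v.2, smallSide, ← ra', ← rb']
    by_cases hlt : h2.var .b < h2.var .a
    · rw [if_neg (show ¬ h2.var .a ≤ h2.var .b by omega)]
      simp [hlt, hfr, and_comm]
    · rw [if_pos (show h2.var .a ≤ h2.var .b by omega)]
      simp [hlt, hfr, and_comm]
  · intro i h1 hi F
    have H1 : Ctx G T (h1.setVar .v i) := (H2.frame F rfl).setVar _ _ rfl
    have e1 : h1.arr .fr = h.arr .fr := (F.arr .fr rfl).trans (F1.arr .fr rfl)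
    have e2 : h1.arr .inA = h.arr .inA := (F.arr .inA rfl).trans (F1.arr .inA rfl)
    have ev : (h1.setVar .v i).var .v = i := by simp
    have hP : min i h1.P = i := by have := F.P; have := H2.n_le; omega
    simp only [run_ite, run_store, Cond.eval_and, Cond.eval_or, Cond.eval_not, Cond.eval_lt,
      H1.isOne (ev.trans_lt hi)]
    simp only [ev, Store.setVar_arr, e1, e2, Exp.eval, Store.setVar_var, reduceCtorEq, if_false,
      Store.setVar_P', hP, F.var .a rfl, F.var .b rfl]
    split_ifs <;> exact ⟨by simp, fun j hj => by simp [hj]⟩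

/-! #### Branching -/

open Classical in
/-- One step of the greedy cover; the state consists of the cover, the number of bits used and a
failure flag. -/
noncomputable def gstep (q : ℕ → ℕ → Prop) (K : ℕ) (bt : ℕ → ℕ) (s : (ℕ → ℕ) × ℕ × ℕ) (p : ℕ × ℕ) :
    (ℕ → ℕ) × ℕ × ℕ :=
  if q p.1 p.2 ∧ s.1 p.1 ≠ 1 ∧ s.1 p.2 ≠ 1 then
    if s.2.1 < K then
      (Function.update s.1 (if bt s.2.1 = 1 then p.1 else p.2) 1, s.2.1 + 1, s.2.2)
    else (s.1, s.2.1, 1)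
  else s

theorem arrSet_update {f : ℕ → ℕ} (u : Fin n) :
    arrSet n (Function.update f u 1) = insert u (arrSet n f) := by
  ext v
  simp only [mem_arrSet, Function.update_apply, Finset.mem_insert, Fin.ext_iff]
  split_ifs with h <;> simp [h]

/-- Each bit that is used adds one new vertex, so the size of the set equals the number of used
bits. The set only grows, and unless the flag is raised every edge is covered once it has been
visited. -/
theorem gfold_sound {q : ℕ → ℕ → Prop} (hq : ∀ u v, q u v → u < n ∧ v < n) {K : ℕ} {bt : ℕ → ℕ}
    (l : List (ℕ × ℕ)) : ∀ s : (ℕ → ℕ) × ℕ × ℕ, (arrSet n s.1).card = s.2.1 → s.2.1 ≤ K →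
      (arrSet n (l.foldl (gstep q K bt) s).1).card ≤ K ∧
      (∀ v, s.1 v = 1 → (l.foldl (gstep q K bt) s).1 v = 1) ∧
      ((l.foldl (gstep q K bt) s).2.2 = 0 → s.2.2 = 0 ∧ ∀ p ∈ l, q p.1 p.2 →
        (l.foldl (gstep q K bt) s).1 p.1 = 1 ∨ (l.foldl (gstep q K bt) s).1 p.2 = 1) := by
  induction l with
  | nil => intro s h1 h2; exact ⟨h1 ▸ h2, fun v hv => hv, fun h => ⟨h, by simp⟩⟩
  | cons p l ih =>
    intro s h1 h2
    rw [List.foldl_cons]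
    have main : (arrSet n (gstep q K bt s p).1).card = (gstep q K bt s p).2.1 ∧
        (gstep q K bt s p).2.1 ≤ K ∧ (∀ v, s.1 v = 1 → (gstep q K bt s p).1 v = 1) ∧
        ((gstep q K bt s p).2.2 = 0 → s.2.2 = 0 ∧ (q p.1 p.2 →
          (gstep q K bt s p).1 p.1 = 1 ∨ (gstep q K bt s p).1 p.2 = 1)) := by
      unfold gstep
      split_ifs with c1 c2 c3
      · have := arrSet_update (f := s.1) ⟨p.1, (hq _ _ c1.1).1⟩
        simp only at this ⊢
        rw [this, Finset.card_insert_of_notMem (by simpa using c1.2.1), h1]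
        refine ⟨rfl, c2, fun v hv => ?_, fun h => ⟨h, fun _ => Or.inl (by simp)⟩⟩
        simp only [Function.update_apply]; split_ifs <;> simp [hv]
      · have := arrSet_update (f := s.1) ⟨p.2, (hq _ _ c1.1).2⟩
        simp only at this ⊢
        rw [this, Finset.card_insert_of_notMem (by simpa using c1.2.2), h1]
        refine ⟨rfl, c2, fun v hv => ?_, fun h => ⟨h, fun _ => Or.inr (by simp)⟩⟩
        simp only [Function.update_apply]; split_ifs <;> simp [hv]
      · exact ⟨h1, h2, fun v hv => hv, fun h => by simp at h⟩
      · exact ⟨h1, h2, fun v hv => hv, fun h => ⟨h, fun hqp => by tauto⟩⟩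
    obtain ⟨i1, i2, i3⟩ := ih _ main.1 main.2.1
    refine ⟨i1, fun v hv => i2 v (main.2.2.1 v hv), fun h => ?_⟩
    obtain ⟨j1, j2⟩ := i3 h
    obtain ⟨k1, k2⟩ := main.2.2.2 j1
    refine ⟨k1, fun p' hp' hqp => ?_⟩
    rcases List.mem_cons.1 hp' with rfl | hp'
    · exact (k2 hqp).imp (i2 _) (i2 _)
    · exact j2 p' hp' hqp

/-- For every cover there are bits that lead the greedy algorithm into it. -/
theorem gfold_complete {q : ℕ → ℕ → Prop} (hq : ∀ u v, q u v → u < n ∧ v < n) {K : ℕ}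
    {C : Finset (Fin n)} (hC : C.card ≤ K)
    (hcov : ∀ u v : Fin n, q u v → u ∈ C ∨ v ∈ C) (l : List (ℕ × ℕ)) :
    ∀ s : (ℕ → ℕ) × ℕ × ℕ, (arrSet n s.1).card = s.2.1 → arrSet n s.1 ⊆ C →
      ∃ b : ℕ → ℕ, ∀ bt : ℕ → ℕ, (∀ j, s.2.1 ≤ j → j < K → (bt j = 1 ↔ b j = 1)) →
        (l.foldl (gstep q K bt) s).2.2 = s.2.2 ∧ arrSet n (l.foldl (gstep q K bt) s).1 ⊆ C := by
  induction l with
  | nil => intro s h1 h2; exact ⟨fun _ => 0, fun bt _ => ⟨rfl, h2⟩⟩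
  | cons p l ih =>
    intro s h1 h2
    by_cases c1 : q p.1 p.2 ∧ s.1 p.1 ≠ 1 ∧ s.1 p.2 ≠ 1
    · obtain ⟨hu, hv⟩ := hq _ _ c1.1
      -- The current subset of `C` misses both ends of an edge that `C` covers. So it is a proper
      -- subset, and a bit is left.
      have hlt : s.2.1 < K := by
        rw [← h1]
        refine (Finset.card_lt_card ⟨h2, fun hsub => ?_⟩).trans_le hC
        rcases hcov ⟨p.1, hu⟩ ⟨p.2, hv⟩ c1.1 with h3 | h3
        · exact c1.2.1 (by simpa using hsub h3)
        · exact c1.2.2 (by simpa using hsub h3)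
      have hw : ∃ (w : Fin n) (β : ℕ), w ∈ C ∧ s.1 w ≠ 1 ∧
          (if β = 1 then p.1 else p.2) = (w : ℕ) := by
        rcases hcov ⟨p.1, hu⟩ ⟨p.2, hv⟩ c1.1 with h3 | h3
        · exact ⟨⟨p.1, hu⟩, 1, h3, c1.2.1, by simp⟩
        · exact ⟨⟨p.2, hv⟩, 0, h3, c1.2.2, by simp⟩
      obtain ⟨w, β, hwC, hws, hwβ⟩ := hw
      have e0 := arrSet_update (f := s.1) w
      obtain ⟨b, hb⟩ := ih (Function.update s.1 w 1, s.2.1 + 1, s.2.2)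
        (by simp only [e0]; rw [Finset.card_insert_of_notMem (by simpa using hws), h1])
        (by simp only [e0]; exact Finset.insert_subset hwC h2)
      -- The bit for this edge picks an end in `C`; the later bits come from the induction.
      refine ⟨fun j => if j = s.2.1 then β else b j, fun bt hbt => ?_⟩
      have hs : gstep q K bt s p = (Function.update s.1 w 1, s.2.1 + 1, s.2.2) := by
        have := hbt s.2.1 le_rfl hlt
        simp only [if_true] at this
        rw [gstep, if_pos c1, if_pos hlt, ← hwβ]
        simp only [this]
      rw [List.foldl_cons, hs]
      refine hb bt fun j hj hjK => ?_
      have := hbt j (by simp only at hj; omega) hjK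
      simp only at this hj
      rwa [if_neg (by omega)] at this
    · obtain ⟨b, hb⟩ := ih s h1 h2
      refine ⟨b, fun bt hbt => ?_⟩
      have hs : gstep q K bt s p = s := by rw [gstep, if_neg c1]
      rw [List.foldl_cons, hs]
      exact hb bt hbt

end

section

variable {n m : ℕ} {G : SimpleGraph (Fin n)} {T : SimpleGraph (Fin m)} {h h' : Store}

theorem Store.setArr_arr_self (h : Store) (a : Arr) (i k : ℕ) :
    (h.setArr a i k).arr a = Function.update (h.arr a) i k := by
  simp [Store.setArr]

/-- The pair `u`, `v` is an edge that leaves the set with characteristic function `A`. -/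
def CutEdge (G : SimpleGraph (Fin n)) (A : ℕ → ℕ) (u v : ℕ) : Prop :=
  A u = 1 ∧ A v ≠ 1 ∧ NAdj G u v

theorem CutEdge.lt {A : ℕ → ℕ} {u v : ℕ} (h : CutEdge G A u v) : u < n ∧ v < n :=
  ⟨h.2.2.1, h.2.2.2.1⟩

/-- The state of the greedy cover. -/
def gstate (h : Store) : (ℕ → ℕ) × ℕ × ℕ := (h.arr .cov, h.var .i, h.var .fail)

theorem greedyStep_spec (H : Ctx G T h) (hu : h.var .u < n) (hv : h.var .v < n)
    (hK : h.var .K ≤ n) : gstate (greedyStep.run h) =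
      gstep (CutEdge G (h.arr .inA)) (h.var .K) (h.arr .bt) (gstate h) (h.var .u, h.var .v) := by
  have hP := H.n_le
  have hPu : min (h.var .u) h.P = h.var .u := by omega
  have hPv : min (h.var .v) h.P = h.var .v := by omega
  have hc : (Cond.and (.and (isOne .inA .u) (.not (isOne .inA .v))) (.and (adjC .u .v)
      (.and (.not (isOne .cov .u)) (.not (isOne .cov .v))))).eval h = true ↔
      CutEdge G (h.arr .inA) (h.var .u) (h.var .v) ∧ h.arr .cov (h.var .u) ≠ 1 ∧
        h.arr .cov (h.var .v) ≠ 1 := by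
    simp only [Cond.eval_and, Cond.eval_not, H.adjC hu hv, H.isOne hu, H.isOne hv, CutEdge]
    tauto
  by_cases c1 : CutEdge G (h.arr .inA) (h.var .u) (h.var .v) ∧ h.arr .cov (h.var .u) ≠ 1 ∧
      h.arr .cov (h.var .v) ≠ 1
  · refine Eq.trans ?_ (if_pos c1).symm
    rw [greedyStep, run_whenDo, if_pos (hc.2 c1), run_ite]
    simp only [Cond.eval_lt, Exp.eval]
    by_cases c2 : h.var .i < h.var .K
    · refine Eq.trans ?_ (if_pos c2).symm
      rw [if_pos c2]
      have h1 : ∀ x : ℕ, x + min 1 h.P = x + 1 := fun x => by omega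
      simp only [run_seq, run_ite, run_store, isOne_eval (show h.var .i ≤ h.P by omega), inc,
        run_assign, Exp.eval, hPu, hPv]
      by_cases c3 : h.arr .bt (h.var .i) = 1
      · simp [Store.setArr_arr_self, h1, gstate, c3]
      · simp [Store.setArr_arr_self, h1, gstate, c3]
    · refine Eq.trans ?_ (if_neg c2).symm
      rw [if_neg c2]
      simp [run_assign, Exp.eval, gstate]
  · refine Eq.trans ?_ (if_neg c1).symm
    rw [greedyStep, run_whenDo, if_neg (mt hc.1 c1)]

/-- All pairs of vertices. -/
def pairs (n k : ℕ) : List (ℕ × ℕ) :=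
  (List.range k).flatMap fun u => (List.range n).map fun v => (u, v)

theorem mem_pairs {n u v : ℕ} (hu : u < n) (hv : v < n) : (u, v) ∈ pairs n n := by
  simp [pairs, hu, hv]

/-- The result of the greedy algorithm with bits `bt`, started with the characteristic
function `z`. -/
noncomputable def gresult (G : SimpleGraph (Fin n)) (A z : ℕ → ℕ) (K : ℕ) (bt : ℕ → ℕ) :
    (ℕ → ℕ) × ℕ × ℕ :=
  (pairs n n).foldl (gstep (CutEdge G A) K bt) ((fun j => if j < n then 0 else z j), 0, 0)

theorem greedy_spec (H : Ctx G T h) (hK : h.var .K ≤ n) : gstate (greedyCmd.run h) =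
    gresult G (h.arr .inA) (h.arr .cov) (h.var .K) (h.arr .bt) := by
  set h1 := (setAll .cov (.lit 0)).run h with hh1
  have F1 : Frame (setAll .cov (.lit 0)) h h1 := Frame.run _ _
  have e1 : h1.arr .cov = fun j => if j < n then 0 else h.arr .cov j := by
    funext j
    exact setAll_arr H (a := .cov) (e := .lit 0) (fun _ => 0) (fun _ _ _ _ => rfl) j
  set h2 := (h1.setVar .i 0).setVar .fail 0 with hh2
  have H2 : Ctx G T h2 := ((H.frame F1 rfl).setVar _ _ rfl).setVar _ _ rfl
  set q := CutEdge G (h.arr .inA)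
  set K := h.var .K
  set bt := h.arr .bt
  have eA : h2.arr .inA = h.arr .inA := F1.arr .inA rfl
  have eb : h2.arr .bt = h.arr .bt := F1.arr .bt rfl
  have eK : h2.var .K = h.var .K := by simpa [hh2] using F1.var .K rfl
  have key := run_loop (x := .u) (c := forV greedyStep) H2.forN
    (fun j h' => gstate h' = (pairs n j).foldl (gstep q K bt) (gstate h2)) (by simp [pairs]) ?_
  · have key' : gstate (greedyCmd.run h) = _ := key
    rw [key', gresult]
    congr 1
    simp [gstate, hh2, e1]
  · intro i h3 hi F3 ih
    have H3 : Ctx G T (h3.setVar .u i) := (H2.frame F3 rfl).setVar _ _ rfl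
    have e3 : pairs n (i + 1) = pairs n i ++ (List.range n).map fun v => (i, v) := by
      simp [pairs, List.range_succ]
    rw [e3, List.foldl_append, ← ih]
    refine run_loop (x := .v) H3.forN (fun j h' => gstate h' =
      ((List.range j).map fun v => (i, v)).foldl (gstep q K bt) (gstate h3)) (by simp [gstate]) ?_
    intro j h4 hj F4 ih4
    have H4 : Ctx G T (h4.setVar .v j) := (H3.frame F4 rfl).setVar _ _ rfl
    have f1 : (h4.setVar .v j).arr .inA = h.arr .inA :=
      (F4.arr .inA rfl).trans ((F3.arr .inA rfl).trans eA)
    have f2 : (h4.setVar .v j).arr .bt = h.arr .bt :=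
      (F4.arr .bt rfl).trans ((F3.arr .bt rfl).trans eb)
    have f3 : (h4.setVar .v j).var .K = h.var .K := by
      simpa [F4.var .K rfl, F3.var .K rfl] using eK
    have f4 : (h4.setVar .v j).var .u = i := by simp [F4.var .u rfl]
    have f5 : (h4.setVar .v j).var .v = j := by simp
    have := greedyStep_spec H4 (f4.trans_lt hi) (f5.trans_lt hj) (f3.trans_le hK)
    rw [this, f1, f2, f3, f4, f5, List.range_succ, List.map_append, List.foldl_append, ← ih4]
    simp [gstate, q, K, bt]

theorem gfold_keep {q : ℕ → ℕ → Prop} (hq : ∀ u v, q u v → u < n ∧ v < n) {K : ℕ} {bt : ℕ → ℕ}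
    (l : List (ℕ × ℕ)) {j : ℕ} (hj : n ≤ j) :
    ∀ s : (ℕ → ℕ) × ℕ × ℕ, (l.foldl (gstep q K bt) s).1 j = s.1 j := by
  induction l with
  | nil => intro s; rfl
  | cons p l ih =>
    intro s
    rw [List.foldl_cons, ih]
    unfold gstep
    split_ifs with c1 c2 c3
    · have := (hq _ _ c1.1).1
      exact Function.update_of_ne (by omega) _ _
    · have := (hq _ _ c1.1).2
      exact Function.update_of_ne (by omega) _ _
    · rfl
    · rfl

variable {A z bt : ℕ → ℕ} {K : ℕ}

theorem gresult_keep {j : ℕ} (hj : n ≤ j) : (gresult G A z K bt).1 j = z j := by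
  rw [gresult, gfold_keep (fun _ _ => CutEdge.lt) _ hj]
  exact if_neg (by omega)

/-- Arrays are functions on all of `ℕ`, and entries beyond `n` are never reset. With this lemma the
results of all rounds can be expressed by one initial `z`. -/
theorem gresult_congr {z' : ℕ → ℕ} (hz : ∀ j, n ≤ j → z' j = z j) :
    gresult G A z' K bt = gresult G A z K bt := by
  have : (fun j => if j < n then 0 else z' j) = fun j => if j < n then 0 else z j := by
    funext j
    split_ifs with hj
    · rfl
    · exact hz j (by omega)
  rw [gresult, this, gresult]

theorem arrSet_zero : arrSet n (fun j => if j < n then 0 else z j) = ∅ := by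
  ext v; simp

theorem gresult_sound (h : (gresult G A z K bt).2.2 = 0) :
    IsCover G (arrSet n A) (arrSet n (gresult G A z K bt).1) ∧
      (arrSet n (gresult G A z K bt).1).card ≤ K := by
  obtain ⟨h1, -, h2⟩ := gfold_sound (fun _ _ => CutEdge.lt (G := G) (A := A)) (K := K) (bt := bt)
    (pairs n n) ((fun j => if j < n then 0 else z j), 0, 0) (by simp [arrSet_zero]) (by simp)
  refine ⟨fun u hu v hv huv => ?_, h1⟩
  simp only [mem_arrSet] at hu hv ⊢
  exact (h2 h).2 (u, v) (mem_pairs u.2 v.2) ⟨hu, hv, nadj_iff.2 huv⟩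

theorem gresult_complete {C : Finset (Fin n)} (hC : IsCover G (arrSet n A) C) (hK : C.card ≤ K) :
    ∃ b : ℕ → ℕ, ∀ bt : ℕ → ℕ, (∀ j, j < K → (bt j = 1 ↔ b j = 1)) →
      (gresult G A z K bt).2.2 = 0 ∧ arrSet n (gresult G A z K bt).1 ⊆ C := by
  obtain ⟨b, hb⟩ := gfold_complete (fun _ _ => CutEdge.lt (G := G) (A := A)) hK (fun u v huv =>
    hC u (by simpa using huv.1) v (by simpa using huv.2.1) (nadj_iff.1 huv.2.2)) (pairs n n)
    ((fun j => if j < n then 0 else z j), 0, 0) (by simp [arrSet_zero]) (by simp [arrSet_zero])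
  exact ⟨b, fun bt hbt => hb bt fun j _ hj => hbt j hj⟩

/-- The cover that has been found so far, if any. -/
def Found (G : SimpleGraph (Fin n)) (A : ℕ → ℕ) (K : ℕ) (h : Store) : Prop :=
  h.var .found = 0 ∨ h.var .found = 1 ∧ IsCover G (arrSet n A) (arrSet n (h.arr .inC)) ∧
    (arrSet n (h.arr .inC)).card ≤ K ∧ h.var .out = (arrSet n (h.arr .inC) \ arrSet n A).card

/-- Once a cover has been found, `found` stays set and `out` never increases, so the final cover is
at least as good as the result of every single bit vector. -/
theorem branchBody_spec (H : Ctx G T h) (hK : h.var .K ≤ n) (hrk : h.var .rk ≠ 1)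
    (hF : Found G (h.arr .inA) (h.var .K) h) :
    Found G (h.arr .inA) (h.var .K) (branchBody.run h) ∧
    (h.var .found = 1 → (branchBody.run h).var .found = 1 ∧
      (branchBody.run h).var .out ≤ h.var .out) ∧
    ((gresult G (h.arr .inA) (h.arr .cov) (h.var .K) (h.arr .bt)).2.2 = 0 →
      (branchBody.run h).var .found = 1 ∧ (branchBody.run h).var .out ≤ (arrSet n
        (gresult G (h.arr .inA) (h.arr .cov) (h.var .K) (h.arr .bt)).1 \
          arrSet n (h.arr .inA)).card) ∧
    (∀ j, n ≤ j → (branchBody.run h).arr .cov j = h.arr .cov j) ∧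
    (code false (h.arr .mk) (h.arr .bt) n < maxCode false (h.arr .mk) n →
      code false (h.arr .mk) ((branchBody.run h).arr .bt) n =
        code false (h.arr .mk) (h.arr .bt) n + 1) := by
  have g := greedy_spec H hK
  have F1 : Frame greedyCmd h (greedyCmd.run h) := Frame.run _ _
  set h1 := greedyCmd.run h with hh1
  have H1 : Ctx G T h1 := H.frame F1 rfl
  set ρ := gresult G (h.arr .inA) (h.arr .cov) (h.var .K) (h.arr .bt) with hρ
  have ecov : h1.arr .cov = ρ.1 := congrArg Prod.fst g
  have efail : h1.var .fail = ρ.2.2 := congrArg (fun x => x.2.2) g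
  set c2 : Cmd := whenDo (.eq (.var .fail) (.lit 0))
    (.assign .o (.lit 0) ;; forV (whenDo (.and (isOne .cov .v) (.not (isOne .inA .v))) (inc .o)) ;;
      whenDo (.or (.eq (.var .found) (.lit 0)) (.lt (.var .o) (.var .out)))
        (.assign .found (.lit 1) ;; .assign .out (.var .o) ;;
          setAll .inC (.arr .cov (.var .v)))) with hc2
  have F2 : Frame c2 h1 (c2.run h1) := Frame.run _ _
  set h2 := c2.run h1 with hh2
  have H2 : Ctx G T h2 := H1.frame F2 rfl
  have F3 : Frame (nextCmd .bt .mk) h2 (branchBody.run h) := Frame.run _ _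
  have eA1 : h1.arr .inA = h.arr .inA := F1.arr .inA rfl
  have key : (ρ.2.2 ≠ 0 → h2 = h1) ∧ (ρ.2.2 = 0 →
      h2.var .found = 1 ∧ h2.var .out ≤ (arrSet n ρ.1 \ arrSet n (h.arr .inA)).card ∧
      ((arrSet n (h2.arr .inC) = arrSet n ρ.1 ∧
        h2.var .out = (arrSet n ρ.1 \ arrSet n (h.arr .inA)).card ∧
        (h1.var .found ≠ 0 → h2.var .out ≤ h1.var .out)) ∨
       (h1.var .found ≠ 0 ∧ h2.arr .inC = h1.arr .inC ∧ h2.var .out = h1.var .out ∧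
        h2.var .found = h1.var .found))) := by
    have hd : h2 = c2.run h1 := rfl
    rw [hc2, run_whenDo] at hd
    simp only [Cond.eval_eq, Exp.eval, efail] at hd
    refine ⟨fun hne => by rw [hd, if_neg hne], fun he => ?_⟩
    rw [if_pos he] at hd
    set c3 : Cmd := forV (whenDo (.and (isOne .cov .v) (.not (isOne .inA .v))) (inc .o)) with hc3
    set h3 := c3.run (h1.setVar .o 0) with hh3
    have F4 : Frame c3 (h1.setVar .o 0) h3 := Frame.run _ _
    have H0 : Ctx G T (h1.setVar .o 0) := H1.setVar _ _ rfl
    have H3 : Ctx G T h3 := H0.frame F4 rfl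
    have eo : h3.var .o = (arrSet n ρ.1 \ arrSet n (h.arr .inA)).card := by
      refine (run_loop_sum (x := .v) H0.forN .o (fun v =>
        if ρ.1 v = 1 ∧ h.arr .inA v ≠ 1 then 1 else 0) ?_).trans ?_
      · intro i h4 hi F
        have H4 : Ctx G T (h4.setVar .v i) := (H0.frame F rfl).setVar _ _ rfl
        have ev : (h4.setVar .v i).var .v = i := by simp
        have e1 : h4.arr .cov = ρ.1 := (F.arr .cov rfl).trans ecov
        have e2 : h4.arr .inA = h.arr .inA := (F.arr .inA rfl).trans eA1
        simp only [run_whenDo, Cond.eval_and, Cond.eval_not, H4.isOne (ev.trans_lt hi), H4.run_inc]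
        simp only [ev, Store.setVar_arr, e1, e2]
        by_cases b1 : ρ.1 i = 1 <;> by_cases b2 : h.arr .inA i = 1 <;> simp [b1, b2]
      · simp only [Store.setVar_var, if_true, zero_add]
        rw [Finset.sum_range, ← Finset.card_filter]
        congr 1
        ext v; simp
    have ef : h3.var .found = h1.var .found := (F4.var .found rfl).trans (by simp)
    have eout : h3.var .out = h1.var .out := (F4.var .out rfl).trans (by simp)
    have eC : h3.arr .inC = h1.arr .inC := F4.arr .inC rfl
    have ecov3 : h3.arr .cov = ρ.1 := (F4.arr .cov rfl).trans ecov
    have hd' : h2 = (whenDo (.or (.eq (.var .found) (.lit 0)) (.lt (.var .o) (.var .out)))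
        (.assign .found (.lit 1) ;; .assign .out (.var .o) ;;
          setAll .inC (.arr .cov (.var .v)))).run h3 := hd
    rw [run_whenDo] at hd'
    simp only [Cond.eval_or, Cond.eval_eq, Cond.eval_lt, Exp.eval, ef, eout] at hd'
    by_cases hc : h1.var .found = 0 ∨ h3.var .o < h1.var .out
    · rw [if_pos hc] at hd'
      set h5 := (h3.setVar .found 1).setVar .out (h3.var .o) with hh5
      have e5 : h2 = (setAll .inC (.arr .cov (.var .v))).run h5 := by
        rw [hd']; simp [run_seq, run_assign, Exp.eval, hh5]
      have H5 : Ctx G T h5 := (H3.setVar _ _ rfl).setVar _ _ rfl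
      have F5 : Frame (setAll .inC (.arr .cov (.var .v))) h5 h2 := e5 ▸ Frame.run _ _
      have eC5 : arrSet n (h2.arr .inC) = arrSet n ρ.1 := by
        ext v
        rw [mem_arrSet, e5, setAll_arr H5 ρ.1, if_pos v.2, mem_arrSet]
        intro i h6 hi F6
        have hP : min i h6.P = i := by have := F6.P; have := H5.n_le; omega
        have : h6.arr .cov = ρ.1 := (F6.arr .cov rfl).trans ecov3
        simp [Exp.eval, hP, this]
      have eo5 : h2.var .out = (arrSet n ρ.1 \ arrSet n (h.arr .inA)).card :=
        (F5.var .out rfl).trans (by simp [hh5, eo])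
      refine ⟨(F5.var .found rfl).trans (by simp [hh5]), eo5.le, Or.inl ⟨eC5, eo5, fun hf => ?_⟩⟩
      have := hc.resolve_left hf
      omega
    · rw [if_neg hc] at hd'
      push Not at hc
      have f1 : h1.var .found = h.var .found := F1.var .found rfl
      rw [hd']
      refine ⟨?_, by omega, Or.inr ⟨hc.1, eC, eout, ef⟩⟩
      rcases hF with hF | hF
      · exact absurd (f1.trans hF) hc.1
      · rw [ef, f1, hF.1]
  have e3f : (branchBody.run h).var .found = h2.var .found := F3.var .found rfl
  have e3o : (branchBody.run h).var .out = h2.var .out := F3.var .out rfl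
  have e3C : (branchBody.run h).arr .inC = h2.arr .inC := F3.arr .inC rfl
  have e1f : h1.var .found = h.var .found := F1.var .found rfl
  have e1o : h1.var .out = h.var .out := F1.var .out rfl
  have e1C : h1.arr .inC = h.arr .inC := F1.arr .inC rfl
  refine ⟨?_, ?_, ?_, ?_, ?_⟩
  · unfold Found at hF ⊢
    rw [e3f, e3o, e3C]
    by_cases hf : ρ.2.2 = 0
    · obtain ⟨k1, k2, ⟨k3, k4, k5⟩ | ⟨k3, k4, k5, k6⟩⟩ := key.2 hf
      · right
        rw [k3]
        obtain ⟨s1, s2⟩ := gresult_sound hf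
        exact ⟨k1, s1, s2, k4⟩
      · right
        rw [e1f] at k3
        have := hF.resolve_left k3
        rw [k4, k5, e1o, e1C]
        exact ⟨k1, this.2⟩
    · rw [key.1 hf, e1f, e1o, e1C]
      exact hF
  · intro hf1
    rw [e3f, e3o]
    by_cases hf : ρ.2.2 = 0
    · obtain ⟨k1, k2, ⟨k3, k4, k5⟩ | ⟨k3, k4, k5, k6⟩⟩ := key.2 hf
      · exact ⟨k1, (k5 (by rw [e1f, hf1]; simp)).trans e1o.le⟩
      · exact ⟨k1, (k5.trans e1o).le⟩
    · rw [key.1 hf, e1f, e1o]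
      exact ⟨hf1, le_rfl⟩
  · intro hf
    rw [e3f, e3o]
    exact ⟨(key.2 hf).1, (key.2 hf).2.1⟩
  · intro j hj
    rw [F3.arr .cov rfl, F2.arr .cov rfl, ecov, gresult_keep hj]
  · intro hlt
    have em : h2.arr .mk = h.arr .mk := (F2.arr .mk rfl).trans (F1.arr .mk rfl)
    have eb : h2.arr .bt = h.arr .bt := (F2.arr .bt rfl).trans (F1.arr .bt rfl)
    have er : h2.var .rk = h.var .rk := (F2.var .rk rfl).trans (F1.var .rk rfl)
    have := (next_spec H2 .bt .mk (by simp) (b := false) (by simp [er, hrk])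
      (by rw [em, eb]; exact hlt)).1
    rw [em, eb] at this
    exact this

end

section

variable {n m : ℕ} {G : SimpleGraph (Fin n)} {T : SimpleGraph (Fin m)} {h h' : Store}

theorem rank_initial {M : ℕ → ℕ} {K : ℕ} (hK : K ≤ n) (hM : ∀ v, v < n → (M v = 1 ↔ v < K)) :
    rank M n = K := by
  have : (Finset.range n).filter (fun v => M v = 1) = Finset.range K := by
    ext v
    simp only [Finset.mem_filter, Finset.mem_range]
    constructor
    · rintro ⟨h1, h2⟩; exact (hM v h1).1 h2
    · intro h1; exact ⟨by omega, (hM v (by omega)).2 h1⟩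
  rw [rank, this, Finset.card_range]

theorem branchLoop_spec (H : Ctx G T h) (hK : h.var .K ≤ n) (hrk : h.var .rk ≠ 1)
    (hfound : h.var .found = 0) (he : h.var .e = 2 ^ h.var .K)
    (hmk : ∀ v, v < n → (h.arr .mk v = 1 ↔ v < h.var .K)) (hbt : ∀ v, v < n → h.arr .bt v = 0) :
    Found G (h.arr .inA) (h.var .K) ((Cmd.bigLoop .j (.var .e) branchBody).run h) ∧
    (∀ C, IsCover G (arrSet n (h.arr .inA)) C → C.card ≤ h.var .K →
      ((Cmd.bigLoop .j (.var .e) branchBody).run h).var .found = 1 ∧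
      ((Cmd.bigLoop .j (.var .e) branchBody).run h).var .out ≤ (C \ arrSet n (h.arr .inA)).card) ∧
    (Cmd.bigLoop .j (.var .e) branchBody).cost h ≤
      1 + 2 ^ h.var .K * (branchBody.pcost h.P + 3) + 4 := by
  set A := h.arr .inA with hA
  set K := h.var .K with hhK
  set M := h.arr .mk with hM
  set z := h.arr .cov with hz
  have hrank : rank M n = K := rank_initial hK hmk
  have hmax : maxCode false M n = 2 ^ K - 1 := by simp [maxCode, hrank]
  have hpos := Nat.one_le_two_pow (n := K)
  have key := run_bigLoop (x := .j) (e := .var .e) (c := branchBody) (h := h) (k := 2 ^ K) he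
    (fun j h' => (j < 2 ^ K → code false M (h'.arr .bt) n = j) ∧
      (∀ i, n ≤ i → h'.arr .cov i = z i) ∧ Found G A K h' ∧
      -- For every target `C` and all bits `b` that lead the greedy algorithm into `C`: once the
      -- counter has passed the code of `b`, the cover kept has no more outer vertices than `C`.
      ∀ C b, (∀ bt : ℕ → ℕ, (∀ j, j < K → (bt j = 1 ↔ b j = 1)) →
          (gresult G A z K bt).2.2 = 0 ∧ arrSet n (gresult G A z K bt).1 ⊆ C) →
        code false M b n < j → h'.var .found = 1 ∧ h'.var .out ≤ (C \ arrSet n A).card)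
    (B := branchBody.pcost h.P) ?_ ?_
  · obtain ⟨⟨-, -, k1, k2⟩, k3⟩ := key
    refine ⟨k1, fun C hC hCK => ?_, k3⟩
    obtain ⟨b, hb⟩ := gresult_complete (z := z) hC hCK
    refine k2 C b hb ?_
    have := code_le_maxCode (b := false) (M := M) (f := b) (k := n)
    omega
  · refine ⟨fun _ => ?_, fun _ _ => rfl, Or.inl hfound, fun _ _ _ h => by omega⟩
    refine Finset.sum_eq_zero fun v hv => ?_
    rw [hbt v (Finset.mem_range.1 hv)]
    simp
  · intro j h1 hj F ⟨i1, i2, i3, i4⟩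
    set h2 := h1.setVar .j j with hh2
    have H2 : Ctx G T h2 := (H.frame F rfl).setVar _ _ rfl
    have eK : h2.var .K = K := by simp [hh2, F.var .K rfl, hhK]
    have er : h2.var .rk = h.var .rk := by simp [hh2, F.var .rk rfl]
    have eA : h2.arr .inA = A := F.arr .inA rfl
    have eM : h2.arr .mk = M := F.arr .mk rfl
    have ef : h2.var .found = h1.var .found := by simp [hh2]
    have eo : h2.var .out = h1.var .out := by simp [hh2]
    have hF2 : Found G (h2.arr .inA) (h2.var .K) h2 := by
      rw [eA, eK]
      unfold Found at i3 ⊢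
      rw [ef, eo]
      exact i3
    obtain ⟨b1, b2, b3, b4, b5⟩ := branchBody_spec H2 (eK.trans_le hK) (er ▸ hrk) hF2
    have eg : gresult G A (h2.arr .cov) K (h2.arr .bt) = gresult G A z K (h1.arr .bt) :=
      gresult_congr i2
    rw [eA, eK] at b1
    rw [eA, eK, eg] at b3
    rw [eM] at b5
    refine ⟨⟨fun hj1 => ?_, fun i hi => ?_, b1, fun C b hb hlt => ?_⟩, ?_⟩
    · have := i1 (by omega)
      rw [b5 (by rw [hmax]; simp only [hh2, Store.setVar_arr]; omega)]
      simp only [hh2, Store.setVar_arr]; omega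
    · rw [b4 i hi]; exact i2 i hi
    · rcases Nat.lt_succ_iff_lt_or_eq.1 hlt with hlt | heq
      · obtain ⟨j1, j2⟩ := i4 C b hb hlt
        obtain ⟨j3, j4⟩ := b2 (ef.trans j1)
        exact ⟨j3, by omega⟩
      -- The current bits have the same code as `b`, hence agree with `b` on all `K` positions.
      · have hci := code_inj (heq.trans (i1 hj).symm)
        obtain ⟨j1, j2⟩ := hb (h1.arr .bt) fun i hi =>
          (hci i (by omega) ((hmk i (by omega)).2 hi)).symm
        obtain ⟨j3, j4⟩ := b3 j1
        exact ⟨j3, j4.trans (Finset.card_le_card (Finset.sdiff_subset_sdiff j2 le_rfl))⟩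
    · have := branchBody.cost_le_pcost rfl h2
      rwa [show h2.P = h.P from F.P] at this

/-- A bound for the cost of one round of `branchCmd`, divided by the number of bit vectors. -/
def branchCost (P : ℕ) : ℕ :=
  (setAll .bt (.lit 0)).pcost P + (forV (.ite (.lt (.var .v) (.var .K))
    (.store .mk (.var .v) (.lit 1)) (.store .mk (.var .v) (.lit 0)))).pcost P +
  (branchBody.pcost P + 8 * P + 50)

/-- No smaller `K` succeeded, so the cover found is minimum. Every minimum cover contains the result
of some bit vector, so none has fewer outer vertices than the one kept. -/
theorem branch_spec (H : Ctx G T h) (hrk : h.var .rk ≠ 1) :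
    IsCanonical G (arrSet n (h.arr .inA)) (arrSet n ((branchCmd.run h).arr .inC)) ∧
    ∀ k, (∃ C, IsCover G (arrSet n (h.arr .inA)) C ∧ C.card ≤ k) →
      branchCmd.cost h ≤ (4 * h.P + 14) + h.P * (branchCost h.P * 2 ^ k + 3) := by
  set A := arrSet n (h.arr .inA) with hA
  have hP := H.n_le
  set h0 := (h.setVar .found 0).setVar .e 1 with hh0
  have H0 : Ctx G T h0 := (H.setVar _ _ rfl).setVar _ _ rfl
  have hb : min ((Exp.add (.var .n) (.lit 1)).eval h0) h0.P = n + 1 := by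
    simp only [Exp.eval, H0.hn]
    have : h0.P = h.P := rfl
    omega
  set body : Cmd := whenDo (.eq (.var .found) (.lit 0))
    (setAll .bt (.lit 0) ;;
      forV (.ite (.lt (.var .v) (.var .K)) (.store .mk (.var .v) (.lit 1))
        (.store .mk (.var .v) (.lit 0))) ;;
      .bigLoop .j (.var .e) branchBody ;; double .e) with hbody
  -- Until something is found no cover has fewer than `K` vertices; afterwards the rounds are idle.
  -- Hence `2 ^ K ≤ 2 ^ k` in every round that works, if some cover has at most `k` vertices.
  set I : ℕ → Store → Prop := fun K h' =>
    (h'.var .found = 0 ∧ h'.var .e = 2 ^ K ∧ ∀ C, IsCover G A C → K ≤ C.card) ∨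
    (h'.var .found = 1 ∧ IsCanonical G A (arrSet n (h'.arr .inC))) with hI
  have step : ∀ K h1, K < n + 1 → Frame (.loop .K (.add (.var .n) (.lit 1)) body) h0 h1 → I K h1 →
      I (K + 1) (body.run (h1.setVar .K K)) ∧
      ∀ k, (∃ C, IsCover G A C ∧ C.card ≤ k) →
        body.cost (h1.setVar .K K) ≤ branchCost h.P * 2 ^ k := by
    intro K h1 hK F ih
    set h2 := h1.setVar .K K with hh2
    have H2 : Ctx G T h2 := (H0.frame F rfl).setVar _ _ rfl
    have ef : h2.var .found = h1.var .found := by simp [hh2]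
    have eP : h2.P = h.P := F.P
    have hcost : body.cost h2 = 3 + if h2.var .found = 0 then
        (setAll .bt (.lit 0) ;; forV (.ite (.lt (.var .v) (.var .K)) (.store .mk (.var .v) (.lit 1))
          (.store .mk (.var .v) (.lit 0))) ;; .bigLoop .j (.var .e) branchBody ;; double .e).cost h2
        else 1 := by
      simp only [hbody, whenDo, Cmd.cost, Cond.cost, Exp.cost, Cond.eval_eq, Exp.eval]
    rw [hcost, hbody, run_whenDo]
    simp only [Cond.eval_eq, Exp.eval, ef]
    rcases ih with ⟨f0, fe, fC⟩ | ⟨f1, fC⟩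
    · rw [if_pos f0, if_pos f0]
      set h3 := (setAll .bt (.lit 0)).run h2 with hh3
      have F3 : Frame (setAll .bt (.lit 0)) h2 h3 := Frame.run _ _
      have H3 : Ctx G T h3 := H2.frame F3 rfl
      set c4 : Cmd := forV (.ite (.lt (.var .v) (.var .K)) (.store .mk (.var .v) (.lit 1))
          (.store .mk (.var .v) (.lit 0))) with hc4
      set h4 := c4.run h3 with hh4
      have F4 : Frame c4 h3 h4 := Frame.run _ _
      have H4 : Ctx G T h4 := H3.frame F4 rfl
      have eK3 : h3.var .K = K := (F3.var .K rfl).trans (by simp [hh2])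
      have eK4 : h4.var .K = K := (F4.var .K rfl).trans eK3
      have eA4 : h4.arr .inA = h.arr .inA :=
        (F4.arr .inA rfl).trans ((F3.arr .inA rfl).trans (F.arr .inA rfl))
      have erk : h4.var .rk = h.var .rk :=
        (F4.var .rk rfl).trans ((F3.var .rk rfl).trans (by simp [hh2, F.var .rk rfl, hh0]))
      have ef4 : h4.var .found = 0 := (F4.var .found rfl).trans ((F3.var .found rfl).trans
        (ef.trans f0))
      have ee4 : h4.var .e = 2 ^ K := (F4.var .e rfl).trans ((F3.var .e rfl).trans
        (by simp [hh2, fe]))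
      have ebt : ∀ v, v < n → h4.arr .bt v = 0 := fun v hv => by
        rw [F4.arr .bt rfl, hh3, setAll_arr H2 (fun _ => 0) (fun _ _ _ _ => rfl), if_pos hv]
      have emk : ∀ v, v < n → (h4.arr .mk v = 1 ↔ v < h4.var .K) := fun v hv => by
        have := run_loop_fill (x := .v) (h := h3) (c := .ite (.lt (.var .v) (.var .K))
          (.store .mk (.var .v) (.lit 1)) (.store .mk (.var .v) (.lit 0))) H3.forN .mk
          (fun v => if v < K then 1 else 0) (by
            intro i h5 hi F5
            have hP5 : min i h5.P = i := by have := F5.P; have := H3.n_le; omega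
            simp only [run_ite, run_store, Cond.eval_lt, Exp.eval, Store.setVar_var, if_true,
              reduceCtorEq, if_false, F5.var .K rfl, eK3, Store.setVar_P', hP5]
            split_ifs <;> exact ⟨by simp, fun j hj => by simp [hj]⟩) v
        have e5 : h4.arr .mk v = _ := this
        rw [e5, if_pos hv, eK4]
        split_ifs with hvK <;> simp [hvK]
      obtain ⟨b1, b2, b3⟩ := branchLoop_spec H4 (by omega) (erk ▸ hrk) ef4 (by rw [ee4, eK4]) emk ebt
      set h5 := (Cmd.bigLoop .j (.var .e) branchBody).run h4 with hh5
      have F5 : Frame (Cmd.bigLoop .j (.var .e) branchBody) h4 h5 := Frame.run _ _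
      have H5 : Ctx G T h5 := H4.frame F5 rfl
      obtain ⟨d1, d2⟩ := double_spec H5 .e (by simp)
      have F6 : Frame (double .e) h5 ((double .e).run h5) := Frame.run _ _
      have ee5 : h5.var .e = 2 ^ K := (F5.var .e rfl).trans ee4
      rw [eA4, eK4] at b1 b2
      refine ⟨?_, ?_⟩
      · show I (K + 1) ((double .e).run h5)
        simp only [hI]
        rw [F6.var .found rfl, F6.arr .inC rfl, d1, ee5]
        rcases b1 with b1 | ⟨b1, c1, c2, c3⟩
        · refine Or.inl ⟨b1, by ring, fun C hC => ?_⟩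
          by_contra hlt
          have := (b2 C hC (by omega)).1
          omega
        · refine Or.inr ⟨b1, c1, fun C' hC' => c2.trans (fC C' hC'), fun C' hC' hc => ?_⟩
          rw [← c3]
          exact (b2 C' hC' (by omega)).2
      · rintro k ⟨C, hC, hCk⟩
        have hKk : K ≤ k := (fC C hC).trans hCk
        have hpow : 2 ^ K ≤ 2 ^ k := Nat.pow_le_pow_right (by omega) hKk
        have hpos := Nat.one_le_two_pow (n := k)
        have q1 := (setAll .bt (.lit 0)).cost_le_pcost rfl h2
        have q2 := c4.cost_le_pcost rfl h3
        have eP3 : h3.P = h.P := F3.P.trans eP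
        have eP4 : h4.P = h.P := F4.P.trans eP3
        have eP5 : h5.P = h.P := F5.P.trans eP4
        rw [eP] at q1
        rw [eP3] at q2
        rw [eP4, eK4] at b3
        rw [eP5, ee5] at d2
        have q3 : (setAll .bt (.lit 0) ;; c4 ;; .bigLoop .j (.var .e) branchBody ;; double .e).cost h2
          = (setAll .bt (.lit 0)).cost h2 + (c4.cost h3 +
            ((Cmd.bigLoop .j (.var .e) branchBody).cost h4 + (double .e).cost h5)) := rfl
        rw [q3]
        set p1 := (setAll .bt (.lit 0)).pcost h.P
        set p2 := c4.pcost h.P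
        set p3 := branchBody.pcost h.P
        have q4 : branchCost h.P = p1 + p2 + (p3 + 8 * h.P + 50) := rfl
        rw [q4]
        have r1 : 2 ^ K * (p3 + 3) ≤ 2 ^ k * (p3 + 3) := Nat.mul_le_mul_right _ hpow
        have r2 : (4 * h.P + 10) * (2 ^ K + 1) ≤ (4 * h.P + 10) * (2 * 2 ^ k) :=
          Nat.mul_le_mul_left _ (by omega)
        have r3 : p1 ≤ p1 * 2 ^ k := Nat.le_mul_of_pos_right _ hpos
        have r4 : p2 ≤ p2 * 2 ^ k := Nat.le_mul_of_pos_right _ hpos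
        nlinarith
    · rw [if_neg (by omega), if_neg (by omega)]
      refine ⟨Or.inr ⟨ef.trans f1, fC⟩, fun k _ => ?_⟩
      have hpos := Nat.one_le_two_pow (n := k)
      have : 50 ≤ branchCost h.P := by unfold branchCost; omega
      calc 3 + 1 ≤ branchCost h.P * 1 := by omega
        _ ≤ _ := Nat.mul_le_mul_left _ hpos
  have hI0 : I 0 h0 := Or.inl ⟨by simp [hh0], by simp [hh0], fun C _ => Nat.zero_le _⟩
  refine ⟨?_, fun k hk => ?_⟩
  · have key := run_loop hb I hI0 fun K h1 hK F ih => (step K h1 hK F ih).1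
    rcases key with ⟨-, -, hall⟩ | ⟨-, hcan⟩
    -- The round `K = n` succeeds at the latest, since all vertices together form a cover.
    · have := hall Finset.univ fun u _ v _ _ => Or.inl (Finset.mem_univ _)
      simp at this
    · exact hcan
  · have key := (cost_loop_le hb I hI0 fun K h1 hK F ih =>
      ⟨(step K h1 hK F ih).1, (step K h1 hK F ih).2 k hk⟩).2
    have q : branchCmd.cost h = 2 + (2 + (Cmd.loop .K (.add (.var .n) (.lit 1)) body).cost h0) := rfl
    have : (n + 1) * (branchCost h.P * 2 ^ k + 3) ≤ h.P * (branchCost h.P * 2 ^ k + 3) :=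
      Nat.mul_le_mul_right _ (by omega)
    simp only [Exp.cost, show h0.P = h.P from rfl] at key
    omega

/-- The cover of the cut, and the type of its states. -/
theorem cover_spec (H : Ctx G T h) :
    IsCanonical G (arrSet n (h.arr .inA)) (arrSet n ((coverCmd.run h).arr .inC)) ∧
    ((coverCmd.run h).var .rk = 1 ↔ IsRankOne G (arrSet n (h.arr .inA))) ∧
    ((coverCmd.run h).var .rk = 1 →
      arrSet n ((coverCmd.run h).arr .inC) = smallSide G (arrSet n (h.arr .inA))) := by
  have hfr := frontier_spec H
  have F1 : Frame frontierCmd h (frontierCmd.run h) := Frame.run _ _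
  set h1 := frontierCmd.run h
  have H1 : Ctx G T h1 := H.frame F1 rfl
  have eA1 : h1.arr .inA = h.arr .inA := F1.arr .inA rfl
  have hrk := rank_spec H1 (by rw [eA1]; exact hfr)
  have F2 : Frame rankCmd h1 (rankCmd.run h1) := Frame.run _ _
  set h2 := rankCmd.run h1
  have H2 : Ctx G T h2 := H1.frame F2 rfl
  have eA2 : h2.arr .inA = h.arr .inA := (F2.arr .inA rfl).trans eA1
  rw [eA1] at hrk
  have e : coverCmd.run h = if h2.var .rk = 1 then smallCmd.run h2 else branchCmd.run h2 := by
    show Cmd.run (.ite _ _ _) h2 = _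
    simp only [run_ite, Cond.eval_eq, Exp.eval]
  rw [e]
  by_cases hr : h2.var .rk = 1
  · rw [if_pos hr]
    have hs := small_spec H2 (by rw [eA2, F2.arr .fr rfl]; exact hfr)
    have F3 : Frame smallCmd h2 (smallCmd.run h2) := Frame.run _ _
    rw [eA2] at hs
    rw [F3.var .rk rfl, hs]
    exact ⟨(hrk.1 hr).isCanonical, hrk, fun _ => rfl⟩
  · rw [if_neg hr]
    have hs := (branch_spec H2 hr).1
    have F3 : Frame branchCmd h2 (branchCmd.run h2) := Frame.run _ _
    rw [eA2] at hs
    rw [F3.var .rk rfl]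
    exact ⟨hs, hrk, fun h => absurd h hr⟩

/-- A bound for the cost of `coverCmd`, divided by the number of states. -/
def coverCost (P : ℕ) : ℕ :=
  frontierCmd.pcost P + rankCmd.pcost P + smallCmd.pcost P + (4 * P + 17 + P * (branchCost P + 3))

/-- A small cover is only required if the rank is not one; otherwise the cover is read off the
frontiers in polynomial time. -/
theorem cover_cost (H : Ctx G T h) {k : ℕ}
    (hk : ¬ IsRankOne G (arrSet n (h.arr .inA)) →
      ∃ C, IsCover G (arrSet n (h.arr .inA)) C ∧ C.card ≤ k) :
    coverCmd.cost h ≤ coverCost h.P * 2 ^ k := by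
  have hfr := frontier_spec H
  have F1 : Frame frontierCmd h (frontierCmd.run h) := Frame.run _ _
  have q1 := frontierCmd.cost_le_pcost rfl h
  have q2 := rankCmd.cost_le_pcost rfl (frontierCmd.run h)
  have q0 : coverCmd.cost h = frontierCmd.cost h + (rankCmd.cost (frontierCmd.run h) +
    (Cmd.ite (.eq (.var .rk) (.lit 1)) smallCmd branchCmd).cost
      (rankCmd.run (frontierCmd.run h))) := rfl
  set h1 := frontierCmd.run h
  have H1 : Ctx G T h1 := H.frame F1 rfl
  have eA1 : h1.arr .inA = h.arr .inA := F1.arr .inA rfl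
  have hrk := rank_spec H1 (by rw [eA1]; exact hfr)
  have F2 : Frame rankCmd h1 (rankCmd.run h1) := Frame.run _ _
  set h2 := rankCmd.run h1
  have H2 : Ctx G T h2 := H1.frame F2 rfl
  have eA2 : h2.arr .inA = h.arr .inA := (F2.arr .inA rfl).trans eA1
  have eP1 : h1.P = h.P := F1.P
  have eP2 : h2.P = h.P := F2.P.trans eP1
  rw [eA1] at hrk
  have q3 : (Cmd.ite (.eq (.var .rk) (.lit 1)) smallCmd branchCmd).cost h2 =
      3 + if h2.var .rk = 1 then smallCmd.cost h2 else branchCmd.cost h2 := by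
    simp only [Cmd.cost, Cond.cost, Exp.cost, Cond.eval_eq, Exp.eval]
  have hpos := Nat.one_le_two_pow (n := k)
  rw [eP1] at q2
  have main : (if h2.var .rk = 1 then smallCmd.cost h2 else branchCmd.cost h2) ≤
      smallCmd.pcost h.P + (4 * h.P + 14 + h.P * (branchCost h.P * 2 ^ k + 3)) := by
    split_ifs with hr
    · have := smallCmd.cost_le_pcost rfl h2
      rw [eP2] at this
      omega
    · have := (branch_spec H2 hr).2 k (by rw [eA2]; exact hk (mt hrk.2 hr))
      rw [eP2] at this
      omega
  rw [q0, q3, coverCost]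
  set p1 := frontierCmd.pcost h.P
  set p2 := rankCmd.pcost h.P
  set p3 := smallCmd.pcost h.P
  have : p1 + p2 + p3 + (4 * h.P + 17 + h.P * (branchCost h.P * 2 ^ k + 3)) ≤
      (p1 + p2 + p3 + (4 * h.P + 17 + h.P * (branchCost h.P + 3))) * 2 ^ k := by
    have r1 : p1 + p2 + p3 + 4 * h.P + 17 + h.P * 3 ≤
      (p1 + p2 + p3 + 4 * h.P + 17 + h.P * 3) * 2 ^ k := Nat.le_mul_of_pos_right _ hpos
    nlinarith
  omega

theorem branchCost_polyBdd : PolyBdd branchCost :=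
  ((Cmd.pcost_polyBdd _).add (Cmd.pcost_polyBdd _)).add
    (((Cmd.pcost_polyBdd _).add ((PolyBdd.const 8).mul .id)).add (.const 50))

theorem coverCost_polyBdd : PolyBdd coverCost :=
  (((Cmd.pcost_polyBdd _).add (Cmd.pcost_polyBdd _)).add (Cmd.pcost_polyBdd _)).add
    ((((PolyBdd.const 4).mul .id).add (.const 17)).add
      (PolyBdd.id.mul (branchCost_polyBdd.add (.const 3))))

end

/-! ### Computation of the tables -/

section

variable {n m : ℕ} {G : SimpleGraph (Fin n)} {T : SimpleGraph (Fin m)} {h h' : Store}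

/-- The labelling stored in record `j` of the tape. -/
def recSet (n : ℕ) (tab : ℕ → ℕ) (j : ℕ) : Finset (Fin n) :=
  arrSet n fun v => tab (j * (n + 1) + 1 + v)

/-- The set of vertices below the node `c`. -/
def topSet (n : ℕ) (top : ℕ → ℕ) (c : ℕ) : Finset (Fin n) := Finset.univ.filter fun v => top v = c

@[simp] theorem mem_topSet {top : ℕ → ℕ} {c : ℕ} {v : Fin n} : v ∈ topSet n top c ↔ top v = c := by
  simp [topSet]

/-- Record `j` occupies the `n + 1` cells from `j * (n + 1)` on: its type and then its labels.
Appending to the tape therefore leaves the earlier records intact. -/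
theorem recSet_congr {tab tab' : ℕ → ℕ} {j N : ℕ} (hj : j < N)
    (h : ∀ i, i < N * (n + 1) → tab' i = tab i) :
    tab' (j * (n + 1)) = tab (j * (n + 1)) ∧ recSet n tab' j = recSet n tab j := by
  have h1 : (j + 1) * (n + 1) ≤ N * (n + 1) := Nat.mul_le_mul_right _ hj
  have h2 : (j + 1) * (n + 1) = j * (n + 1) + (n + 1) := by ring
  refine ⟨h _ (by omega), ?_⟩
  ext v
  have := v.2
  rw [recSet, recSet, mem_arrSet, mem_arrSet, h _ (by omega)]

theorem run_read (p : Fin 3) (x : Var) : (Cmd.read p x).run h =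
    { h.setVar x (h.tab (h.cur p)) with cur := Function.update h.cur p (h.cur p + 1) } := rfl

theorem run_append (e : Exp) : (Cmd.append e).run h =
    { h with
      tab := Function.update h.tab (h.cur 0) (e.eval h)
      cur := Function.update h.cur 0 (h.cur 0 + 1) } := rfl

theorem readRec_spec (H : Ctx G T h) {p : Fin 3} {x : Var} {f : Arr} {j : ℕ}
    (hx : x ≠ .v ∧ x ≠ .tmp) (hloc : isLocal x = true) (hj : h.cur p = j * (n + 1)) :
    ((readRec p x f).run h).var x = h.tab (j * (n + 1)) ∧
    arrSet n (((readRec p x f).run h).arr f) = recSet n h.tab j ∧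
    ((readRec p x f).run h).cur p = (j + 1) * (n + 1) := by
  set h1 := (Cmd.read p x).run h with hh1
  have H1 : Ctx G T h1 := by
    refine H.frame (Frame.run (Cmd.read p x) h) ?_
    simp only [isLocal, Bool.and_eq_true, bne_iff_ne] at hloc
    simp [Cmd.keeps, Cmd.wvar, Cmd.wio, hloc.1.1.symm, hloc.1.2.symm, hloc.2.symm]
  set c : Cmd := .read p .tmp ;; .store f (.var .v) (.var .tmp) with hc
  have F2 : Frame (forV c) h1 ((readRec p x f).run h) := Frame.run _ _
  have e1 : h1.var x = h.tab (j * (n + 1)) := by simp [hh1, run_read, Store.setVar, hj]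
  have e2 : h1.cur p = j * (n + 1) + 1 := by simp [hh1, run_read, hj]
  have e3 : h1.tab = h.tab := by simp [hh1, run_read]
  have key := run_loop (x := .v) (c := c) H1.forN (fun i h' => h'.cur p = j * (n + 1) + 1 + i ∧
    ∀ v, v < i → h'.arr f v = h.tab (j * (n + 1) + 1 + v)) ⟨e2, by omega⟩ (by
      intro i h2 hi F ⟨i1, i2⟩
      have hP : min i h2.P = i := by have := F.P; have := H1.n_le; omega
      have et : h2.tab = h.tab := (F.tab rfl).trans e3
      have er : c.run (h2.setVar .v i) = { ((h2.setVar .v i).setVar .tmp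
          (h.tab (j * (n + 1) + 1 + i))).setArr f i (h.tab (j * (n + 1) + 1 + i)) with
          cur := Function.update h2.cur p (h2.cur p + 1) } := by
        simp only [hc, run_seq, run_read, run_store, Exp.eval]
        simp [Store.setVar, Store.setArr, i1, et, hP]
      rw [er]
      refine ⟨by simp [i1]; omega, fun v hv => ?_⟩
      simp only [Store.setArr, Function.update_self, Function.update_apply]
      split_ifs with hvi
      · rw [hvi]
      · exact i2 v (by omega))
  refine ⟨?_, ?_, ?_⟩
  · refine (F2.var x ?_).trans e1
    simp [forV, hc, Cmd.wvar, hx.1, hx.2]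
  · ext v
    rw [mem_arrSet, recSet, mem_arrSet]
    have : ((readRec p x f).run h).arr f v = _ := key.2 v v.2
    rw [this]
  · have : ((readRec p x f).run h).cur p = _ := key.1
    rw [this]; ring

theorem writeRec_spec (H : Ctx G T h) {e : Exp} {f : Arr} {R : ℕ} (hR : h.var .R = R)
    (hc : h.cur 0 = R * (n + 1)) :
    ((writeRec e f).run h).var .R = R + 1 ∧ ((writeRec e f).run h).cur 0 = (R + 1) * (n + 1) ∧
    (∀ i, i < R * (n + 1) → ((writeRec e f).run h).tab i = h.tab i) ∧
    ((writeRec e f).run h).tab (R * (n + 1)) = e.eval h ∧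
    recSet n ((writeRec e f).run h).tab R = arrSet n (h.arr f) := by
  set h1 := (Cmd.append e).run h with hh1
  have H1 : Ctx G T h1 := H.run _ rfl
  set c : Cmd := .append (.arr f (.var .v)) with hcc
  set h2 := (forV c).run h1 with hh2
  have F2 : Frame (forV c) h1 h2 := Frame.run _ _
  have H2 : Ctx G T h2 := H1.frame F2 rfl
  have e3 : (writeRec e f).run h = h2.setVar .R (h2.var .R + 1) := H2.run_inc .R
  have e1 : h1.arr = h.arr := by simp [hh1, run_append]
  have key := run_loop (x := .v) (c := c) H1.forN (fun i h' => h'.cur 0 = R * (n + 1) + 1 + i ∧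
    (∀ i, i < R * (n + 1) → h'.tab i = h.tab i) ∧ h'.tab (R * (n + 1)) = e.eval h ∧
    ∀ v, v < i → h'.tab (R * (n + 1) + 1 + v) = h.arr f v) ?_ ?_
  · obtain ⟨k1, k2, k3, k4⟩ := key
    rw [e3]
    refine ⟨?_, ?_, k2, k3, ?_⟩
    · have : h2.var .R = h1.var .R := F2.var .R rfl
      simp [this, hh1, run_append, hR]
    · have : h2.cur 0 = _ := k1
      rw [Store.setVar_cur, this]; ring
    · ext v
      rw [recSet, mem_arrSet, mem_arrSet]
      have := k4 v v.2
      rw [← this]; rfl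
  · refine ⟨by simp [hh1, run_append, hc], fun i hi => ?_, by simp [hh1, run_append, hc], by omega⟩
    simp only [hh1, run_append, hc]
    rw [Function.update_of_ne (by omega)]
  · intro i h3 hi F ⟨i1, i2, i3, i4⟩
    have hP : min i h3.P = i := by have := F.P; have := H1.n_le; omega
    have ea : h3.arr f = h.arr f := (F.arr f rfl).trans (by rw [e1])
    simp only [hcc, run_append, Exp.eval, Store.setVar_tab, Store.setVar_cur, i1, Store.setVar_var,
      if_true, Store.setVar_P', hP, Store.setVar_arr, ea]
    refine ⟨by simp; omega, fun l hl => ?_, ?_, fun v hv => ?_⟩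
    · rw [Function.update_of_ne (by omega), i2 l hl]
    · rw [Function.update_of_ne (by omega), i3]
    · simp only [Function.update_apply]
      by_cases hvi : v = i
      · rw [if_pos (by omega), hvi]
      · rw [if_neg (by omega), i4 v (by omega)]

/-- The sets that are fixed while a table is computed. -/
structure Frozen (n : ℕ) (A C X₁ X₂ : Finset (Fin n)) (h : Store) : Prop where
  inA : arrSet n (h.arr .inA) = A
  inC : arrSet n (h.arr .inC) = C
  top₁ : topSet n (h.arr .top) (h.var .c1) = X₁
  top₂ : topSet n (h.arr .top) (h.var .c2) = X₂

/-- The variable `bv` holds the value of the labelling `best`, which has the right state. -/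
structure Best (G : SimpleGraph (Fin n)) (A C s : Finset (Fin n)) (h : Store) : Prop where
  state : SameState G A C (arrSet n (h.arr .best)) s
  value : h.var .bv = partialCut G A C (arrSet n (h.arr .best))

/-- The combination of the labellings of the children and of the current state. -/
def merged (X₁ X₂ L₁ L₂ s : Finset (Fin n)) : Finset (Fin n) := glue X₁ L₁ (glue X₂ L₂ s)

variable {A C X₁ X₂ s : Finset (Fin n)}

theorem Frozen.frame {c : Cmd} (Z : Frozen n A C X₁ X₂ h) (F : Frame c h h')
    (h1 : c.warr .inA = false) (h2 : c.warr .inC = false) (h3 : c.warr .top = false)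
    (h4 : c.wvar .c1 = false) (h5 : c.wvar .c2 = false) : Frozen n A C X₁ X₂ h' :=
  ⟨by rw [F.arr _ h1, Z.inA], by rw [F.arr _ h2, Z.inC], by rw [F.arr _ h3, F.var _ h4, Z.top₁],
    by rw [F.arr _ h3, F.var _ h5, Z.top₂]⟩

theorem Frozen.setVar (Z : Frozen n A C X₁ X₂ h) (x : Var) (k : ℕ) (hx : Var.c1 ≠ x)
    (hx' : Var.c2 ≠ x) : Frozen n A C X₁ X₂ (h.setVar x k) :=
  ⟨Z.inA, Z.inC, by simp [hx, Z.top₁], by simp [hx', Z.top₂]⟩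

theorem try_spec (H : Ctx G T h) (Z : Frozen n A C X₁ X₂ h) (h₁ : X₁ ⊆ A) (h₂ : X₂ ⊆ A)
    (hs : arrSet n (h.arr .s) = s) (B : Best G A C s h) :
    Best G A C s (tryCmd.run h) ∧ h.var .bv ≤ (tryCmd.run h).var .bv ∧
    (SameState G A C (merged X₁ X₂ (arrSet n (h.arr .l1)) (arrSet n (h.arr .l2)) s) s →
      partialCut G A C (merged X₁ X₂ (arrSet n (h.arr .l1)) (arrSet n (h.arr .l2)) s) ≤
        (tryCmd.run h).var .bv) := by
  set M := merged X₁ X₂ (arrSet n (h.arr .l1)) (arrSet n (h.arr .l2)) s with hM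
  have F1 : Frame mergeCmd h (mergeCmd.run h) := Frame.run _ _
  have em : arrSet n ((mergeCmd.run h).arr .L) = M := by
    ext v
    rw [mem_arrSet, merge_spec H v v.2, hM, merged, mem_glue, mem_glue, ← Z.top₁, ← Z.top₂]
    simp only [mem_topSet, mem_arrSet, ← hs]
    split_ifs <;> rfl
  set h1 := mergeCmd.run h
  have H1 : Ctx G T h1 := H.frame F1 rfl
  have Z1 := Z.frame F1 rfl rfl rfl rfl rfl
  have e1s : arrSet n (h1.arr .s) = s := by rw [F1.arr .s rfl, hs]
  have hck := check_spec H1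
  have F2 : Frame checkCmd h1 (checkCmd.run h1) := Frame.run _ _
  set h2 := checkCmd.run h1
  have H2 : Ctx G T h2 := H1.frame F2 rfl
  have Z2 := Z1.frame F2 rfl rfl rfl rfl rfl
  rw [Z1.inA, Z1.inC, em, e1s] at hck
  have e2L : arrSet n (h2.arr .L) = M := by rw [F2.arr .L rfl, em]
  have ebv : h2.var .bv = h.var .bv := (F2.var .bv rfl).trans (F1.var .bv rfl)
  have ebest : h2.arr .best = h.arr .best := (F2.arr .best rfl).trans (F1.arr .best rfl)
  -- The program compares only the first half of the state. The second half concerns labels outside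
  -- `A`, where the merged labelling equals `s`.
  have hst : h2.var .ok = 1 ↔ SameState G A C M s := by
    rw [hck]
    refine ⟨fun h3 => ⟨h3, fun u _ => degIn_congr fun x hx => ?_⟩, fun h3 => h3.1⟩
    have hxA : x ∉ A := (Finset.mem_sdiff.1 hx).2
    rw [hM, merged, mem_glue, if_neg fun h => hxA (h₁ h), mem_glue, if_neg fun h => hxA (h₂ h)]
  have e : tryCmd.run h = if h2.var .ok = 1 then (countCmd .L ;;
      whenDo (.lt (.var .bv) (.var .cv)) (.assign .bv (.var .cv) ;;
        setAll .best (.arr .L (.var .v)))).run h2 else h2 := by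
    show Cmd.run (whenDo _ _) h2 = _
    simp only [run_whenDo, Cond.eval_eq, Exp.eval]
  rw [e]
  by_cases hok : h2.var .ok = 1
  · rw [if_pos hok, run_seq]
    have hcnt := count_spec H2 .L
    have F3 : Frame (countCmd .L) h2 ((countCmd .L).run h2) := Frame.run _ _
    set h3 := (countCmd .L).run h2
    have H3 : Ctx G T h3 := H2.frame F3 rfl
    rw [Z2.inA, Z2.inC, e2L] at hcnt
    have ebv3 : h3.var .bv = h.var .bv := (F3.var .bv rfl).trans ebv
    have ebest3 : h3.arr .best = h.arr .best := (F3.arr .best rfl).trans ebest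
    simp only [run_whenDo, Cond.eval_lt, Exp.eval, hcnt, ebv3]
    by_cases hlt : h.var .bv < partialCut G A C M
    · rw [if_pos hlt, run_seq, run_assign]
      simp only [Exp.eval, hcnt]
      set h4 := h3.setVar .bv (partialCut G A C M) with hh4
      have H4 : Ctx G T h4 := H3.setVar _ _ rfl
      have F5 : Frame (setAll .best (.arr .L (.var .v))) h4
        ((setAll .best (.arr .L (.var .v))).run h4) := Frame.run _ _
      have e5 : arrSet n (((setAll .best (.arr .L (.var .v))).run h4).arr .best) = M := by
        ext v
        rw [mem_arrSet, setAll_arr H4 (h2.arr .L), if_pos v.2, ← mem_arrSet (n := n), e2L]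
        intro i h6 hi F6
        have hP : min i h6.P = i := by have := F6.P; have := H4.n_le; omega
        have : h6.arr .L = h2.arr .L := (F6.arr .L rfl).trans (F3.arr .L rfl)
        simp [Exp.eval, hP, this]
      have e6 : ((setAll .best (.arr .L (.var .v))).run h4).var .bv = partialCut G A C M :=
        (F5.var .bv rfl).trans (by simp [hh4])
      exact ⟨⟨by rw [e5]; exact hst.1 hok, by rw [e5, e6]⟩, by rw [e6]; exact hlt.le,
        fun _ => e6.ge⟩
    · rw [if_neg hlt]
      exact ⟨⟨by rw [ebest3]; exact B.state, by rw [ebest3, ebv3]; exact B.value⟩, ebv3.ge,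
        fun _ => by rw [ebv3]; omega⟩
  · rw [if_neg hok]
    exact ⟨⟨by rw [ebest]; exact B.state, by rw [ebest, ebv]; exact B.value⟩, ebv.ge,
      fun h => absurd (hst.2 h) hok⟩

end

section

variable {n m : ℕ} {G : SimpleGraph (Fin n)} {T : SimpleGraph (Fin m)} {h h' : Store}
  {A C X₁ X₂ s : Finset (Fin n)}

def innerBody : Cmd := readRec 2 .id2 .l2 ;; whenDo (.eq (.var .id2) (.var .c2)) tryCmd

def outerBody : Cmd := readRec 1 .id1 .l1 ;; whenDo (.eq (.var .id1) (.var .c1)) innerLoop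

theorem Best.congr (B : Best G A C s h) (h1 : h'.arr .best = h.arr .best)
    (h2 : h'.var .bv = h.var .bv) : Best G A C s h' :=
  ⟨by rw [h1]; exact B.state, by rw [h1, h2]; exact B.value⟩

theorem innerLoop_spec (H : Ctx G T h) (Z : Frozen n A C X₁ X₂ h) (h₁ : X₁ ⊆ A) (h₂ : X₂ ⊆ A)
    (hs : arrSet n (h.arr .s) = s) (B : Best G A C s h) {R : ℕ} (hR : h.var .R = R) :
    (Best G A C s (innerLoop.run h) ∧ h.var .bv ≤ (innerLoop.run h).var .bv ∧
    ∀ j, j < R → h.tab (j * (n + 1)) = h.var .c2 →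
      SameState G A C (merged X₁ X₂ (arrSet n (h.arr .l1)) (recSet n h.tab j) s) s →
      partialCut G A C (merged X₁ X₂ (arrSet n (h.arr .l1)) (recSet n h.tab j) s) ≤
        (innerLoop.run h).var .bv) ∧
    innerLoop.cost h ≤ (innerBody.pcost h.P + 9) * (R + 1) := by
  set h0 := (Cmd.rewind 2).run h with hh0
  have F0 : Frame (Cmd.rewind 2) h h0 := Frame.run _ _
  have H0 : Ctx G T h0 := H.frame F0 rfl
  have c0 : h0.cur 2 = 0 := by simp [hh0, Cmd.run]
  have key := run_bigLoop (x := .j2) (e := .var .R) (c := innerBody) (h := h0) (k := R)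
    ((F0.var .R rfl).trans hR) (fun j h' => h'.cur 2 = j * (n + 1) ∧ Best G A C s h' ∧
      h.var .bv ≤ h'.var .bv ∧ ∀ i, i < j → h.tab (i * (n + 1)) = h.var .c2 →
      SameState G A C (merged X₁ X₂ (arrSet n (h.arr .l1)) (recSet n h.tab i) s) s →
      partialCut G A C (merged X₁ X₂ (arrSet n (h.arr .l1)) (recSet n h.tab i) s) ≤ h'.var .bv)
    (B := innerBody.pcost h.P)
    ⟨by rw [c0]; simp, B.congr rfl rfl, le_rfl, by omega⟩ ?_
  · obtain ⟨⟨-, k1⟩, k2⟩ := key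
    refine ⟨k1, ?_⟩
    have e : innerLoop.cost h = 1 + (Cmd.bigLoop .j2 (.var .R) innerBody).cost h0 := rfl
    rw [e]
    simp only [Exp.cost] at k2
    nlinarith
  · intro j h1 hj F ⟨i1, i2, i3, i4⟩
    set h2 := h1.setVar .j2 j with hh2
    have H1 : Ctx G T h1 := H0.frame F rfl
    have H2 : Ctx G T h2 := H1.setVar _ _ rfl
    have et : h2.tab = h.tab := F.tab rfl
    obtain ⟨r1, r2, r3⟩ := readRec_spec H2 (p := 2) (x := .id2) (f := .l2) (j := j)
      ⟨by simp, by simp⟩ rfl i1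
    rw [et] at r1 r2
    set h3 := (readRec 2 .id2 .l2).run h2 with hh3
    have F3 : Frame (readRec 2 .id2 .l2) h2 h3 := Frame.run _ _
    have H3 : Ctx G T h3 := H2.frame F3 rfl
    have Z3 : Frozen n A C X₁ X₂ h3 := Frozen.frame (((Z.frame F0 rfl rfl rfl rfl rfl).frame F rfl
      rfl rfl rfl rfl).setVar .j2 j (by simp) (by simp)) F3 rfl rfl rfl rfl rfl
    have B3 : Best G A C s h3 := i2.congr (F3.arr .best rfl)
      ((F3.var .bv rfl).trans (by simp [hh2]))
    have es : arrSet n (h3.arr .s) = s := by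
      rw [F3.arr .s rfl]; show arrSet n (h1.arr .s) = s; rw [F.arr .s rfl]; exact hs
    have el : h3.arr .l1 = h.arr .l1 := (F3.arr .l1 rfl).trans (F.arr .l1 rfl)
    have ec : h3.var .c2 = h.var .c2 := (F3.var .c2 rfl).trans (by simp [hh2, F.var .c2 rfl]; rfl)
    have ebv : h3.var .bv = h1.var .bv := (F3.var .bv rfl).trans (by simp [hh2])
    have e : innerBody.run h2 = if h.tab (j * (n + 1)) = h.var .c2 then tryCmd.run h3 else h3 := by
      show Cmd.run (whenDo _ _) h3 = _
      simp only [run_whenDo, Cond.eval_eq, Exp.eval, r1, ec]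
    have hcost : innerBody.cost h2 ≤ innerBody.pcost h.P := by
      have := innerBody.cost_le_pcost rfl h2
      rwa [show h2.P = h.P from F.P] at this
    refine ⟨?_, hcost⟩
    rw [e]
    by_cases hc : h.tab (j * (n + 1)) = h.var .c2
    · rw [if_pos hc]
      obtain ⟨t1, t2, t3⟩ := try_spec H3 Z3 h₁ h₂ es B3
      have F4 : Frame tryCmd h3 (tryCmd.run h3) := Frame.run _ _
      rw [el, r2] at t3
      refine ⟨(F4.cur 2 rfl).trans r3, t1, by omega, fun i hi hci hst => ?_⟩
      rcases Nat.lt_succ_iff_lt_or_eq.1 hi with hi | rfl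
      · have := i4 i hi hci hst; omega
      · exact t3 hst
    · rw [if_neg hc]
      refine ⟨r3, B3, by omega, fun i hi hci hst => ?_⟩
      rcases Nat.lt_succ_iff_lt_or_eq.1 hi with hi | rfl
      · have := i4 i hi hci hst; omega
      · exact absurd hci hc

/-- A bound for the cost of one round of the outer loop, divided by the number of records. -/
def outerCost (P : ℕ) : ℕ := (readRec 1 .id1 .l1).pcost P + (innerBody.pcost P + 30)

theorem outerLoop_spec (H : Ctx G T h) (Z : Frozen n A C X₁ X₂ h) (h₁ : X₁ ⊆ A) (h₂ : X₂ ⊆ A)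
    (hs : arrSet n (h.arr .s) = s) (B : Best G A C s h) {R : ℕ} (hR : h.var .R = R) :
    (Best G A C s (outerLoop.run h) ∧ h.var .bv ≤ (outerLoop.run h).var .bv ∧
    ∀ i j, i < R → j < R → h.tab (i * (n + 1)) = h.var .c1 → h.tab (j * (n + 1)) = h.var .c2 →
      SameState G A C (merged X₁ X₂ (recSet n h.tab i) (recSet n h.tab j) s) s →
      partialCut G A C (merged X₁ X₂ (recSet n h.tab i) (recSet n h.tab j) s) ≤
        (outerLoop.run h).var .bv) ∧
    outerLoop.cost h ≤ outerCost h.P * (R + 1) ^ 2 := by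
  set h0 := (Cmd.rewind 1).run h with hh0
  have F0 : Frame (Cmd.rewind 1) h h0 := Frame.run _ _
  have H0 : Ctx G T h0 := H.frame F0 rfl
  have c0 : h0.cur 1 = 0 := by simp [hh0, Cmd.run]
  have key := run_bigLoop (x := .j1) (e := .var .R) (c := outerBody) (h := h0) (k := R)
    ((F0.var .R rfl).trans hR) (fun j h' => h'.cur 1 = j * (n + 1) ∧ Best G A C s h' ∧
      h.var .bv ≤ h'.var .bv ∧ ∀ i, i < j → ∀ l, l < R → h.tab (i * (n + 1)) = h.var .c1 →
      h.tab (l * (n + 1)) = h.var .c2 →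
      SameState G A C (merged X₁ X₂ (recSet n h.tab i) (recSet n h.tab l) s) s →
      partialCut G A C (merged X₁ X₂ (recSet n h.tab i) (recSet n h.tab l) s) ≤ h'.var .bv)
    (B := (readRec 1 .id1 .l1).pcost h.P + (4 + (innerBody.pcost h.P + 9) * (R + 1)))
    ⟨by rw [c0]; simp, B.congr rfl rfl, le_rfl, by omega⟩ ?_
  · obtain ⟨⟨-, k1, k2, k3⟩, k4⟩ := key
    refine ⟨⟨k1, k2, fun i j hi hj => k3 i hi j hj⟩, ?_⟩
    have e : outerLoop.cost h = 1 + (Cmd.bigLoop .j1 (.var .R) outerBody).cost h0 := rfl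
    rw [e, outerCost]
    simp only [Exp.cost] at k4
    set p1 := (readRec 1 .id1 .l1).pcost h.P
    set p2 := innerBody.pcost h.P
    refine (Nat.add_le_add_left k4 1).trans ?_
    have : 0 ≤ R * R := Nat.zero_le _
    nlinarith [Nat.zero_le (R * p1), Nat.zero_le (R * R * p1), Nat.zero_le (R * p2)]
  · intro j h1 hj F ⟨i1, i2, i3, i4⟩
    set h2 := h1.setVar .j1 j with hh2
    have H1 : Ctx G T h1 := H0.frame F rfl
    have H2 : Ctx G T h2 := H1.setVar _ _ rfl
    have et : h2.tab = h.tab := F.tab rfl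
    obtain ⟨r1, r2, r3⟩ := readRec_spec H2 (p := 1) (x := .id1) (f := .l1) (j := j)
      ⟨by simp, by simp⟩ rfl i1
    rw [et] at r1 r2
    set h3 := (readRec 1 .id1 .l1).run h2 with hh3
    have F3 : Frame (readRec 1 .id1 .l1) h2 h3 := Frame.run _ _
    have H3 : Ctx G T h3 := H2.frame F3 rfl
    have Z3 : Frozen n A C X₁ X₂ h3 := Frozen.frame (((Z.frame F0 rfl rfl rfl rfl rfl).frame F rfl
      rfl rfl rfl rfl).setVar .j1 j (by simp) (by simp)) F3 rfl rfl rfl rfl rfl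
    have B3 : Best G A C s h3 := i2.congr (F3.arr .best rfl)
      ((F3.var .bv rfl).trans (by simp [hh2]))
    have es : arrSet n (h3.arr .s) = s := by
      rw [F3.arr .s rfl]; show arrSet n (h1.arr .s) = s; rw [F.arr .s rfl]; exact hs
    have ec : h3.var .c1 = h.var .c1 := (F3.var .c1 rfl).trans (by simp [hh2, F.var .c1 rfl]; rfl)
    have ec2 : h3.var .c2 = h.var .c2 := (F3.var .c2 rfl).trans (by simp [hh2, F.var .c2 rfl]; rfl)
    have ebv : h3.var .bv = h1.var .bv := (F3.var .bv rfl).trans (by simp [hh2])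
    have eR : h3.var .R = R := (F3.var .R rfl).trans (by simp [hh2, F.var .R rfl]; exact hR)
    have et3 : h3.tab = h.tab := (F3.tab rfl).trans et
    have eP3 : h3.P = h.P := F3.P.trans F.P
    have e : outerBody.run h2 =
        if h.tab (j * (n + 1)) = h.var .c1 then innerLoop.run h3 else h3 := by
      show Cmd.run (whenDo _ _) h3 = _
      simp only [run_whenDo, Cond.eval_eq, Exp.eval, r1, ec]
    obtain ⟨⟨t1, t2, t3⟩, t4⟩ := innerLoop_spec H3 Z3 h₁ h₂ es B3 eR
    refine ⟨?_, ?_⟩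
    · rw [e]
      by_cases hc : h.tab (j * (n + 1)) = h.var .c1
      · rw [if_pos hc]
        have F4 : Frame innerLoop h3 (innerLoop.run h3) := Frame.run _ _
        rw [et3, ec2, r2] at t3
        refine ⟨(F4.cur 1 rfl).trans r3, t1, by omega, fun i hi l hl hci hcl hst => ?_⟩
        rcases Nat.lt_succ_iff_lt_or_eq.1 hi with hi | rfl
        · have := i4 i hi l hl hci hcl hst; omega
        · exact t3 l hl hcl hst
      · rw [if_neg hc]
        refine ⟨r3, B3, by omega, fun i hi l hl hci hcl hst => ?_⟩
        rcases Nat.lt_succ_iff_lt_or_eq.1 hi with hi | rfl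
        · have := i4 i hi l hl hci hcl hst; omega
        · exact absurd hci hc
    · have q1 := (readRec 1 .id1 .l1).cost_le_pcost rfl h2
      rw [show h2.P = h.P from F.P] at q1
      have q2 : outerBody.cost h2 = (readRec 1 .id1 .l1).cost h2 +
        (whenDo (.eq (.var .id1) (.var .c1)) innerLoop).cost h3 := rfl
      have q3 : (whenDo (.eq (.var .id1) (.var .c1)) innerLoop).cost h3 ≤
          4 + innerLoop.cost h3 := by
        simp only [whenDo, Cmd.cost, Cond.cost, Exp.cost]
        split_ifs <;> omega
      rw [eP3] at t4
      omega

/-- Record `r` is a best labelling for the state of `s` that is obtained from the first `R` records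
of the tape `tab`, where `c₁` and `c₂` are the children. -/
structure GoodRec (G : SimpleGraph (Fin n)) (A C X₁ X₂ s : Finset (Fin n)) (tab : ℕ → ℕ)
    (R c₁ c₂ : ℕ) (L : Finset (Fin n)) : Prop where
  state : SameState G A C L s
  base : partialCut G A C s ≤ partialCut G A C L
  merge : ∀ i j, i < R → j < R → tab (i * (n + 1)) = c₁ → tab (j * (n + 1)) = c₂ →
    SameState G A C (merged X₁ X₂ (recSet n tab i) (recSet n tab j) s) s →
      partialCut G A C (merged X₁ X₂ (recSet n tab i) (recSet n tab j) s) ≤ partialCut G A C L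

/-- A bound for the cost of `stateCmd`, divided by the square of the number of records. -/
def stateCost (P : ℕ) : ℕ :=
  (setAll .best (.arr .s (.var .v))).pcost P + (countCmd .best).pcost P + 2 + outerCost P +
    (writeRec (.var .x) .best).pcost P + (nextCmd .s .inC).pcost P

-- `best` starts as `s` itself, which has the right state for trivial reasons. So a record is
-- written even if no merge is successful, as happens at leaves.
set_option maxHeartbeats 400000 in
theorem state_spec (H : Ctx G T h) (Z : Frozen n A C X₁ X₂ h) (h₁ : X₁ ⊆ A) (h₂ : X₂ ⊆ A)
    (hs : arrSet n (h.arr .s) = s) {R : ℕ} (hR : h.var .R = R) (hcur : h.cur 0 = R * (n + 1)) :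
    ((stateCmd.run h).var .R = R + 1 ∧ (stateCmd.run h).cur 0 = (R + 1) * (n + 1) ∧
    (∀ i, i < R * (n + 1) → (stateCmd.run h).tab i = h.tab i) ∧
    (stateCmd.run h).tab (R * (n + 1)) = h.var .x ∧
    GoodRec G A C X₁ X₂ s h.tab R (h.var .c1) (h.var .c2) (recSet n (stateCmd.run h).tab R) ∧
    arrSet n ((stateCmd.run h).arr .best) = recSet n (stateCmd.run h).tab R ∧
    (stateCmd.run h).var .bv = partialCut G A C (recSet n (stateCmd.run h).tab R)) ∧
    (∀ b : Bool, (h.var .rk = 1 ↔ b = true) →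
      code b (h.arr .inC) (h.arr .s) n < maxCode b (h.arr .inC) n →
      code b (h.arr .inC) ((stateCmd.run h).arr .s) n = code b (h.arr .inC) (h.arr .s) n + 1 ∧
      ∀ v, h.arr .inC v ≠ 1 → (stateCmd.run h).arr .s v = h.arr .s v) ∧
    stateCmd.cost h ≤ stateCost h.P * (R + 1) ^ 2 := by
  set h1 := (setAll .best (.arr .s (.var .v))).run h with hh1
  have F1 : Frame (setAll .best (.arr .s (.var .v))) h h1 := Frame.run _ _
  have H1 : Ctx G T h1 := H.frame F1 rfl
  have e1 : arrSet n (h1.arr .best) = s := by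
    ext v
    rw [mem_arrSet, hh1, setAll_arr H (h.arr .s), if_pos v.2, ← hs, mem_arrSet]
    intro i h6 hi F6
    have hP : min i h6.P = i := by have := F6.P; have := H.n_le; omega
    have : h6.arr .s = h.arr .s := F6.arr .s rfl
    simp [Exp.eval, hP, this]
  set h2 := (countCmd .best).run h1 with hh2
  have F2 : Frame (countCmd .best) h1 h2 := Frame.run _ _
  have H2 : Ctx G T h2 := H1.frame F2 rfl
  have Z1 := Z.frame F1 rfl rfl rfl rfl rfl
  have Z2 := Z1.frame F2 rfl rfl rfl rfl rfl
  have e2 : h2.var .cv = partialCut G A C s := by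
    rw [hh2, count_spec H1, Z1.inA, Z1.inC, e1]
  set h3 := h2.setVar .bv (h2.var .cv) with hh3
  have H3 : Ctx G T h3 := H2.setVar _ _ rfl
  have Z3 : Frozen n A C X₁ X₂ h3 := Z2.setVar _ _ (by simp) (by simp)
  have eb3 : arrSet n (h3.arr .best) = s := by
    show arrSet n (h2.arr .best) = s
    rw [F2.arr .best rfl, e1]
  have B3 : Best G A C s h3 := by
    refine ⟨by rw [eb3]; exact SameState.rfl, ?_⟩
    rw [eb3]
    simp [hh3, e2]
  have es3 : h3.arr .s = h.arr .s := (F2.arr .s rfl).trans (F1.arr .s rfl)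
  have eR3 : h3.var .R = R := by simp [hh3, F2.var .R rfl, F1.var .R rfl, hR]
  have et3 : h3.tab = h.tab := (F2.tab rfl).trans (F1.tab rfl)
  have ec3 : ∀ y, y ≠ .bv → (setAll .best (.arr .s (.var .v))).wvar y = false →
      (countCmd .best).wvar y = false → h3.var y = h.var y := fun y h1 h2 h3 => by
    simp [hh3, h1, F2.var y h3, F1.var y h2]
  obtain ⟨⟨o1, o2, o3⟩, o4⟩ := outerLoop_spec H3 Z3 h₁ h₂ (by rw [es3, hs]) B3 eR3
  set h4 := outerLoop.run h3 with hh4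
  have F4 : Frame outerLoop h3 h4 := Frame.run _ _
  have H4 : Ctx G T h4 := H3.frame F4 rfl
  have eR4 : h4.var .R = R := (F4.var .R rfl).trans eR3
  have ecur4 : h4.cur 0 = R * (n + 1) := by
    rw [F4.cur 0 rfl]
    show h2.cur 0 = _
    rw [F2.cur 0 rfl, F1.cur 0 rfl, hcur]
  obtain ⟨w1, w2, w3, w4, w5⟩ := writeRec_spec H4 (e := .var .x) (f := .best) eR4 ecur4
  set h5 := (writeRec (.var .x) .best).run h4 with hh5
  have F5 : Frame (writeRec (.var .x) .best) h4 h5 := Frame.run _ _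
  have H5 : Ctx G T h5 := H4.frame F5 rfl
  have er : stateCmd.run h = (nextCmd .s .inC).run h5 := rfl
  have F6 : Frame (nextCmd .s .inC) h5 (stateCmd.run h) := Frame.run _ _
  have et4 : h4.tab = h.tab := (F4.tab rfl).trans et3
  have et6 : (stateCmd.run h).tab = h5.tab := F6.tab rfl
  have eb6 : (stateCmd.run h).arr .best = h4.arr .best := (F6.arr .best rfl).trans (F5.arr .best rfl)
  have ebv6 : (stateCmd.run h).var .bv = h4.var .bv := (F6.var .bv rfl).trans (F5.var .bv rfl)
  rw [et4] at w3
  rw [et3, ec3 .c1 (by simp) rfl rfl, ec3 .c2 (by simp) rfl rfl] at o3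
  have hbv3 : h3.var .bv = partialCut G A C s := by simp [hh3, e2]
  refine ⟨⟨(F6.var .R rfl).trans w1, (F6.cur 0 rfl).trans w2, by rw [et6]; exact w3, ?_, ?_, ?_, ?_⟩,
    ?_, ?_⟩
  · rw [et6, w4]
    exact (F4.var .x rfl).trans (ec3 .x (by simp) rfl rfl)
  · rw [et6, w5]
    have hv := o1.value
    exact ⟨o1.state, by omega, fun i j hi hj hci hcj hst => (o3 i j hi hj hci hcj hst).trans hv.le⟩
  · rw [et6, w5, eb6]
  · rw [et6, w5, ebv6, o1.value]
  · intro b hb hlt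
    have es5 : h5.arr .s = h.arr .s := (F5.arr .s rfl).trans ((F4.arr .s rfl).trans es3)
    have eC5 : h5.arr .inC = h.arr .inC := (F5.arr .inC rfl).trans ((F4.arr .inC rfl).trans
      ((F2.arr .inC rfl).trans (F1.arr .inC rfl)))
    have erk5 : h5.var .rk = h.var .rk := (F5.var .rk rfl).trans ((F4.var .rk rfl).trans
      (ec3 .rk (by simp) rfl rfl))
    have := next_spec H5 .s .inC (by simp) (b := b) (by rw [erk5]; exact hb)
      (by rw [eC5, es5]; exact hlt)
    rw [eC5, es5] at this
    exact this
  · have q : stateCmd.cost h = (setAll .best (.arr .s (.var .v))).cost h + ((countCmd .best).cost h1 +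
      (2 + (outerLoop.cost h3 + ((writeRec (.var .x) .best).cost h4 +
        (nextCmd .s .inC).cost h5)))) := rfl
    have q1 := (setAll .best (.arr .s (.var .v))).cost_le_pcost rfl h
    have q2 := (countCmd .best).cost_le_pcost rfl h1
    have q5 := (writeRec (.var .x) .best).cost_le_pcost rfl h4
    have q6 := (nextCmd .s .inC).cost_le_pcost rfl h5
    have p1 : h1.P = h.P := F1.P
    have p3 : h3.P = h.P := F2.P.trans p1
    have p4 : h4.P = h.P := F4.P.trans p3
    have p5 : h5.P = h.P := F5.P.trans p4
    rw [p1] at q2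
    rw [p3] at o4
    rw [p4] at q5
    rw [p5] at q6
    rw [q, stateCost]
    set a1 := (setAll .best (.arr .s (.var .v))).pcost h.P
    set a2 := (countCmd .best).pcost h.P
    set a5 := (writeRec (.var .x) .best).pcost h.P
    set a6 := (nextCmd .s .inC).pcost h.P
    have hpos : 1 ≤ (R + 1) ^ 2 := Nat.one_le_pow _ _ (by omega)
    have : a1 + a2 + 2 + a5 + a6 ≤ (a1 + a2 + 2 + a5 + a6) * (R + 1) ^ 2 :=
      Nat.le_mul_of_pos_right _ hpos
    have e : (a1 + a2 + 2 + outerCost h.P + a5 + a6) * (R + 1) ^ 2 =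
      (a1 + a2 + 2 + a5 + a6) * (R + 1) ^ 2 + outerCost h.P * (R + 1) ^ 2 := by ring
    rw [e]
    omega

theorem outerCost_polyBdd : PolyBdd outerCost :=
  (Cmd.pcost_polyBdd _).add ((Cmd.pcost_polyBdd _).add (.const 30))

theorem stateCost_polyBdd : PolyBdd stateCost :=
  (((((Cmd.pcost_polyBdd _).add (Cmd.pcost_polyBdd _)).add (.const 2)).add outerCost_polyBdd).add
    (Cmd.pcost_polyBdd _)).add (Cmd.pcost_polyBdd _)

end

/-! ### Complete tables -/

section

variable {n m : ℕ} {G : SimpleGraph (Fin n)} {T : SimpleGraph (Fin m)} {h h' : Store}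
  {A C X₁ X₂ s : Finset (Fin n)}

theorem maxCode_mono (b : Bool) (M : ℕ → ℕ) : Monotone (maxCode b M) :=
  monotone_nat_of_le_succ fun k => by rw [maxCode_succ]; omega

theorem GoodRec.mono {tab tab' : ℕ → ℕ} {R R' c₁ c₂ : ℕ} {L : Finset (Fin n)} (hR : R ≤ R')
    (ht : ∀ i, i < R * (n + 1) → tab' i = tab i)
    (H : GoodRec G A C X₁ X₂ s tab' R' c₁ c₂ L) : GoodRec G A C X₁ X₂ s tab R c₁ c₂ L := by
  refine ⟨H.state, H.base, fun i j hi hj hci hcj => ?_⟩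
  obtain ⟨i1, i2⟩ := recSet_congr hi ht
  obtain ⟨j1, j2⟩ := recSet_congr hj ht
  rw [← i2, ← j2]
  exact H.merge i j (by omega) (by omega) (i1.trans hci) (j1.trans hcj)

def sizeBody : Cmd :=
  whenDo (isOne .inC .v) (.ite (.eq (.var .rk) (.lit 1)) (inc .ns) (double .ns))

/-- A bound for the cost of one round of the computation of the number of states, divided by this
number. -/
def sizeCost (P : ℕ) : ℕ := (isOne .inC .v).cost P + (inc .ns).pcost P + (4 * P + 14)

theorem size_spec (H : Ctx G T h) {b : Bool} (hb : h.var .rk = 1 ↔ b = true)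
    (hns : h.var .ns = 1) :
    ((forV sizeBody).run h).var .ns = maxCode b (h.arr .inC) n + 1 ∧
    (forV sizeBody).cost h ≤ 5 + h.P * (sizeCost h.P * (maxCode b (h.arr .inC) n + 2) + 3) := by
  set M := h.arr .inC with hM
  have key := cost_loop_le (x := .v) (c := sizeBody) H.forN
    (fun i h' => h'.var .ns = maxCode b M i + 1) (B := sizeCost h.P * (maxCode b M n + 2))
    (by rw [hns]; cases b <;> simp [maxCode, rank]) ?_
  · refine ⟨key.1, ?_⟩
    have k := key.2
    have : n * (sizeCost h.P * (maxCode b M n + 2) + 3) ≤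
      h.P * (sizeCost h.P * (maxCode b M n + 2) + 3) :=
      Nat.mul_le_mul_right _ (by have := H.n_le; omega)
    simp only [Exp.cost] at k
    show (Cmd.loop .v (.var .n) sizeBody).cost h ≤ _
    omega
  · intro i h1 hi F ih
    set h2 := h1.setVar .v i with hh2
    have H2 : Ctx G T h2 := (H.frame F rfl).setVar _ _ rfl
    have ev : h2.var .v = i := by simp [hh2]
    have eM : h2.arr .inC = M := F.arr .inC rfl
    have erk : h2.var .rk = 1 ↔ b = true := by rw [← hb]; simp [hh2, F.var .rk rfl]
    have ens : h2.var .ns = maxCode b M i + 1 := by simp [hh2, ih]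
    have eP : h2.P = h.P := F.P
    have hle : maxCode b M i ≤ maxCode b M n := maxCode_mono b M hi.le
    obtain ⟨d1, d2⟩ := double_spec H2 .ns (by simp)
    have hc := H2.isOne (a := .inC) (ev.trans_lt hi)
    rw [eM, ev] at hc
    constructor
    · rw [sizeBody, run_whenDo, maxCode_succ, weight]
      by_cases hMi : M i = 1
      · rw [if_pos (hc.2 hMi), if_pos hMi, run_ite]
        simp only [Cond.eval_eq, Exp.eval, erk]
        cases b with
        | true => simp only [if_true, H2.run_inc, Store.setVar_var, ens]
        | false =>
          simp only [Bool.false_eq_true, if_false, d1, ens, maxCode]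
          have := Nat.one_le_two_pow (n := rank M i)
          omega
      · rw [if_neg (mt hc.1 hMi), if_neg hMi, ens]
    · have q1 : sizeBody.cost h2 ≤ (isOne .inC .v).cost h2.P + (3 + (inc .ns).cost h2 +
          (double .ns).cost h2 + 1) := by
        simp only [sizeBody, whenDo, Cmd.cost, Cond.cost, Exp.cost]
        split_ifs <;> omega
      have q2 := (inc .ns).cost_le_pcost rfl h2
      rw [eP] at q1 q2
      rw [eP, ens] at d2
      rw [sizeCost]
      set a1 := (isOne .inC .v).cost h.P
      set a2 := (inc .ns).pcost h.P
      have r1 : (4 * h.P + 10) * (maxCode b M i + 1 + 1) ≤ (4 * h.P + 10) * (maxCode b M n + 2) :=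
        Nat.mul_le_mul_left _ (by omega)
      have r2 : a1 + a2 + 4 ≤ (a1 + a2 + 4) * (maxCode b M n + 2) :=
        Nat.le_mul_of_pos_right _ (by omega)
      have r3 : (a1 + a2 + (4 * h.P + 14)) * (maxCode b M n + 2) =
        (a1 + a2 + 4) * (maxCode b M n + 2) + (4 * h.P + 10) * (maxCode b M n + 2) := by ring
      omega

/-- A bound for the cost of `tableCmd`, divided by the number of states and the square of the number
of records. -/
def tableCost (P : ℕ) : ℕ :=
  7 + P * (2 * sizeCost P + 3) + (setAll .s (.lit 0)).pcost P + (stateCost P + 8)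

theorem table_spec (H : Ctx G T h) (Z : Frozen n A C X₁ X₂ h) (h₁ : X₁ ⊆ A) (h₂ : X₂ ⊆ A)
    {b : Bool} (hb : h.var .rk = 1 ↔ b = true) {R : ℕ} (hR : h.var .R = R)
    (hcur : h.cur 0 = R * (n + 1)) {S : ℕ} (hS : S = maxCode b (h.arr .inC) n + 1) :
    ((tableCmd.run h).var .R = R + S ∧ (tableCmd.run h).cur 0 = (R + S) * (n + 1) ∧
    (∀ i, i < R * (n + 1) → (tableCmd.run h).tab i = h.tab i) ∧
    (∀ i, i < S → (tableCmd.run h).tab ((R + i) * (n + 1)) = h.var .x ∧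
      ∃ f : ℕ → ℕ, code b (h.arr .inC) f n = i ∧ arrSet n f ⊆ C ∧
        GoodRec G A C X₁ X₂ (arrSet n f) h.tab R (h.var .c1) (h.var .c2)
          (recSet n (tableCmd.run h).tab (R + i))) ∧
    arrSet n ((tableCmd.run h).arr .best) = recSet n (tableCmd.run h).tab (R + (S - 1)) ∧
    (tableCmd.run h).var .bv = partialCut G A C (recSet n (tableCmd.run h).tab (R + (S - 1)))) ∧
    tableCmd.cost h ≤ tableCost h.P * (S * (R + S + 1) ^ 2) := by
  set M := h.arr .inC with hM
  set h1 := h.setVar .ns 1 with hh1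
  have H1 : Ctx G T h1 := H.setVar _ _ rfl
  obtain ⟨z1, z2⟩ := size_spec H1 (b := b) (by simpa [hh1] using hb) (by simp [hh1])
  set h2 := (forV sizeBody).run h1 with hh2
  have F2 : Frame (forV sizeBody) h1 h2 := Frame.run _ _
  have H2 : Ctx G T h2 := H1.frame F2 rfl
  have eS : h2.var .ns = S := z1.trans hS.symm
  set h3 := (setAll .s (.lit 0)).run h2 with hh3
  have F3 : Frame (setAll .s (.lit 0)) h2 h3 := Frame.run _ _
  have H3 : Ctx G T h3 := H2.frame F3 rfl
  have e3s : ∀ v, v < n → h3.arr .s v = 0 := fun v hv => by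
    rw [hh3, setAll_arr H2 (fun _ => 0) (fun _ _ _ _ => rfl), if_pos hv]
  have evar : ∀ y, y ≠ .ns → (forV sizeBody).wvar y = false →
      (setAll .s (.lit 0)).wvar y = false → h3.var y = h.var y := fun y h1 h2 h3 => by
    simp [F3.var y h3, F2.var y h2, hh1, h1]
  have eM3 : h3.arr .inC = M := (F3.arr .inC rfl).trans (F2.arr .inC rfl)
  have et3 : h3.tab = h.tab := (F3.tab rfl).trans (F2.tab rfl)
  have ec3 : h3.cur 0 = R * (n + 1) := (F3.cur 0 rfl).trans ((F2.cur 0 rfl).trans hcur)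
  have eP3 : h3.P = h.P := F3.P.trans F2.P
  have Z3 : Frozen n A C X₁ X₂ h3 := ((Z.setVar .ns 1 (by simp) (by simp)).frame F2 rfl rfl rfl rfl
    rfl).frame F3 rfl rfl rfl rfl rfl
  have key := run_bigLoop (x := .j) (e := .var .ns) (c := stateCmd) (h := h3) (k := S)
    ((F3.var .ns rfl).trans eS) (fun j h' => h'.var .R = R + j ∧ h'.cur 0 = (R + j) * (n + 1) ∧
      (∀ i, i < R * (n + 1) → h'.tab i = h.tab i) ∧
      -- Round `j` treats the subset with code `j`. After the last round the counter has overflowed,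
      -- and nothing is claimed about `s`.
      (j < S → code b M (h'.arr .s) n = j ∧ ∀ v, v < n → h'.arr .s v = 1 → M v = 1) ∧
      (∀ i, i < j → h'.tab ((R + i) * (n + 1)) = h.var .x ∧
        ∃ f : ℕ → ℕ, code b M f n = i ∧ arrSet n f ⊆ C ∧
          GoodRec G A C X₁ X₂ (arrSet n f) h.tab R (h.var .c1) (h.var .c2)
            (recSet n h'.tab (R + i))) ∧
      (0 < j → arrSet n (h'.arr .best) = recSet n h'.tab (R + (j - 1)) ∧
        h'.var .bv = partialCut G A C (recSet n h'.tab (R + (j - 1)))))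
    (B := stateCost h.P * (R + S + 1) ^ 2) ?_ ?_
  · obtain ⟨⟨k1, k2, k3, -, k4, k5⟩, k6⟩ := key
    refine ⟨⟨k1, k2, k3, k4, k5 (by omega)⟩, ?_⟩
    have q : tableCmd.cost h = 2 + ((forV sizeBody).cost h1 + ((setAll .s (.lit 0)).cost h2 +
      (Cmd.bigLoop .j (.var .ns) stateCmd).cost h3)) := rfl
    have q3 := (setAll .s (.lit 0)).cost_le_pcost rfl h2
    rw [show h2.P = h.P from F2.P] at q3
    have z2' : (forV sizeBody).cost h1 ≤ 5 + h.P * (sizeCost h.P * (S + 1) + 3) := by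
      rw [hS]; exact z2
    rw [q, tableCost]
    simp only [Exp.cost] at k6
    set p3 := (setAll .s (.lit 0)).pcost h.P
    set p1 := sizeCost h.P
    set p4 := stateCost h.P
    set Q := (R + S + 1) ^ 2 with hQ
    have hS1 : 1 ≤ S := by omega
    have hQ1 : 1 ≤ Q := Nat.one_le_pow _ _ (by omega)
    have hSQ : S ≤ S * Q := Nat.le_mul_of_pos_right _ hQ1
    have r1 : h.P * (p1 * (S + 1) + 3) ≤ h.P * (2 * p1 + 3) * (S * Q) := by
      rw [mul_assoc]
      refine Nat.mul_le_mul_left _ ?_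
      have : p1 * (S + 1) ≤ p1 * (2 * (S * Q)) := Nat.mul_le_mul_left _ (by omega)
      have e : (2 * p1 + 3) * (S * Q) = p1 * (2 * (S * Q)) + 3 * (S * Q) := by ring
      omega
    have r2 : 7 ≤ 7 * (S * Q) := by omega
    have r3 : p3 ≤ p3 * (S * Q) := Nat.le_mul_of_pos_right _ (by omega)
    have r4 : S * (p4 * Q + 3) = p4 * (S * Q) + 3 * S := by ring
    have r5 : (7 + h.P * (2 * p1 + 3) + p3 + (p4 + 8)) * (S * Q) = 7 * (S * Q) +
      h.P * (2 * p1 + 3) * (S * Q) + p3 * (S * Q) + p4 * (S * Q) + 8 * (S * Q) := by ring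
    omega
  · refine ⟨(evar .R (by simp) rfl rfl).trans hR, ec3, by rw [et3]; exact fun _ _ => rfl,
      fun _ => ⟨?_, fun v hv hv1 => ?_⟩, by omega, by omega⟩
    · refine Finset.sum_eq_zero fun v hv => ?_
      rw [e3s v (Finset.mem_range.1 hv)]
      simp
    · rw [e3s v hv] at hv1
      exact absurd hv1 (by simp)
  · intro j h4 hj F ⟨i1, i2, i3, i4, i5, i6⟩
    obtain ⟨i4a, i4b⟩ := i4 hj
    set h5 := h4.setVar .j j with hh5
    have H5 : Ctx G T h5 := (H3.frame F rfl).setVar _ _ rfl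
    have Z5 : Frozen n A C X₁ X₂ h5 :=
      (Z3.frame F rfl rfl rfl rfl rfl).setVar .j j (by simp) (by simp)
    have eM5 : h5.arr .inC = M := (F.arr .inC rfl).trans eM3
    have v5 : ∀ y, y ≠ .j → y ≠ .ns → (forV sizeBody).wvar y = false →
        (setAll .s (.lit 0)).wvar y = false → stateCmd.wvar y = false → h5.var y = h.var y := by
      intro y w1 w2 w3 w4 w5
      have hw : (Cmd.loop .j (.var .ns) stateCmd).wvar y = false := by simp [Cmd.wvar, w1, w5]
      simp [hh5, w1, F.var y hw, evar y w2 w3 w4]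
    obtain ⟨⟨s1, s2, s3, s4, s5, s6, s7⟩, s8, s9⟩ := state_spec H5 Z5 h₁ h₂
      (s := arrSet n (h4.arr .s)) rfl (R := R + j) (by simp [hh5, i1]) (by simp [hh5, i2])
    rw [eM5] at s8
    rw [v5 .x (by simp) (by simp) rfl rfl rfl] at s4
    rw [v5 .c1 (by simp) (by simp) rfl rfl rfl, v5 .c2 (by simp) (by simp) rfl rfl rfl] at s5
    have s3' : ∀ i, i < (R + j) * (n + 1) → (stateCmd.run h5).tab i = h4.tab i := s3
    have hle : R * (n + 1) ≤ (R + j) * (n + 1) := Nat.mul_le_mul_right _ (by omega)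
    refine ⟨⟨s1, s2, fun i hi => ?_, fun hj1 => ?_, fun i hi => ?_, fun _ => ⟨s6, s7⟩⟩, ?_⟩
    · rw [s3' i (by omega), i3 i hi]
    · have hrk5 : h5.var .rk = 1 ↔ b = true := by
        rw [v5 .rk (by simp) (by simp) rfl rfl rfl]; exact hb
      have hlt : code b M (h4.arr .s) n < maxCode b M n := by omega
      obtain ⟨t1, t2⟩ := s8 b hrk5 hlt
      refine ⟨t1.trans (by simp [hh5, i4a]), fun v hv hv1 => ?_⟩
      by_contra hMv
      rw [t2 v hMv] at hv1
      exact hMv (i4b v hv hv1)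
    · rcases Nat.lt_succ_iff_lt_or_eq.1 hi with hi | rfl
      · obtain ⟨c1, c2⟩ := recSet_congr (show R + i < R + j by omega) s3'
        rw [c1, c2]
        exact i5 i hi
      · refine ⟨s4, h4.arr .s, i4a, fun v hv => ?_, GoodRec.mono (by omega) i3 s5⟩
        rw [← Z5.inC, mem_arrSet, eM5]
        exact i4b v v.2 (mem_arrSet.1 hv)
    · rw [show h5.P = h.P from F.P.trans eP3] at s9
      refine s9.trans (Nat.mul_le_mul_left _ (Nat.pow_le_pow_left (by omega) _))

/-- The labellings of record type `c` allow us to replace the restriction of a labelling to `X`. -/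
def Replace (G : SimpleGraph (Fin n)) (A C X : Finset (Fin n)) (tab : ℕ → ℕ) (R c : ℕ) : Prop :=
  ∀ L, ∃ j, j < R ∧ tab (j * (n + 1)) = c ∧ SameState G A C (glue X (recSet n tab j) L) L ∧
    partialCut G A C L ≤ partialCut G A C (glue X (recSet n tab j) L)

/-- Let `f` be the enumerated representative of the state of `L`. Exchanging the parts of `L` in
`X₂` and in `X₁` for records of the children keeps the state and does not decrease the partial cut.
Passing to `f` outside `A` is harmless as the states agree, and the result is precisely a merge that
the program tried for `f`. -/
theorem table_complete (hA : IsCanonical G A C) {M : ℕ → ℕ} (hM : arrSet n M = C) {b : Bool}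
    (hb : b = true → IsRankOne G A ∧ C = smallSide G A) (h₁ : X₁ ⊆ A) (h₂ : X₂ ⊆ A)
    {tab tab' : ℕ → ℕ} {R c₁ c₂ x : ℕ} (r₁ : Replace G A C X₁ tab R c₁)
    (r₂ : Replace G A C X₂ tab R c₂)
    (hrec : ∀ i, i < maxCode b M n + 1 → tab' ((R + i) * (n + 1)) = x ∧
      ∃ f : ℕ → ℕ, code b M f n = i ∧ arrSet n f ⊆ C ∧
        GoodRec G A C X₁ X₂ (arrSet n f) tab R c₁ c₂ (recSet n tab' (R + i)))
    (L : Finset (Fin n)) (hL : (∀ v ∈ A, v ∈ X₁ ∨ v ∈ X₂ ∨ (v ∉ L ∧ v ∉ C)) ∨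
      partialCut G A C L = 0) :
    ∃ i, i < maxCode b M n + 1 ∧ tab' ((R + i) * (n + 1)) = x ∧
      SameState G A C (recSet n tab' (R + i)) L ∧
      partialCut G A C L ≤ partialCut G A C (recSet n tab' (R + i)) := by
  classical
  set g : ℕ → ℕ := fun v => if hv : v < n then (if (⟨v, hv⟩ : Fin n) ∈ L then 1 else 0) else 0 with hg
  have egL : arrSet n g = L := by ext v; simp [hg]
  have hlt : code b M g n < maxCode b M n + 1 := Nat.lt_succ_of_le code_le_maxCode
  obtain ⟨hx, f, hf, hfC, hgood⟩ := hrec _ hlt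
  refine ⟨_, hlt, hx, ?_⟩
  have hfL : SameState G A C (arrSet n f) L := by
    cases b with
    | true =>
      obtain ⟨h3, h4⟩ := hb rfl
      rw [code_true_eq_card, code_true_eq_card, hM, egL, h4] at hf
      rw [h4]
      exact h3.sameState hf
    | false =>
      refine hA.cover.sameState fun v hv => ?_
      have := code_inj hf v v.2 (by rw [← hM, mem_arrSet] at hv; exact hv)
      rw [← egL, mem_arrSet, mem_arrSet, this]
  refine ⟨hgood.state.trans hfL, ?_⟩
  -- The first case serves inner nodes and the root, where vertices of `A` below no child carry no
  -- label in `L` nor in `f`. The second serves leaves, where having the right state is enough.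
  rcases hL with hL | hL
  · obtain ⟨j, hj, hcj, sj, pj⟩ := r₂ L
    obtain ⟨i, hi, hci, si, pi⟩ := r₁ (glue X₂ (recSet n tab j) L)
    have st : SameState G A C (glue X₁ (recSet n tab i) (glue X₂ (recSet n tab j) L)) (arrSet n f) :=
      (si.trans sj).trans hfL.symm
    have em : merged X₁ X₂ (recSet n tab i) (recSet n tab j) (arrSet n f) =
        glue A (glue X₁ (recSet n tab i) (glue X₂ (recSet n tab j) L)) (arrSet n f) := by
      ext v
      rw [merged, mem_glue, mem_glue, mem_glue, mem_glue, mem_glue]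
      by_cases hvA : v ∈ A
      · rw [if_pos hvA]
        by_cases hv1 : v ∈ X₁
        · rw [if_pos hv1, if_pos hv1]
        by_cases hv2 : v ∈ X₂
        · rw [if_neg hv1, if_neg hv1]
          rw [if_pos hv2, if_pos hv2]
        rw [if_neg hv1, if_neg hv1]
        rw [if_neg hv2, if_neg hv2]
        obtain ⟨h5, h6⟩ := ((hL v hvA).resolve_left hv1).resolve_left hv2
        exact ⟨fun h7 => absurd (hfC h7) h6, fun h7 => absurd h7 h5⟩
      · rw [if_neg hvA, if_neg fun h => hvA (h₁ h), if_neg fun h => hvA (h₂ h)]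
    obtain ⟨g1, g2⟩ := st.glue_right
    rw [← em] at g1 g2
    have := hgood.merge i j hi hj hci hcj g1
    omega
  · omega

theorem sizeCost_polyBdd : PolyBdd sizeCost :=
  ((Cond.cost_polyBdd _).add (Cmd.pcost_polyBdd _)).add (((PolyBdd.const 4).mul .id).add (.const 14))

theorem tableCost_polyBdd : PolyBdd tableCost :=
  (((PolyBdd.const 7).add (PolyBdd.id.mul (((PolyBdd.const 2).mul sizeCost_polyBdd).add
    (.const 3)))).add (Cmd.pcost_polyBdd _)).add (stateCost_polyBdd.add (.const 8))

end

/-! ### Traversal of the tree -/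

section

variable {n m : ℕ} {G : SimpleGraph (Fin n)} {T : SimpleGraph (Fin m)} {h h' : Store}

open Classical in
/-- The number of living neighbours of `y`. -/
noncomputable def liveDeg (T : SimpleGraph (Fin m)) (dead : ℕ → ℕ) (y : ℕ) : ℕ :=
  ∑ z ∈ Finset.range m, if NAdj T y z ∧ dead z ≠ 1 then 1 else 0

/-- The node `y` can be processed in round `rnd`. -/
def Ready (T : SimpleGraph (Fin m)) (dead : ℕ → ℕ) (r rnd y : ℕ) : Prop :=
  dead y ≠ 1 ∧ (y ≠ r ∨ rnd + 1 = m) ∧ liveDeg T dead y < 2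

theorem find_spec (H : Ctx G T h)
    (hex : ∃ y, y < m ∧ Ready T (h.arr .dead) (h.var .r) (h.var .rnd) y) :
    (findCmd.run h).var .x < m ∧
      Ready T (h.arr .dead) (h.var .r) (h.var .rnd) ((findCmd.run h).var .x) := by
  classical
  set q := Ready T (h.arr .dead) (h.var .r) (h.var .rnd) with hq
  have hx0 : (Cmd.assign .x (.var .m)).run h = h.setVar .x m := by
    rw [run_assign]; simp only [Exp.eval, H.hm]
  set h0 := h.setVar .x m with hh0
  have H0 : Ctx G T h0 := H.setVar _ _ rfl
  set body : Cmd := whenDo (.and (.not (isOne .dead .y)) (.or (.not (.eq (.var .y) (.var .r)))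
        (.eq (.add (.var .rnd) (.lit 1)) (.var .m))))
      (.assign .d (.lit 0) ;; .loop .z (.var .m)
          (whenDo (.and (treeC .y .z) (.not (isOne .dead .z))) (inc .d)) ;;
        whenDo (.lt (.var .d) (.lit 2)) (.assign .x (.var .y))) with hbody
  have key := run_loop (x := .y) (c := body) H0.forM
    (fun i h' => (h'.var .x = m ∨ h'.var .x < m ∧ q (h'.var .x)) ∧
      ((∃ y, y < i ∧ q y) → h'.var .x ≠ m)) ⟨Or.inl (by simp [hh0]), by simp⟩ ?_
  · have e : findCmd.run h = (Cmd.loop .y (.var .m) body).run h0 := by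
      show (Cmd.loop .y (.var .m) body).run ((Cmd.assign .x (.var .m)).run h) = _
      rw [hx0]
    rw [e]
    exact key.1.resolve_left (key.2 hex)
  · intro i h1 hi F ⟨i1, i2⟩
    set h2 := h1.setVar .y i with hh2
    have H2 : Ctx G T h2 := (H0.frame F rfl).setVar _ _ rfl
    have ey : h2.var .y = i := by simp [hh2]
    have ed : h2.arr .dead = h.arr .dead := F.arr .dead rfl
    have er : h2.var .r = h.var .r := by simp [hh2, F.var .r rfl, hh0]
    have ern : h2.var .rnd = h.var .rnd := by simp [hh2, F.var .rnd rfl, hh0]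
    have ex : h2.var .x = h1.var .x := by simp [hh2]
    have hP := H2.n_le
    have hmin : min 1 h2.P = 1 := by omega
    have hfinal : body.run h2 = h2 ∧ ¬ q i ∨ (body.run h2).var .x = if q i then i else h2.var .x := by
      rw [hbody, run_whenDo]
      simp only [Cond.eval_and, Cond.eval_or, Cond.eval_not, Cond.eval_eq, Exp.eval,
        H2.isOneM (ey.trans_lt hi), H2.hm]
      simp only [ey, ed, er, ern, hmin]
      by_cases hc : ¬ h.arr .dead i = 1 ∧ (¬ i = h.var .r ∨ h.var .rnd + 1 = m)
      · rw [if_pos hc]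
        right
        set h3 := h2.setVar .d 0 with hh3
        have H3 : Ctx G T h3 := H2.setVar _ _ rfl
        set c4 : Cmd := .loop .z (.var .m)
          (whenDo (.and (treeC .y .z) (.not (isOne .dead .z))) (inc .d)) with hc4
        have F4 : Frame c4 h3 (c4.run h3) := Frame.run _ _
        have e4 : (c4.run h3).var .d = liveDeg T (h.arr .dead) i := by
          refine (run_loop_sum (x := .z) H3.forM .d (fun z =>
            if NAdj T i z ∧ h.arr .dead z ≠ 1 then 1 else 0) ?_).trans ?_
          · intro j h5 hj F5
            have H5 : Ctx G T (h5.setVar .z j) := (H3.frame F5 rfl).setVar _ _ rfl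
            have ez : (h5.setVar .z j).var .z = j := by simp
            have ey5 : (h5.setVar .z j).var .y = i := by simp [F5.var .y rfl, hh3, ey]
            have ed5 : h5.arr .dead = h.arr .dead := (F5.arr .dead rfl).trans ed
            simp only [run_whenDo, Cond.eval_and, Cond.eval_not,
              H5.treeC (ey5.trans_lt hi) (ez.trans_lt hj), H5.isOneM (ez.trans_lt hj), H5.run_inc]
            simp only [ez, ey5, Store.setVar_arr, ed5]
            by_cases b1 : NAdj T i j <;> by_cases b2 : h.arr .dead j = 1 <;> simp [b1, b2]
          · simp [hh3, liveDeg]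
        have e5 : (Cmd.run (.assign .d (.lit 0) ;; c4 ;;
            whenDo (.lt (.var .d) (.lit 2)) (.assign .x (.var .y))) h2).var .x =
            if liveDeg T (h.arr .dead) i < 2 then i else h2.var .x := by
          show (Cmd.run (whenDo _ _) (c4.run h3)).var .x = _
          rw [run_whenDo]
          simp only [Cond.eval_lt, Exp.eval, e4, run_assign]
          split_ifs with hl
          · rw [Store.setVar_var, if_pos rfl, F4.var .y rfl]
            simp [hh3, ey]
          · exact (F4.var .x rfl).trans (by simp [hh3])
        rw [e5]
        have : q i ↔ liveDeg T (h.arr .dead) i < 2 := by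
          simp only [hq, Ready]; tauto
        simp only [this]
      · rw [if_neg hc]
        left
        refine ⟨rfl, fun hqi => hc ⟨hqi.1, hqi.2.1⟩⟩
    have hx : (body.run h2).var .x = if q i then i else h1.var .x := by
      rcases hfinal with ⟨h3, h4⟩ | h3
      · rw [h3, if_neg h4, ex]
      · rw [h3, ex]
    simp only [hx]
    by_cases hqi : q i
    · rw [if_pos hqi]
      exact ⟨Or.inr ⟨hi, hqi⟩, fun _ => by omega⟩
    · rw [if_neg hqi]
      refine ⟨i1, ?_⟩
      rintro ⟨y, hy, hqy⟩
      rcases Nat.lt_succ_iff_lt_or_eq.1 hy with hy | rfl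
      exacts [i2 ⟨y, hy, hqy⟩, absurd hqy hqi]

theorem children_spec (H : Ctx G T h) (hx : h.var .x < m)
    (h3 : ∀ a b c, a < b → b < c → c < m → (NAdj T (h.var .x) a ∧ h.arr .dead a = 1) →
      (NAdj T (h.var .x) b ∧ h.arr .dead b = 1) → (NAdj T (h.var .x) c ∧ h.arr .dead c = 1) →
        False) :
    (∀ c, (c = (childrenCmd.run h).var .c1 ∨ c = (childrenCmd.run h).var .c2) →
      c = m ∨ c < m ∧ NAdj T (h.var .x) c ∧ h.arr .dead c = 1) ∧
    ∀ z, z < m → NAdj T (h.var .x) z → h.arr .dead z = 1 →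
      z = (childrenCmd.run h).var .c1 ∨ z = (childrenCmd.run h).var .c2 := by
  classical
  set q : ℕ → Prop := fun z => NAdj T (h.var .x) z ∧ h.arr .dead z = 1 with hq
  set h0 := (h.setVar .c1 m).setVar .c2 m with hh0
  have H0 : Ctx G T h0 := (H.setVar _ _ rfl).setVar _ _ rfl
  set body : Cmd := whenDo (.and (treeC .x .z) (isOne .dead .z))
      (.ite (.eq (.var .c1) (.var .m)) (.assign .c1 (.var .z)) (.assign .c2 (.var .z))) with hbody
  have key := run_loop (x := .z) (c := body) H0.forM (fun i h' =>
    (h'.var .c1 = m ∧ h'.var .c2 = m ∧ ∀ z, z < i → ¬ q z) ∨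
    (h'.var .c1 < i ∧ h'.var .c2 = m ∧ q (h'.var .c1) ∧ ∀ z, z < i → q z → z = h'.var .c1) ∨
    (h'.var .c1 < h'.var .c2 ∧ h'.var .c2 < i ∧ q (h'.var .c1) ∧ q (h'.var .c2) ∧
      ∀ z, z < i → q z → z = h'.var .c1 ∨ z = h'.var .c2))
    (Or.inl ⟨by simp [hh0], by simp [hh0], by omega⟩) ?_
  · have e : childrenCmd.run h = (Cmd.loop .z (.var .m) body).run h0 := by
      show (Cmd.loop .z (.var .m) body).run (((Cmd.assign .c2 (.var .m)).run
        ((Cmd.assign .c1 (.var .m)).run h))) = _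
      simp [run_assign, Exp.eval, H.hm, hh0]
    rw [e]
    set h9 := (Cmd.loop .z (.var .m) body).run h0
    rcases key with ⟨k1, k2, k3⟩ | ⟨k1, k2, k3, k4⟩ | ⟨k1, k2, k3, k4, k5⟩
    · refine ⟨?_, fun z hz h1 h2 => absurd ⟨h1, h2⟩ (k3 z hz)⟩
      rintro c (rfl | rfl)
      exacts [Or.inl k1, Or.inl k2]
    · refine ⟨?_, fun z hz h1 h2 => Or.inl (k4 z hz ⟨h1, h2⟩)⟩
      rintro c (rfl | rfl)
      exacts [Or.inr ⟨k1, k3⟩, Or.inl k2]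
    · refine ⟨?_, fun z hz h1 h2 => k5 z hz ⟨h1, h2⟩⟩
      rintro c (rfl | rfl)
      exacts [Or.inr ⟨by omega, k3⟩, Or.inr ⟨k2, k4⟩]
  · intro i h1 hi F ih
    set h2 := h1.setVar .z i with hh2
    have H2 : Ctx G T h2 := (H0.frame F rfl).setVar _ _ rfl
    have ez : h2.var .z = i := by simp [hh2]
    have ex : h2.var .x = h.var .x := by simp [hh2, F.var .x rfl, hh0]
    have ed : h2.arr .dead = h.arr .dead := F.arr .dead rfl
    have e1 : h2.var .c1 = h1.var .c1 := by simp [hh2]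
    have e2 : h2.var .c2 = h1.var .c2 := by simp [hh2]
    have hrun : ((body.run h2).var .c1 = if q i ∧ h1.var .c1 = m then i else h1.var .c1) ∧
        ((body.run h2).var .c2 = if q i ∧ h1.var .c1 ≠ m then i else h1.var .c2) := by
      rw [hbody, run_whenDo]
      simp only [Cond.eval_and, H2.treeC (ex.trans_lt hx) (ez.trans_lt hi), H2.isOneM (ez.trans_lt hi)]
      simp only [ez, ex, ed]
      by_cases hqi : q i
      · rw [if_pos (by exact hqi), run_ite]
        simp only [Cond.eval_eq, Exp.eval, e1, H2.hm, run_assign, ez]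
        by_cases hc : h1.var .c1 = m <;> simp [hc, hqi, e1, e2]
      · rw [if_neg (by exact hqi)]
        simp [hqi, e1, e2]
    simp only [hrun.1, hrun.2]
    by_cases hqi : q i
    · rcases ih with ⟨k1, k2, k3⟩ | ⟨k1, k2, k3, k4⟩ | ⟨k1, k2, k3, k4, k5⟩
      · right; left
        simp only [hqi, k1, true_and, ne_eq, not_true, if_true, if_false, k2]
        refine ⟨by omega, fun z hz hqz => ?_⟩
        rcases Nat.lt_succ_iff_lt_or_eq.1 hz with hz | rfl
        exacts [absurd hqz (k3 z hz), rfl]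
      · right; right
        have hne : h1.var .c1 ≠ m := by omega
        simp only [hqi, hne, true_and, ne_eq, not_false_eq_true, if_true, if_false]
        refine ⟨k1, by omega, k3, fun z hz hqz => ?_⟩
        rcases Nat.lt_succ_iff_lt_or_eq.1 hz with hz | rfl
        exacts [Or.inl (k4 z hz hqz), Or.inr rfl]
      · exact absurd hqi fun hqi => h3 _ _ _ k1 k2 hi k3 k4 hqi
    · simp only [hqi, false_and, if_false]
      have hz' : ∀ z, z < i + 1 → q z → z < i := fun z hz hqz => by
        rcases Nat.lt_succ_iff_lt_or_eq.1 hz with hz | rfl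
        exacts [hz, absurd hqz hqi]
      rcases ih with ⟨k1, k2, k3⟩ | ⟨k1, k2, k3, k4⟩ | ⟨k1, k2, k3, k4, k5⟩
      · exact Or.inl ⟨k1, k2, fun z hz hqz => k3 z (hz' z hz hqz) hqz⟩
      · exact Or.inr (Or.inl ⟨by omega, k2, k3, fun z hz hqz => k4 z (hz' z hz hqz) hqz⟩)
      · exact Or.inr (Or.inr ⟨k1, by omega, k3, k4, fun z hz hqz => k5 z (hz' z hz hqz) hqz⟩)

theorem inside_spec (H : Ctx G T h) (v : Fin n) : (insideCmd.run h).arr .inA v = 1 ↔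
    h.arr .top v = h.var .x ∨ h.arr .top v = h.var .c1 ∨ h.arr .top v = h.var .c2 := by
  have key := run_loop_fill (x := .v) (h := h) (c := .ite (.or (.eq (.arr .top (.var .v)) (.var .x))
    (.or (.eq (.arr .top (.var .v)) (.var .c1)) (.eq (.arr .top (.var .v)) (.var .c2))))
    (.store .inA (.var .v) (.lit 1)) (.store .inA (.var .v) (.lit 0))) H.forN .inA
    (fun v => if h.arr .top v = h.var .x ∨ h.arr .top v = h.var .c1 ∨ h.arr .top v = h.var .c2
      then 1 else 0) ?_ v
  · have key' : (insideCmd.run h).arr .inA v = _ := key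
    rw [key', if_pos v.2]
    split_ifs with hc <;> simp [hc]
  · intro i h1 hi F
    have hP : min i h1.P = i := by have := F.P; have := H.n_le; omega
    simp only [run_ite, run_store, Cond.eval_or, Cond.eval_eq, Exp.eval, Store.setVar_var, if_true,
      Store.setVar_P', Store.setVar_arr, hP, F.arr .top rfl, reduceCtorEq, if_false,
      F.var .x rfl, F.var .c1 rfl, F.var .c2 rfl]
    split_ifs <;> exact ⟨by simp, fun j hj => by simp [hj]⟩

theorem close_spec (H : Ctx G T h) (hx : h.var .x < m) :
    (∀ v : Fin n, (closeCmd.run h).arr .top v =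
      if h.arr .inA v = 1 then h.var .x else h.arr .top v) ∧
    (closeCmd.run h).arr .dead = Function.update (h.arr .dead) (h.var .x) 1 := by
  set c : Cmd := forV (whenDo (isOne .inA .v) (.store .top (.var .v) (.var .x))) with hc
  have F1 : Frame c h (c.run h) := Frame.run _ _
  have e1 : (c.run h).var .x = h.var .x := F1.var .x rfl
  have e2 : closeCmd.run h = (c.run h).setArr .dead (h.var .x) 1 := by
    show (Cmd.store .dead (.var .x) (.lit 1)).run (c.run h) = _
    have : (c.run h).P = h.P := F1.P
    have := H.m_le
    rw [run_store]
    simp only [Exp.eval, e1]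
    rw [min_eq_left (by omega)]
  rw [e2]
  refine ⟨fun v => ?_, ?_⟩
  · have key := run_loop (x := .v) (h := h)
      (c := whenDo (isOne .inA .v) (.store .top (.var .v) (.var .x))) H.forN
      (fun i h' => ∀ v, h'.arr .top v =
        if v < i ∧ h.arr .inA v = 1 then h.var .x else h.arr .top v) (by simp) ?_ v
    · have key' : (c.run h).arr .top v = _ := key
      simp [key']
    · intro i h1 hi F ih j
      have H1 : Ctx G T (h1.setVar .v i) := (H.frame F rfl).setVar _ _ rfl
      have ev : (h1.setVar .v i).var .v = i := by simp
      have hP : min i h1.P = i := by have := F.P; have := H.n_le; omega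
      simp only [run_whenDo, H1.isOne (ev.trans_lt hi), run_store, Exp.eval]
      simp only [ev, Store.setVar_arr, Store.setVar_P', hP, F.arr .inA rfl, Store.setVar_var,
        reduceCtorEq, if_false, F.var .x rfl]
      by_cases hA : h.arr .inA i = 1
      · rw [if_pos hA]
        by_cases hj : j = i
        · subst hj; simp [hA]
        · have : j < i + 1 ↔ j < i := by omega
          simp [hj, ih j, this]
      · rw [if_neg hA, Store.setVar_arr, ih j]
        by_cases hj : j = i
        · subst hj; simp [hA]
        · have : j < i + 1 ↔ j < i := by omega
          simp [this]
  · rw [Store.setArr_arr_self, F1.arr .dead rfl]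

end

/-! ### Invariants of the traversal -/

section

variable {n m : ℕ} {G : SimpleGraph (Fin n)} {D : BranchDecomposition (Fin n) (Fin m)} {r : Fin m}
  {h h' : Store} {i k : ℕ}

theorem liveDeg_eq_card [DecidableRel D.tree.Adj] (dead : ℕ → ℕ) (y : Fin m) :
    liveDeg D.tree dead y =
      (Finset.univ.filter fun z : Fin m => D.tree.Adj y z ∧ dead z ≠ 1).card := by
  classical
  rw [liveDeg, Finset.sum_range, ← Finset.card_filter]
  congr 1
  ext z
  simp [nadj_iff]

/-- The records of type `c` contain optimal labellings of `A` for all states. -/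
def Complete (G : SimpleGraph (Fin n)) (A : Finset (Fin n)) (tab : ℕ → ℕ) (R c : ℕ) : Prop :=
  ∃ C, IsCanonical G A C ∧ ∀ L, ∃ j, j < R ∧ tab (j * (n + 1)) = c ∧
    SameState G A C (recSet n tab j) L ∧ partialCut G A C L ≤ partialCut G A C (recSet n tab j)

theorem Complete.mono {A : Finset (Fin n)} {tab tab' : ℕ → ℕ} {R R' c : ℕ} (hR : R ≤ R')
    (ht : ∀ i, i < R * (n + 1) → tab' i = tab i) (H : Complete G A tab R c) :
    Complete G A tab' R' c := by
  obtain ⟨C, hC, hL⟩ := H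
  refine ⟨C, hC, fun L => ?_⟩
  obtain ⟨j, hj, h1, h2, h3⟩ := hL L
  obtain ⟨e1, e2⟩ := recSet_congr hj ht
  exact ⟨j, by omega, e1.trans h1, by rw [e2]; exact h2, by rw [e2]; exact h3⟩

/-- The exchange works for any canonical covers of the two cuts. So the cover used for a child may
be forgotten once its table is complete. -/
theorem Complete.replace {A B C : Finset (Fin n)} {tab : ℕ → ℕ} {R c : ℕ} (hA : IsCanonical G A C)
    (hBA : B ⊆ A) (H : Complete G B tab R c) : Replace G A C B tab R c := by
  obtain ⟨E, hE, hL⟩ := H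
  intro L
  obtain ⟨j, hj, h1, h2, h3⟩ := hL L
  exact ⟨j, hj, h1, SameState.exchange hA hE hBA h2 h3⟩

/-- The case of a missing child, served by the dummy record: any record may be glued along the empty
set. -/
theorem replace_empty {A C : Finset (Fin n)} {tab : ℕ → ℕ} {R c : ℕ}
    (hj : ∃ j, j < R ∧ tab (j * (n + 1)) = c) : Replace G A C ∅ tab R c := by
  obtain ⟨j, hj, h1⟩ := hj
  intro L
  have : glue ∅ (recSet n tab j) L = L := by ext v; simp [mem_glue]
  exact ⟨j, hj, h1, by rw [this]; exact SameState.rfl, by rw [this]⟩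

open Classical in
/-- The vertices on the side of `x` of the edge `xy`. -/
noncomputable def sideSet (D : BranchDecomposition (Fin n) (Fin m)) (x y : Fin m) :
    Finset (Fin n) := Finset.univ.filter fun v => v ∈ D.side x y

@[simp] theorem mem_sideSet {x y : Fin m} {v : Fin n} : v ∈ sideSet D x y ↔ v ∈ D.side x y := by
  simp [sideSet]

theorem coe_sideSet {x y : Fin m} : (sideSet D x y : Set (Fin n)) = D.side x y := by
  ext v; simp

/-- The tree after `i` rounds. -/
structure TreeInv (D : BranchDecomposition (Fin n) (Fin m)) (r : Fin m) (i : ℕ) (h : Store) :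
    Prop where
  root : h.var .r = r
  card : (arrSet m (h.arr .dead)).card = i
  closed : ∀ x y, IsParent D.tree r x y → h.arr .dead y = 1 → h.arr .dead x = 1
  alive : i < m → h.arr .dead r ≠ 1
  top_lt : ∀ v : Fin n, h.arr .top v < m
  top_alive : ∀ (v : Fin n) (x : Fin m), h.arr .dead x ≠ 1 →
    (h.arr .top v = x ↔ (D.δ.symm v : Fin m) = x)
  top_dead : ∀ (v : Fin n) (y p : Fin m), IsParent D.tree r y p → h.arr .dead y = 1 →
    h.arr .dead p ≠ 1 → (h.arr .top v = y ↔ v ∈ D.side y p)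

/-- The tables after `i` rounds. -/
structure TabInv (G : SimpleGraph (Fin n)) (D : BranchDecomposition (Fin n) (Fin m)) (r : Fin m)
    (k i : ℕ) (h : Store) : Prop where
  table : ∀ y p, IsParent D.tree r y p → h.arr .dead y = 1 → h.arr .dead p ≠ 1 →
    Complete G (sideSet D y p) h.tab (h.var .R) y
  dummy : ∃ j, j < h.var .R ∧ h.tab (j * (n + 1)) = m
  cur : h.cur 0 = h.var .R * (n + 1)
  size : h.var .R ≤ 1 + i * ((n + 1) * 2 ^ k)
  final : i = m → h.var .bv = cutSize G (arrSet n (h.arr .best) : Set (Fin n)) ∧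
    IsMaxCut G (arrSet n (h.arr .best) : Set (Fin n))

/-- The node `x` is processed next. -/
structure Next (D : BranchDecomposition (Fin n) (Fin m)) (r : Fin m) (dead : ℕ → ℕ) (i : ℕ)
    (x : Fin m) : Prop where
  alive : dead x ≠ 1
  child : ∀ z, D.tree.Adj x z → ¬ IsParent D.tree r x z → dead z = 1
  parent : ∀ p, IsParent D.tree r x p → dead p ≠ 1
  root : x = r ↔ i + 1 = m
  only : x = r → ∀ z, z ≠ r → dead z = 1

theorem TreeInv.card_alive (I : TreeInv D r i h) :
    (arrSet m (h.arr .dead))ᶜ.card = m - i := by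
  rw [Finset.card_compl, I.card, Fintype.card_fin]

theorem TreeInv.only_root (I : TreeInv D r i h) (hi : i + 1 = m) (z : Fin m) (hz : z ≠ r) :
    h.arr .dead z = 1 := by
  by_contra hd
  have h1 := I.card_alive
  have h2 := I.alive (by omega)
  have : 1 < (arrSet m (h.arr .dead))ᶜ.card :=
    Finset.one_lt_card.2 ⟨z, by simpa using hd, r, by simpa using h2, hz⟩
  omega

/-- In the last round only the root is alive. Before that, take an outermost living node other than
the root: all its living neighbours are parents, and the parent is unique. -/
theorem TreeInv.exists_ready (I : TreeInv D r i h) (hi : i < m) :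
    ∃ y, y < m ∧ Ready D.tree (h.arr .dead) (h.var .r) i y := by
  classical
  have hr := I.alive hi
  by_cases him : i + 1 = m
  · refine ⟨r, r.2, hr, Or.inr him, ?_⟩
    rw [liveDeg_eq_card, Finset.card_eq_zero.2]
    · omega
    · refine Finset.filter_eq_empty_iff.2 fun z _ hz => hz.2 (I.only_root him z ?_)
      rintro rfl
      exact hz.1.ne rfl
  · have h1 := I.card_alive
    have h2 : 1 < (arrSet m (h.arr .dead))ᶜ.card := by omega
    obtain ⟨y, hy, hyr⟩ := Finset.exists_mem_ne h2 r
    obtain ⟨x, hx, hxr, hpar⟩ := exists_outermost (r := r) D.isTree {z : Fin m | h.arr .dead z ≠ 1}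
      ⟨y, by simpa using hy, hyr⟩
    refine ⟨x, x.2, hx, Or.inl (by rw [I.root]; exact fun h => hxr (Fin.ext h)), ?_⟩
    rw [liveDeg_eq_card]
    refine Nat.lt_succ_of_le (Finset.card_le_one.2 fun a ha b hb => ?_)
    simp only [Finset.mem_filter, Finset.mem_univ, true_and] at ha hb
    exact (hpar a ha.2 ha.1).unique D.isTree (hpar b hb.2 hb.1)

/-- Dead nodes are closed under descendants, so the parent of a living node is alive. It uses up the
one living neighbour that is allowed, and all children are dead. -/
theorem TreeInv.next (I : TreeInv D r i h) {x : Fin m}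
    (hx : Ready D.tree (h.arr .dead) (h.var .r) i x) : Next D r (h.arr .dead) i x := by
  classical
  obtain ⟨h1, h2, h3⟩ := hx
  have hroot : x = r ↔ i + 1 = m := by
    constructor
    · rintro rfl
      refine h2.resolve_left fun h => h I.root.symm
    · intro him
      by_contra hxr
      exact h1 (I.only_root him x hxr)
  have hpar : ∀ p, IsParent D.tree r x p → h.arr .dead p ≠ 1 := fun p hp hd => h1 (I.closed x p hp hd)
  refine ⟨h1, fun z hz hnp => ?_, hpar, hroot, fun hxr => I.only_root (hroot.1 hxr)⟩
  by_cases hxr : x = r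
  · refine I.only_root (hroot.1 hxr) z ?_
    rintro rfl
    exact hz.ne hxr
  · obtain ⟨p, hp⟩ := exists_isParent D.isTree hxr
    by_contra hd
    rw [liveDeg_eq_card] at h3
    have : 1 < (Finset.univ.filter fun z : Fin m => D.tree.Adj x z ∧ h.arr .dead z ≠ 1).card :=
      Finset.one_lt_card.2 ⟨z, by simp [hz, hd], p, by simp [hp.1, hpar p hp], by
        rintro rfl; exact hnp hp⟩
    omega

theorem Next.isParent {x z : Fin m} {dead : ℕ → ℕ} (N : Next D r dead i x)
    (hz : D.tree.Adj x z) (hd : dead z = 1) : IsParent D.tree r z x :=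
  isParent_of_not D.isTree hz fun hp => N.parent z hp hd

/-- A node of the tree has at most two children. -/
theorem Next.no_three {x : Fin m} {dead : ℕ → ℕ} (N : Next D r dead i x) (v₀ : Fin n)
    (hr : (D.δ.symm v₀ : Fin m) = r) (a b c : ℕ) (hab : a < b) (hbc : b < c)
    (ha : NAdj D.tree x a ∧ dead a = 1) (hb : NAdj D.tree x b ∧ dead b = 1)
    (hc : NAdj D.tree x c ∧ dead c = 1) : False := by
  obtain ⟨⟨_, ha1, ha2⟩, ha3⟩ := ha
  obtain ⟨⟨_, hb1, hb2⟩, hb3⟩ := hb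
  obtain ⟨⟨_, hc1, hc2⟩, hc3⟩ := hc
  -- The root is a leaf and has at most one neighbour.
  by_cases hxr : x = r
  · have h1 : (D.tree.neighborSet x).encard ≤ 1 := by
      rw [hxr, ← hr]; exact (D.δ.symm v₀).2
    rw [Set.encard_le_one_iff] at h1
    have := h1 ⟨a, ha1⟩ ⟨b, hb1⟩ ha2 hb2
    simp only [Fin.mk.injEq] at this
    omega
  · obtain ⟨p, hp⟩ := exists_isParent D.isTree hxr
    have hpd := N.parent p hp
    have h1 := D.subcubic x
    -- Three children and the parent would be four neighbours.
    have hsub : (({⟨a, ha1⟩, ⟨b, hb1⟩, ⟨c, hc1⟩, p} : Finset (Fin m)) : Set (Fin m)) ⊆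
        D.tree.neighborSet x := by
      intro z hz
      simp only [Finset.coe_insert, Finset.coe_singleton, Set.mem_insert_iff,
        Set.mem_singleton_iff] at hz
      rcases hz with rfl | rfl | rfl | rfl
      exacts [ha2, hb2, hc2, hp.1]
    have h2 := (Set.encard_le_encard hsub).trans h1
    rw [Set.encard_coe_eq_coe_finsetCard] at h2
    have hap : a ≠ p := by rintro rfl; exact hpd ha3
    have hbp : b ≠ p := by rintro rfl; exact hpd hb3
    have hcp : c ≠ p := by rintro rfl; exact hpd hc3
    rw [Finset.card_insert_of_notMem, Finset.card_insert_of_notMem,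
      Finset.card_insert_of_notMem, Finset.card_singleton] at h2
    · norm_num at h2
    · simp only [Finset.mem_singleton, Fin.ext_iff]; exact hcp
    · simp only [Finset.mem_insert, Finset.mem_singleton, Fin.ext_iff]; push Not
      exact ⟨by omega, hbp⟩
    · simp only [Finset.mem_insert, Finset.mem_singleton, Fin.ext_iff]; push Not
      exact ⟨by omega, by omega, hap⟩

/-- The children of the node `x`. -/
structure Children (D : BranchDecomposition (Fin n) (Fin m)) (dead : ℕ → ℕ) (x : Fin m)
    (c₁ c₂ : ℕ) : Prop where
  child : ∀ c, (c = c₁ ∨ c = c₂) → c = m ∨ c < m ∧ NAdj D.tree x c ∧ dead c = 1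
  all : ∀ z, z < m → NAdj D.tree x z → dead z = 1 → z = c₁ ∨ z = c₂

/-- Translates the test of `insideCmd`, which only looks at `top`, into sides of tree edges. -/
theorem TreeInv.mem_inside (I : TreeInv D r i h) {x : Fin m} (N : Next D r (h.arr .dead) i x)
    {c₁ c₂ : ℕ} (K : Children D (h.arr .dead) x c₁ c₂) (v : Fin n) :
    (h.arr .top v = x ∨ h.arr .top v = c₁ ∨ h.arr .top v = c₂) ↔
      (D.δ.symm v : Fin m) = x ∨ ∃ z, D.tree.Adj x z ∧ h.arr .dead z = 1 ∧ v ∈ D.side z x := by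
  rw [I.top_alive v x N.alive]
  refine or_congr Iff.rfl ⟨fun hc => ?_, ?_⟩
  · rcases K.child (h.arr .top v) hc with h1 | ⟨h1, h2, h3⟩
    · have := I.top_lt v
      omega
    · obtain ⟨_, hz, h4⟩ := h2
      exact ⟨⟨_, hz⟩, h4, h3, (I.top_dead v ⟨_, hz⟩ x (N.isParent h4 h3) h3 N.alive).1 rfl⟩
  · rintro ⟨z, h1, h2, h3⟩
    rw [(I.top_dead v z x (N.isParent h1 h2) h2 N.alive).2 h3]
    exact K.all z z.2 (nadj_iff.2 h1) h2

theorem Next.mem_side {x p : Fin m} {dead : ℕ → ℕ} (N : Next D r dead i x)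
    (hp : IsParent D.tree r x p) (v : Fin n) :
    ((D.δ.symm v : Fin m) = x ∨ ∃ z, D.tree.Adj x z ∧ dead z = 1 ∧ v ∈ D.side z x) ↔
      v ∈ D.side x p := by
  rw [D.mem_side, mem_comp_iff_exists D.isTree hp.1]
  refine or_congr Iff.rfl ⟨?_, ?_⟩
  · rintro ⟨z, h1, h2, h3⟩
    exact ⟨z, h1, by rintro rfl; exact N.parent z hp h2, h3⟩
  · rintro ⟨z, h1, h2, h3⟩
    exact ⟨z, h1, N.child z h1 fun h4 => h2 (h4.unique D.isTree hp), h3⟩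

theorem Next.mem_root {x : Fin m} {dead : ℕ → ℕ} (N : Next D r dead i x) (hx : x = r)
    (v : Fin n) :
    (D.δ.symm v : Fin m) = x ∨ ∃ z, D.tree.Adj x z ∧ dead z = 1 ∧ v ∈ D.side z x := by
  by_cases hv : (D.δ.symm v : Fin m) = x
  · exact Or.inl hv
  · obtain ⟨z, h1, h2⟩ := exists_mem_comp D.isTree hv
    refine Or.inr ⟨z, h1, N.only hx z ?_, h2⟩
    rintro rfl
    exact h1.ne hx

/-- The tree after the node `x` has been processed. -/
theorem TreeInv.step (I : TreeInv D r i h) (hi : i < m) {x : Fin m}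
    (N : Next D r (h.arr .dead) i x) {c₁ c₂ : ℕ} (K : Children D (h.arr .dead) x c₁ c₂)
    (hroot : h'.var .r = h.var .r) (hdead : h'.arr .dead = Function.update (h.arr .dead) x 1)
    (htop : ∀ v : Fin n, (h.arr .top v = x ∨ h.arr .top v = c₁ ∨ h.arr .top v = c₂) ∧
        h'.arr .top v = x ∨ ¬ (h.arr .top v = x ∨ h.arr .top v = c₁ ∨ h.arr .top v = c₂) ∧
        h'.arr .top v = h.arr .top v) : TreeInv D r (i + 1) h' := by
  have hd : ∀ y : Fin m, h'.arr .dead y = 1 ↔ y = x ∨ h.arr .dead y = 1 := by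
    intro y
    rw [hdead, Function.update_apply]
    simp only [← Fin.ext_iff]
    split_ifs with hyx <;> simp [hyx]
  refine ⟨hroot.trans I.root, ?_, ?_, ?_, ?_, ?_, ?_⟩
  · have : arrSet m (h'.arr .dead) = insert x (arrSet m (h.arr .dead)) := by
      rw [hdead]; exact arrSet_update x
    rw [this, Finset.card_insert_of_notMem (by simpa using N.alive), I.card]
  · intro y p hp hdp
    rw [hd] at hdp ⊢
    rcases hdp with rfl | hdp
    · exact Or.inr (N.child y hp.1.symm (hp.not_swap D.isTree))
    · exact Or.inr (I.closed y p hp hdp)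
  · intro hi1
    rw [Ne, hd]
    push Not
    refine ⟨fun hrx => ?_, I.alive hi⟩
    have := N.root.1 hrx.symm
    omega
  · intro v
    rcases htop v with ⟨-, h1⟩ | ⟨-, h1⟩
    · rw [h1]; exact x.2
    · rw [h1]; exact I.top_lt v
  · intro v y hy
    rw [Ne, hd] at hy
    push Not at hy
    rw [← I.top_alive v y hy.2]
    rcases htop v with ⟨h2, h1⟩ | ⟨-, h1⟩
    · rw [h1]
      have e1 : ((x : ℕ) = y) ↔ False := by
        rw [← Fin.ext_iff]; exact iff_false_intro fun h => hy.1 h.symm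
      rw [e1, false_iff]
      intro h3
      rcases h2 with h2 | h2
      · exact hy.1 (Fin.ext (h3.symm.trans h2))
      · rcases K.child _ h2 with h4 | ⟨-, -, h4⟩
        · have := I.top_lt v; omega
        · rw [h3] at h4; exact hy.2 h4
    · rw [h1]
  · intro v y p hp hy hpa
    rw [hd] at hy
    rw [Ne, hd] at hpa
    push Not at hpa
    by_cases hyx : y = x
    · subst hyx
      rw [← N.mem_side hp v, ← I.mem_inside N K v]
      rcases htop v with ⟨h2, h1⟩ | ⟨h2, h1⟩
      · simp only [h1, h2]
      · simp only [h2, h1, iff_false]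
        exact fun h3 => h2 (Or.inl h3)
    · have hyd := hy.resolve_left hyx
      rw [← I.top_dead v y p hp hyd hpa.2]
      rcases htop v with ⟨h2, h1⟩ | ⟨-, h1⟩
      · rw [h1]
        have e1 : ((x : ℕ) = y) ↔ False := by
          rw [← Fin.ext_iff]; exact iff_false_intro fun h => hyx h.symm
        rw [e1, false_iff]
        intro h3
        rcases h2 with h2 | h2
        · exact hyx (Fin.ext (h3.symm.trans h2))
        · rcases K.child _ h2 with h4 | ⟨-, h5, h4⟩
          · have := I.top_lt v; omega
          · rw [h3] at h5 h4
            exact hpa.1 (hp.unique D.isTree (N.isParent (nadj_iff.1 h5) h4))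
      · rw [h1]

end

/-! ### Processing one node -/

section

variable {n m : ℕ} {G : SimpleGraph (Fin n)} {D : BranchDecomposition (Fin n) (Fin m)} {r : Fin m}
  {h h' : Store} {i k : ℕ}

/-- There are no edges inside `A`, and a canonical cover has no outer vertices. At a leaf every
labelling is therefore optimal for its state. -/
theorem partialCut_of_card_le_one {A C : Finset (Fin n)} (hA : IsCanonical G A C)
    (hc : A.card ≤ 1) (L : Finset (Fin n)) : partialCut G A C L = 0 := by
  classical
  rw [partialCut, hA.outer_eq_empty hc]
  have h1 : crossCut G L ∅ A = 0 := by simp [crossCut]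
  have h2 : innerCut G L A = 0 := by
    refine Finset.sum_eq_zero fun u hu => Finset.sum_eq_zero fun v hv => ?_
    rw [Finset.card_le_one.1 hc u hu v hv]
    simp
  rw [h1, h2]

theorem isRankOne_univ : IsRankOne G Finset.univ := fun _ _ v hv => absurd (Finset.mem_univ v) hv

theorem IsCanonical.univ_eq_empty {C : Finset (Fin n)} (h : IsCanonical G Finset.univ C) :
    C = ∅ := by
  have := h.card_le ∅ fun _ _ v hv => absurd (Finset.mem_univ v) hv
  simpa using this

/-- Of each cut and its complement, one avoids `v₀`. -/
theorem isMaxCut_of_complete {L₀ : Finset (Fin n)} (v₀ : Fin n)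
    (hL : ∀ L : Finset (Fin n), v₀ ∉ L →
      partialCut G Finset.univ ∅ L ≤ partialCut G Finset.univ ∅ L₀) :
    IsMaxCut G (L₀ : Set (Fin n)) := by
  classical
  intro W
  rw [← partialCut_univ L₀]
  have e : cutSize G W = partialCut G Finset.univ ∅ W.toFinset := by
    rw [partialCut_univ, Set.coe_toFinset]
  rw [e]
  by_cases hv : v₀ ∈ W.toFinset
  · rw [← partialCut_compl]
    exact hL _ (by simpa using hv)
  · exact hL _ hv

/-- The factor `n + 1` pays for the cuts of rank one, the factor `2 ^ k` for all others. -/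
theorem maxCode_succ_le (b : Bool) (M : ℕ → ℕ) (hb : b = false → (arrSet n M).card ≤ k) :
    maxCode b M n + 1 ≤ (n + 1) * 2 ^ k := by
  have hpos := Nat.one_le_two_pow (n := k)
  have hr := rank_eq_card M n
  cases b with
  | true =>
    have h1 : (arrSet n M).card ≤ n := by
      simpa using Finset.card_le_univ (arrSet n M)
    simp only [maxCode, if_true]
    calc rank M n + 1 ≤ (n + 1) * 1 := by omega
      _ ≤ _ := Nat.mul_le_mul_left _ hpos
  | false =>
    have h1 : 2 ^ rank M n ≤ 2 ^ k := Nat.pow_le_pow_right (by omega) (by rw [hr]; exact hb rfl)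
    have h2 := Nat.one_le_two_pow (n := rank M n)
    simp only [maxCode, Bool.false_eq_true, if_false]
    calc 2 ^ rank M n - 1 + 1 ≤ 1 * 2 ^ k := by omega
      _ ≤ _ := Nat.mul_le_mul_right _ (by omega)

/-- A bound for the cost of processing a node, divided by `8 ^ k`. -/
def nodeCost (P : ℕ) : ℕ :=
  findCmd.pcost P + childrenCmd.pcost P + insideCmd.pcost P + coverCost P +
    tableCost P * (P * (P * P * (P * P))) + closeCmd.pcost P

theorem nodeCost_polyBdd : PolyBdd nodeCost :=
  (((((Cmd.pcost_polyBdd _).add (Cmd.pcost_polyBdd _)).add (Cmd.pcost_polyBdd _)).add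
    coverCost_polyBdd).add (tableCost_polyBdd.mul (PolyBdd.id.mul ((PolyBdd.id.mul .id).mul
      (PolyBdd.id.mul .id))))).add (Cmd.pcost_polyBdd _)

/-- The source of `8 ^ k`: the number of states and the two numbers of scanned records each
contribute a factor `2 ^ k`, while the number of nodes and the factors `n + 1` are bounded by powers
of `P`. -/
theorem table_bound {R S P : ℕ} (hn : n + 2 ≤ P) (hm : m + 2 ≤ P) (hi : i < m)
    (hR : R ≤ 1 + i * ((n + 1) * 2 ^ k)) (hS : S ≤ (n + 1) * 2 ^ k) :
    S * (R + S + 1) ^ 2 ≤ P * (P * P * (P * P)) * 8 ^ k := by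
  have hpos := Nat.one_le_two_pow (n := k)
  have h1 : (n + 1) * 2 ^ k ≤ P * 2 ^ k := Nat.mul_le_mul_right _ (by omega)
  have h2 : R + S + 1 ≤ P * P * 2 ^ k := by
    have h3 : (i + 1) * ((n + 1) * 2 ^ k) ≤ m * (P * 2 ^ k) := Nat.mul_le_mul hi h1
    have h4 : (m + 2) * (P * 2 ^ k) ≤ P * (P * 2 ^ k) := Nat.mul_le_mul_right _ hm
    have h5 : 1 ≤ P * 2 ^ k := Nat.mul_pos (by omega) hpos
    have h6 : (i + 1) * ((n + 1) * 2 ^ k) = i * ((n + 1) * 2 ^ k) + (n + 1) * 2 ^ k := by ring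
    have h7 : (m + 2) * (P * 2 ^ k) = m * (P * 2 ^ k) + 2 * (P * 2 ^ k) := by ring
    have h8 : P * P * 2 ^ k = P * (P * 2 ^ k) := by ring
    omega
  calc S * (R + S + 1) ^ 2 ≤ (P * 2 ^ k) * (P * P * 2 ^ k) ^ 2 :=
        Nat.mul_le_mul (hS.trans h1) (Nat.pow_le_pow_left h2 2)
    _ = P * (P * P * (P * P)) * (2 ^ k) ^ 3 := by ring
    _ = P * (P * P * (P * P)) * 8 ^ k := by
      rw [← pow_mul, mul_comm k 3, pow_mul]; norm_num

theorem node_spec (H : Ctx G D.tree h) (I : TreeInv D r i h) (J : TabInv G D r k i h)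
    (hrnd : h.var .rnd = i) (hi : i < m) (v₀ : Fin n) (hr : (D.δ.symm v₀ : Fin m) = r)
    (hk : D.smWidth G ≤ k) :
    (TreeInv D r (i + 1) (nodeCmd.run h) ∧ TabInv G D r k (i + 1) (nodeCmd.run h)) ∧
      nodeCmd.cost h ≤ nodeCost h.P * 8 ^ k := by
  -- the node and its children
  obtain ⟨hxm, hx⟩ := find_spec H (by rw [hrnd]; exact I.exists_ready hi)
  rw [hrnd] at hx
  have F1 : Frame findCmd h (findCmd.run h) := Frame.run _ _
  have q1 := findCmd.cost_le_pcost rfl h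
  set h1 := findCmd.run h with hh1
  have H1 : Ctx G D.tree h1 := H.frame F1 rfl
  obtain ⟨x, hxx⟩ : ∃ x : Fin m, h1.var .x = x := ⟨⟨_, hxm⟩, rfl⟩
  rw [hxx] at hx
  have N := I.next hx
  have ed1 : h1.arr .dead = h.arr .dead := F1.arr .dead rfl
  have hch := children_spec H1 (by rw [hxx]; exact x.2) (by
    rw [hxx, ed1]
    exact fun a b c hab hbc _ ha hb hc => N.no_three v₀ hr a b c hab hbc ha hb hc)
  have F2 : Frame childrenCmd h1 (childrenCmd.run h1) := Frame.run _ _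
  have q2 := childrenCmd.cost_le_pcost rfl h1
  set h2 := childrenCmd.run h1 with hh2
  have H2 : Ctx G D.tree h2 := H1.frame F2 rfl
  rw [hxx, ed1] at hch
  have K : Children D (h.arr .dead) x (h2.var .c1) (h2.var .c2) := ⟨hch.1, hch.2⟩
  set c₁ := h2.var .c1 with hc₁
  set c₂ := h2.var .c2 with hc₂
  have ex2 : h2.var .x = x := (F2.var .x rfl).trans hxx
  have et2 : h2.arr .top = h.arr .top := (F2.arr .top rfl).trans (F1.arr .top rfl)
  -- the cut and its cover
  have hin := inside_spec H2
  have F3 : Frame insideCmd h2 (insideCmd.run h2) := Frame.run _ _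
  have q3 := insideCmd.cost_le_pcost rfl h2
  set h3 := insideCmd.run h2 with hh3
  have H3 : Ctx G D.tree h3 := H2.frame F3 rfl
  rw [et2, ex2] at hin
  set A := arrSet n (h3.arr .inA) with hA
  have memA : ∀ v, v ∈ A ↔ (h.arr .top v = x ∨ h.arr .top v = c₁ ∨ h.arr .top v = c₂) :=
    fun v => mem_arrSet.trans (hin v)
  have memA' : ∀ v, v ∈ A ↔ ((D.δ.symm v : Fin m) = x ∨
      ∃ z, D.tree.Adj x z ∧ h.arr .dead z = 1 ∧ v ∈ D.side z x) :=
    fun v => (memA v).trans (I.mem_inside N K v)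
  have hAside : ∀ p, IsParent D.tree r x p → A = sideSet D x p := fun p hp => by
    ext v; rw [memA', mem_sideSet, N.mem_side hp]
  have hAroot : x = r → A = Finset.univ := fun hxr => by
    ext v; rw [memA']; simpa using N.mem_root hxr v
  obtain ⟨hcan, hrk, hsmall⟩ := cover_spec H3
  have F4 : Frame coverCmd h3 (coverCmd.run h3) := Frame.run _ _
  have hcc := cover_cost H3 (k := k)
  set h4 := coverCmd.run h3 with hh4
  have H4 : Ctx G D.tree h4 := H3.frame F4 rfl
  rw [← hA] at hcan hrk hsmall hcc
  set C := arrSet n (h4.arr .inC) with hC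
  -- At the root the cut has rank one for trivial reasons; elsewhere `A` is a side of a tree edge
  -- and the width applies.
  have hCk : ¬ IsRankOne G A → C.card ≤ k := by
    intro hnr
    by_cases hxr : x = r
    · rw [hAroot hxr] at hnr
      exact absurd isRankOne_univ hnr
    · obtain ⟨p, hp⟩ := exists_isParent D.isTree hxr
      have h5 := card_le_sm hcan hnr
      rw [hAside p hp, coe_sideSet] at h5
      exact h5.trans ((D.sm_le G hp.1).trans hk)
  have q4 : coverCmd.cost h3 ≤ coverCost h3.P * 2 ^ k :=
    hcc fun hnr => ⟨C, hcan.cover, hCk hnr⟩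
  -- the table
  set X₁ := topSet n (h.arr .top) c₁ with hX₁
  set X₂ := topSet n (h.arr .top) c₂ with hX₂
  have hXA : ∀ c, (c = c₁ ∨ c = c₂) → topSet n (h.arr .top) c ⊆ A := fun c hc v hv => by
    rw [mem_topSet] at hv
    rw [memA, hv]
    exact Or.inr hc
  have ec1 : h4.var .c1 = c₁ := (F4.var .c1 rfl).trans (F3.var .c1 rfl)
  have ec2 : h4.var .c2 = c₂ := (F4.var .c2 rfl).trans (F3.var .c2 rfl)
  have et4 : h4.arr .top = h.arr .top := (F4.arr .top rfl).trans ((F3.arr .top rfl).trans et2)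
  have eA4 : h4.arr .inA = h3.arr .inA := F4.arr .inA rfl
  have Z4 : Frozen n A C X₁ X₂ h4 :=
    ⟨by rw [eA4], rfl, by rw [et4, ec1], by rw [et4, ec2]⟩
  have eR4 : h4.var .R = h.var .R := (F4.var .R rfl).trans ((F3.var .R rfl).trans
    ((F2.var .R rfl).trans (F1.var .R rfl)))
  have ecur4 : h4.cur 0 = h.var .R * (n + 1) := ((F4.cur 0 rfl).trans ((F3.cur 0 rfl).trans
    ((F2.cur 0 rfl).trans (F1.cur 0 rfl)))).trans J.cur
  have etab4 : h4.tab = h.tab := (F4.tab rfl).trans ((F3.tab rfl).trans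
    ((F2.tab rfl).trans (F1.tab rfl)))
  have ed4 : h4.arr .dead = h.arr .dead := (F4.arr .dead rfl).trans ((F3.arr .dead rfl).trans
    ((F2.arr .dead rfl).trans (F1.arr .dead rfl)))
  have ex4 : h4.var .x = x := (F4.var .x rfl).trans ((F3.var .x rfl).trans ex2)
  obtain ⟨b, hb⟩ : ∃ b : Bool, h4.var .rk = 1 ↔ b = true := ⟨decide (h4.var .rk = 1), by simp⟩
  obtain ⟨S, hS⟩ : ∃ S, S = maxCode b (h4.arr .inC) n + 1 := ⟨_, rfl⟩
  obtain ⟨⟨t1, t2, t3, t4, t5, t6⟩, t7⟩ :=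
    table_spec H4 Z4 (hXA c₁ (Or.inl rfl)) (hXA c₂ (Or.inr rfl)) hb eR4 ecur4 hS
  have F5 : Frame tableCmd h4 (tableCmd.run h4) := Frame.run _ _
  set h5 := tableCmd.run h4 with hh5
  have H5 : Ctx G D.tree h5 := H4.frame F5 rfl
  rw [etab4] at t3 t4
  rw [ec1, ec2, ex4] at t4
  -- For a missing child there are no vertices to replace; for a proper child its complete table is
  -- transferred to `A` by the exchange.
  have hrep : ∀ c, (c = c₁ ∨ c = c₂) →
      Replace G A C (topSet n (h.arr .top) c) h.tab (h.var .R) c := by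
    intro c hc
    rcases K.child c hc with rfl | ⟨hcm, ⟨_, hcm', hadj⟩, hdc⟩
    · have : topSet n (h.arr .top) c = ∅ := by
        ext v
        have := I.top_lt v
        simp only [mem_topSet, Finset.notMem_empty, iff_false]
        omega
      rw [this]
      exact replace_empty J.dummy
    · have hp := N.isParent hadj hdc
      have e : topSet n (h.arr .top) c = sideSet D ⟨c, hcm'⟩ x := by
        ext v
        rw [mem_topSet, mem_sideSet]
        exact I.top_dead v ⟨c, hcm'⟩ x hp hdc N.alive
      have := J.table ⟨c, hcm'⟩ x hp hdc N.alive
      rw [← e] at this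
      exact this.replace hcan (hXA c hc)
  have hcomp := table_complete hcan (M := h4.arr .inC) rfl (b := b)
    (fun hbt => ⟨hrk.1 (hb.2 hbt), hsmall (hb.2 hbt)⟩) (hXA c₁ (Or.inl rfl)) (hXA c₂ (Or.inr rfl))
    (hrep c₁ (Or.inl rfl)) (hrep c₂ (Or.inr rfl)) (tab' := h5.tab) (x := x)
    (by rw [← hS]; exact t4)
  rw [← hS] at hcomp
  have hSle : S ≤ (n + 1) * 2 ^ k := by
    rw [hS]
    refine maxCode_succ_le b _ fun hbf => hCk fun h6 => ?_
    have := hb.1 (hrk.2 h6)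
    rw [hbf] at this
    exact absurd this (by simp)
  -- the end of the round
  have hcl := close_spec H5 (by rw [F5.var .x rfl, ex4]; exact x.2)
  have F6 : Frame closeCmd h5 (closeCmd.run h5) := Frame.run _ _
  have q6 := closeCmd.cost_le_pcost rfl h5
  have erun : nodeCmd.run h = closeCmd.run h5 := rfl
  have ecost : nodeCmd.cost h = findCmd.cost h + (childrenCmd.cost h1 + (insideCmd.cost h2 +
    (coverCmd.cost h3 + (tableCmd.cost h4 + closeCmd.cost h5)))) := rfl
  rw [erun, ecost]
  set h6 := closeCmd.run h5 with hh6
  have ex5 : h5.var .x = x := (F5.var .x rfl).trans ex4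
  have ed5 : h5.arr .dead = h.arr .dead := (F5.arr .dead rfl).trans ed4
  have et5 : h5.arr .top = h.arr .top := (F5.arr .top rfl).trans et4
  have eA5 : h5.arr .inA = h3.arr .inA := (F5.arr .inA rfl).trans eA4
  rw [ex5, ed5, et5, eA5] at hcl
  have etab6 : h6.tab = h5.tab := F6.tab rfl
  have eR6 : h6.var .R = h.var .R + S := (F6.var .R rfl).trans t1
  have I6 : TreeInv D r (i + 1) h6 := by
    refine I.step hi N K ?_ hcl.2 fun v => ?_
    · rw [F6.var .r rfl, F5.var .r rfl, F4.var .r rfl, F3.var .r rfl, F2.var .r rfl, F1.var .r rfl]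
    · rw [hcl.1 v]
      have := hin v
      by_cases hv : h3.arr .inA v = 1
      · exact Or.inl ⟨this.1 hv, by rw [if_pos hv]⟩
      · exact Or.inr ⟨mt this.2 hv, by rw [if_neg hv]⟩
  refine ⟨⟨I6, ?_⟩, ?_⟩
  · refine ⟨fun y p hp hy hpa => ?_, ?_, ?_, ?_, ?_⟩
    · rw [etab6, eR6]
      rw [hcl.2, Function.update_apply] at hy hpa
      by_cases hyx : y = x
      · subst hyx
        rw [← hAside p hp]
        refine ⟨C, hcan, fun L => ?_⟩
        -- If `y` is a leaf of the tree, its only neighbour is the parent and `A` is at most a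
        -- single vertex. Otherwise every vertex of `A` lies below a child.
        obtain ⟨j, j1, j2, j3, j4⟩ := hcomp L (by
          by_cases hleaf : ∃ v, (D.δ.symm v : Fin m) = y
          · right
            obtain ⟨v, hv⟩ := hleaf
            refine partialCut_of_card_le_one hcan (Finset.card_le_one.2 ?_) L
            have hno : ∀ u, u ∈ A → u = v := by
              intro u hu
              rcases (memA' u).1 hu with h7 | ⟨z, h7, h8, -⟩
              · exact D.δ.symm.injective (Subtype.ext (h7.trans hv.symm))
              · have h9 : (D.tree.neighborSet y).encard ≤ 1 := by
                  rw [← hv]; exact (D.δ.symm v).2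
                rw [Set.encard_le_one_iff] at h9
                have := h9 z p h7 hp.1
                rw [this] at h8
                exact absurd h8 (N.parent p hp)
            intro u hu w hw
            rw [hno u hu, hno w hw]
          · left
            intro v hv
            rcases (memA v).1 hv with h7 | h7 | h7
            · exact absurd ((I.top_alive v y N.alive).1 h7) fun h8 => hleaf ⟨v, h8⟩
            · exact Or.inl (mem_topSet.2 h7)
            · exact Or.inr (Or.inl (mem_topSet.2 h7)))
        exact ⟨_, by omega, j2, j3, j4⟩
      · rw [if_neg fun h => hyx (Fin.ext h)] at hy
        have hpx : (p : ℕ) ≠ x := by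
          intro h7; rw [if_pos h7] at hpa; exact hpa rfl
        rw [if_neg hpx] at hpa
        exact (J.table y p hp hy hpa).mono (by omega) t3
    · obtain ⟨j, hj, hjm⟩ := J.dummy
      rw [etab6, eR6]
      exact ⟨j, by omega, (recSet_congr hj t3).1.trans hjm⟩
    · rw [F6.cur 0 rfl, t2, eR6]
    · rw [eR6]
      have := J.size
      have e : (i + 1) * ((n + 1) * 2 ^ k) = i * ((n + 1) * 2 ^ k) + (n + 1) * 2 ^ k := by ring
      omega
    · intro him
      have hxr := N.root.2 him
      have hAu := hAroot hxr
      have hC0 : C = ∅ := IsCanonical.univ_eq_empty (hAu ▸ hcan)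
      -- An empty cover leaves a single state, so the last record, which `best` and `bv` still hold,
      -- is the only one of the root.
      have hS1 : S = 1 := by
        have hr0 : rank (h4.arr .inC) n = 0 := by
          rw [rank_eq_card, ← hC, hC0]; rfl
        rw [hS]
        cases b <;> simp [maxCode, hr0]
      rw [F6.var .bv rfl, F6.arr .best rfl, t6, t5, hAu, hC0]
      refine ⟨partialCut_univ _, isMaxCut_of_complete v₀ fun L hL => ?_⟩
      -- Below no child there is only `v₀`, which is neither in `L` nor in the empty cover.
      obtain ⟨j, j1, j2, j3, j4⟩ := hcomp L (Or.inl fun v hv => by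
        rcases (memA v).1 hv with h7 | h7 | h7
        · have h8 := (I.top_alive v x N.alive).1 h7
          have : v = v₀ := D.δ.symm.injective (Subtype.ext (h8.trans (hxr.trans hr.symm)))
          rw [this, hC0]
          exact Or.inr (Or.inr ⟨hL, by simp⟩)
        · exact Or.inl (mem_topSet.2 h7)
        · exact Or.inr (Or.inl (mem_topSet.2 h7)))
      obtain rfl : j = 0 := by omega
      rw [hAu, hC0] at j4
      rw [hS1]
      exact j4
  · have p1 : h1.P = h.P := F1.P
    have p2 : h2.P = h.P := F2.P.trans p1
    have p3 : h3.P = h.P := F3.P.trans p2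
    have p4 : h4.P = h.P := F4.P.trans p3
    have p5 : h5.P = h.P := F5.P.trans p4
    rw [p1] at q2
    rw [p2] at q3
    rw [p3] at q4
    rw [p4] at t7
    rw [p5] at q6
    have hb1 := table_bound H.n_le H.m_le hi J.size hSle
    have hb2 := Nat.mul_le_mul_left (tableCost h.P) hb1
    have hpos : 1 ≤ 8 ^ k := Nat.one_le_pow _ _ (by omega)
    have h28 : 2 ^ k ≤ 8 ^ k := Nat.pow_le_pow_left (by omega) k
    have hb3 := Nat.mul_le_mul_left (coverCost h.P) h28
    rw [nodeCost]
    set a1 := findCmd.pcost h.P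
    set a2 := childrenCmd.pcost h.P
    set a3 := insideCmd.pcost h.P
    set a6 := closeCmd.pcost h.P
    have hb4 : a1 + a2 + a3 + a6 ≤ (a1 + a2 + a3 + a6) * 8 ^ k := Nat.le_mul_of_pos_right _ hpos
    have e : (a1 + a2 + a3 + coverCost h.P + tableCost h.P * (h.P * (h.P * h.P * (h.P * h.P))) +
        a6) * 8 ^ k = (a1 + a2 + a3 + a6) * 8 ^ k + coverCost h.P * 8 ^ k +
        tableCost h.P * (h.P * (h.P * h.P * (h.P * h.P)) * 8 ^ k) := by ring
    rw [e]
    omega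

end

/-! ### Input and output -/

section

variable {n m : ℕ} {G : SimpleGraph (Fin n)} {D : BranchDecomposition (Fin n) (Fin m)} {r : Fin m}
  {h h' : Store} {i k : ℕ}

theorem getD_flatMap {α : Type*} (f : α → List ℕ) (hf : ∀ a, (f a).length = n) (v : ℕ) (hv : v < n) :
    ∀ (l : List α) (u : ℕ) (hu : u < l.length),
      (l.flatMap f).getD (u * n + v) 0 = (f l[u]).getD v 0 := by
  intro l
  induction l with
  | nil => intro u hu; simp at hu
  | cons a l ih =>
    intro u hu
    rw [List.flatMap_cons]
    cases u with
    | zero => rw [List.getD_append _ _ _ _ (by rw [hf]; omega)]; simp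
    | succ u =>
      have e : (u + 1) * n + v = (u * n + v) + n := by ring
      rw [List.getD_append_right _ _ _ _ (by rw [hf]; omega), hf, e, Nat.add_sub_cancel,
        ih u (by simpa using hu)]
      simp

theorem length_encodeGraph (G : SimpleGraph (Fin n)) : (encodeGraph G).length = n * n := by
  simp [encodeGraph, List.length_flatMap]

theorem getD_encodeGraph (G : SimpleGraph (Fin n)) {u v : ℕ} (hu : u < n) (hv : v < n) :
    (encodeGraph G).getD (u * n + v) 0 = 1 ↔ NAdj G u v := by
  classical
  have h1 : u < (List.finRange n).length := by simpa using hu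
  rw [encodeGraph, getD_flatMap _ (by simp) v hv _ u h1, List.getD_eq_getElem _ _ (by simpa using hv)]
  simp only [List.getElem_map, List.getElem_finRange, NAdj, hu, hv, exists_true_left]
  split_ifs with hadj
  · exact iff_of_true rfl hadj
  · exact iff_of_false (by simp) hadj

theorem length_encodeInput (G : SimpleGraph (Fin n)) (D : BranchDecomposition (Fin n) (Fin m)) :
    (encodeInput G D).length = 2 + n * n + m * m + n := by
  simp [encodeInput, length_encodeGraph]
  omega

theorem encodeInput_eq (G : SimpleGraph (Fin n)) (D : BranchDecomposition (Fin n) (Fin m)) :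
    (encodeInput G D).getD 0 0 = n ∧ (encodeInput G D).getD 1 0 = m ∧
    (∀ u v, u < n → v < n → ((encodeInput G D).getD (2 + u * n + v) 0 = 1 ↔ NAdj G u v)) ∧
    (∀ x y, x < m → y < m →
      ((encodeInput G D).getD (2 + n * n + x * m + y) 0 = 1 ↔ NAdj D.tree x y)) ∧
    ∀ v : Fin n, (encodeInput G D).getD (2 + n * n + m * m + v) 0 = (D.δ.symm v : Fin m) := by
  have l1 : ([n, m] ++ encodeGraph G).length = 2 + n * n := by
    simp [length_encodeGraph]; omega
  have l2 : ([n, m] ++ encodeGraph G ++ encodeGraph D.tree).length = 2 + n * n + m * m := by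
    rw [List.length_append, l1, length_encodeGraph]
  refine ⟨rfl, rfl, fun u v hu hv => ?_, fun x y hx hy => ?_, fun v => ?_⟩
  · have := mul_add_lt hu hv
    rw [← getD_encodeGraph G hu hv, encodeInput, List.getD_append _ _ _ _ (by rw [l2]; omega),
      List.getD_append _ _ _ _ (by rw [l1]; omega),
      List.getD_append_right _ _ _ _ (by simp; omega)]
    simp only [List.length_cons, List.length_nil]
    rw [show 2 + u * n + v - (0 + 1 + 1) = u * n + v by omega]
  · have := mul_add_lt hx hy
    rw [← getD_encodeGraph D.tree hx hy, encodeInput, List.getD_append _ _ _ _ (by rw [l2]; omega),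
      List.getD_append_right _ _ _ _ (by rw [l1]; omega), l1,
      show 2 + n * n + x * m + y - (2 + n * n) = x * m + y by omega]
  · rw [encodeInput, List.getD_append_right _ _ _ _ (by rw [l2]; omega), l2, Nat.add_sub_cancel_left,
      List.getD_eq_getElem _ _ (by simp)]
    simp

theorem eval_io {e : Exp} {j : ℕ} (he : e.eval h = j) (hj : j < h.P) :
    (Exp.io e).eval h = h.io j := by
  subst he
  exact if_pos hj

/-- The initial store on input `l`. -/
def Store.init (l : List ℕ) : Store where
  P := l.length
  var := fun _ => 0
  arr := fun _ _ => 0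
  io := fun i => l.getD i 0
  tab := fun _ => 0
  cur := fun _ => 0

theorem init_spec (v₀ : Fin n) (hv₀ : (v₀ : ℕ) = 0) (hr : (D.δ.symm v₀ : Fin m) = r) :
    Ctx G D.tree (initCmd.run (Store.init (encodeInput G D))) ∧
    TreeInv D r 0 (initCmd.run (Store.init (encodeInput G D))) ∧
    TabInv G D r k 0 (initCmd.run (Store.init (encodeInput G D))) := by
  obtain ⟨i0, i1, i2, i3, i4⟩ := encodeInput_eq G D
  set h0 := Store.init (encodeInput G D) with hh0
  have hP0 : h0.P = 2 + n * n + m * m + n := length_encodeInput G D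
  have hn2 : n ≤ n * n := Nat.le_mul_self n
  have hm2 : m ≤ m * m := Nat.le_mul_self m
  have hn1 : 1 ≤ n := by have := v₀.2; omega
  have e1 : (Cmd.assign .n (.io (.lit 0))).run h0 = h0.setVar .n n := by
    rw [run_assign, eval_io (j := 0) rfl (by omega)]
    exact congrArg _ i0
  set h1 := h0.setVar .n n with hh1
  have e2 : (Cmd.assign .m (.io (.lit 1))).run h1 = h1.setVar .m m := by
    rw [run_assign, eval_io (h := h1) (j := 1) rfl (show 1 < h0.P by omega)]
    exact congrArg _ i1
  set h2 := h1.setVar .m m with hh2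
  have e3 : (Cmd.assign .tO (.add (.lit 2) (.mul (.var .n) (.var .n)))).run h2 =
      h2.setVar .tO (2 + n * n) := by
    rw [run_assign]
    simp only [Exp.eval]
    have : h2.P = h0.P := rfl
    have hv : h2.var .n = n := by simp [hh2, hh1]
    rw [hv, this, min_eq_left (a := n) (by omega), min_eq_left (by omega)]
  set h3 := h2.setVar .tO (2 + n * n) with hh3
  have e4 : (Cmd.assign .dO (.add (.var .tO) (.mul (.var .m) (.var .m)))).run h3 =
      h3.setVar .dO (2 + n * n + m * m) := by
    rw [run_assign]
    simp only [Exp.eval]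
    have : h3.P = h0.P := rfl
    have hv : h3.var .m = m := by simp [hh3, hh2]
    have hv' : h3.var .tO = 2 + n * n := by simp [hh3]
    rw [hv, hv', this, min_eq_left (a := m) (by omega), min_eq_left (by omega)]
  set h4 := h3.setVar .dO (2 + n * n + m * m) with hh4
  have e5 : (Cmd.assign .r (.io (.var .dO))).run h4 = h4.setVar .r r := by
    have hv : h4.var .dO = 2 + n * n + m * m := by simp [hh4]
    rw [run_assign, eval_io (h := h4) (e := .var .dO) (j := 2 + n * n + m * m) hv (show _ < h0.P by omega)]
    have := i4 v₀
    rw [hv₀, hr] at this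
    exact congrArg _ this
  set h5 := h4.setVar .r r with hh5
  have H5 : Ctx G D.tree h5 :=
    ⟨hP0, by simp [hh5, hh4, hh3, hh2, hh1], by simp [hh5, hh4, hh3, hh2],
      by simp [hh5, hh4, hh3], i2, i3⟩
  set c6 := setAll .top (.io (.add (.var .dO) (.var .v))) with hc6
  have F6 : Frame c6 h5 (c6.run h5) := Frame.run _ _
  set h6 := c6.run h5 with hh6
  have H6 : Ctx G D.tree h6 := H5.frame F6 rfl
  have etop : ∀ v : Fin n, h6.arr .top v = (D.δ.symm v : Fin m) := by
    intro v
    rw [hh6, hc6, setAll_arr H5 (fun v => (encodeInput G D).getD (2 + n * n + m * m + v) 0),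
      if_pos v.2, i4]
    intro j h7 hj F7
    have hd : h7.var .dO = 2 + n * n + m * m := (F7.var .dO rfl).trans (by simp [hh5, hh4])
    have hp : h7.P = 2 + n * n + m * m + n := F7.P.trans hP0
    have hio : h7.io = h0.io := F7.io rfl
    rw [eval_io (j := 2 + n * n + m * m + j) ?_ (by rw [Store.setVar_P']; omega), Store.setVar_io, hio]
    · rfl
    · simp only [Exp.eval, Store.setVar_var, reduceCtorEq, if_false, if_true, Store.setVar_P', hd]
      omega
  have eR6 : h6.var .R = 0 := (F6.var .R rfl).trans (by
    simp [hh5, hh4, hh3, hh2, hh1, hh0, Store.init])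
  have ec6 : h6.cur 0 = 0 * (n + 1) := (F6.cur 0 rfl).trans (by
    simp [hh5, hh4, hh3, hh2, hh1, hh0, Store.init])
  obtain ⟨w1, w2, -, w4, -⟩ := writeRec_spec H6 (e := .var .m) (f := .s) eR6 ec6
  have F7 : Frame (writeRec (.var .m) .s) h6 ((writeRec (.var .m) .s).run h6) := Frame.run _ _
  have erun : initCmd.run h0 = (writeRec (.var .m) .s).run h6 := by
    simp only [initCmd, run_seq, e1, e2, e3, e4, e5]
    rfl
  rw [erun]
  set h7 := (writeRec (.var .m) .s).run h6 with hh7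
  have ed7 : ∀ j, h7.arr .dead j = 0 := fun j => by
    rw [F7.arr .dead rfl, F6.arr .dead rfl]; rfl
  refine ⟨H6.frame F7 rfl, ⟨?_, ?_, ?_, ?_, ?_, ?_, ?_⟩, ⟨?_, ⟨0, by omega, ?_⟩, ?_, ?_, ?_⟩⟩
  · exact (F7.var .r rfl).trans ((F6.var .r rfl).trans (by simp [hh5]))
  · rw [Finset.card_eq_zero]; ext z; simp [ed7]
  · intro x y _ hy; rw [ed7] at hy; exact absurd hy (by simp)
  · intro _; rw [ed7]; simp
  · intro v; rw [F7.arr .top rfl, etop]; exact Fin.is_lt _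
  · intro v x _; rw [F7.arr .top rfl, etop, Fin.ext_iff]
  · intro v y p _ hy; rw [ed7] at hy; exact absurd hy (by simp)
  · intro y p _ hy; rw [ed7] at hy; exact absurd hy (by simp)
  · rw [w4]; exact H6.hm
  · rw [w2, w1]
  · rw [w1]; omega
  · intro hm0
    exact absurd r.2 (by omega)

theorem TreeInv.setVar (I : TreeInv D r i h) (x : Var) (j : ℕ) (hx : Var.r ≠ x) :
    TreeInv D r i (h.setVar x j) :=
  ⟨by simpa [hx] using I.root, I.card, I.closed, I.alive, I.top_lt, I.top_alive, I.top_dead⟩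

theorem TabInv.setVar (J : TabInv G D r k i h) (x : Var) (j : ℕ) (hx : Var.R ≠ x)
    (hx' : Var.bv ≠ x) : TabInv G D r k i (h.setVar x j) :=
  ⟨by simpa [hx] using J.table, by simpa [hx] using J.dummy, by simpa [hx] using J.cur,
    by simpa [hx] using J.size, by simpa [hx'] using J.final⟩

theorem loop_spec (H : Ctx G D.tree h) (I : TreeInv D r 0 h) (J : TabInv G D r k 0 h)
    (v₀ : Fin n) (hr : (D.δ.symm v₀ : Fin m) = r) (hk : D.smWidth G ≤ k) :
    TabInv G D r k m ((Cmd.loop .rnd (.var .m) nodeCmd).run h) ∧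
      (Cmd.loop .rnd (.var .m) nodeCmd).cost h ≤ 5 + h.P * (nodeCost h.P * 8 ^ k + 3) := by
  have key := cost_loop_le (x := .rnd) (c := nodeCmd) H.forM
    (fun i h' => TreeInv D r i h' ∧ TabInv G D r k i h') (B := nodeCost h.P * 8 ^ k) ⟨I, J⟩ (by
      intro i h1 hi F ⟨I1, J1⟩
      have H1 : Ctx G D.tree (h1.setVar .rnd i) := (H.frame F rfl).setVar _ _ rfl
      have := node_spec H1 (I1.setVar .rnd i (by simp)) (J1.setVar .rnd i (by simp) (by simp))
        (by simp) hi v₀ hr hk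
      rwa [show (h1.setVar .rnd i).P = h.P from F.P] at this)
  refine ⟨key.1.2, ?_⟩
  have k2 := key.2
  have : m * (nodeCost h.P * 8 ^ k + 3) ≤ h.P * (nodeCost h.P * 8 ^ k + 3) :=
    Nat.mul_le_mul_right _ (by have := H.m_le; omega)
  simp only [Exp.cost] at k2
  omega

theorem run_put (a e : Exp) : (Cmd.put a e).run h = if a.eval h < h.P then
    { h with io := Function.update h.io (a.eval h) (e.eval h) } else h := rfl

theorem output_spec (H : Ctx G D.tree h) :
    (∀ v, v < n → (outputCmd.run h).io v = if h.arr .best v = 1 then 1 else 0) ∧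
      (outputCmd.run h).io n = h.var .bv := by
  have hP := H.n_le
  set c : Cmd := .ite (isOne .best .v) (.put (.var .v) (.lit 1)) (.put (.var .v) (.lit 0))
    with hc
  have key := run_loop (x := .v) (c := c) H.forN
    (fun i h' => ∀ v, v < i → h'.io v = if h.arr .best v = 1 then 1 else 0) (by omega) ?_
  · have F : Frame (forV c) h ((forV c).run h) := Frame.run _ _
    have e : outputCmd.run h = (Cmd.put (.var .n) (.var .bv)).run ((forV c).run h) := rfl
    have e1 : ((forV c).run h).var .n = n := (F.var .n rfl).trans H.hn
    have e2 : ((forV c).run h).var .bv = h.var .bv := F.var .bv rfl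
    have e3 : ((forV c).run h).P = h.P := F.P
    rw [e, run_put]
    simp only [Exp.eval, e1, e2, e3]
    rw [if_pos (by omega)]
    refine ⟨fun v hv => ?_, by simp⟩
    have : ((forV c).run h).io v = _ := key v hv
    simp only [Function.update_of_ne (show v ≠ n by omega), this]
  · intro i h1 hi F ih v hv
    have ev : (h1.setVar .v i).var .v = i := by simp
    have hP1 : h1.P = h.P := F.P
    have hone := isOne_eval (h := h1.setVar .v i) (a := .best) (x := .v)
      (by rw [ev, Store.setVar_P', hP1]; omega)
    have eb : h1.arr .best = h.arr .best := F.arr .best rfl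
    rw [ev, Store.setVar_arr, eb] at hone
    rw [hc, run_ite]
    simp only [hone, run_put, Exp.eval, ev, Store.setVar_P', hP1]
    rw [if_pos (show i < h.P by omega), if_pos (show i < h.P by omega)]
    by_cases hvi : v = i
    · subst hvi
      split_ifs <;> simp
    · have := ih v (by omega)
      split_ifs <;> simp_all

/-- A bound for the running time, divided by `8 ^ k`. -/
def mainCost (P : ℕ) : ℕ :=
  initCmd.pcost P + (5 + P * (nodeCost P + 3)) + outputCmd.pcost P

theorem mainCost_polyBdd : PolyBdd mainCost :=
  ((Cmd.pcost_polyBdd _).add ((PolyBdd.const 5).add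
    (PolyBdd.id.mul (nodeCost_polyBdd.add (.const 3))))).add (Cmd.pcost_polyBdd _)

theorem main_spec (G : SimpleGraph (Fin n)) (D : BranchDecomposition (Fin n) (Fin m))
    (hk : D.smWidth G ≤ k) :
    (∃ W : Finset (Fin n), IsMaxCut G (W : Set (Fin n)) ∧
      (∀ v : Fin n, (mainCmd.run (Store.init (encodeInput G D))).io v = if v ∈ W then 1 else 0) ∧
      (mainCmd.run (Store.init (encodeInput G D))).io n = cutSize G (W : Set (Fin n))) ∧
    mainCmd.cost (Store.init (encodeInput G D)) ≤
      mainCost (2 + n * n + m * m + n) * 8 ^ k := by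
  have hn : 0 < n := by
    obtain ⟨v⟩ := D.nonempty
    exact v.pos
  set v₀ : Fin n := ⟨0, hn⟩ with hv₀
  obtain ⟨H1, I1, J1⟩ := init_spec (G := G) (k := k) (D := D) v₀ rfl rfl
  have q1 := initCmd.cost_le_pcost rfl (Store.init (encodeInput G D))
  have F1 : Frame initCmd (Store.init (encodeInput G D))
    (initCmd.run (Store.init (encodeInput G D))) := Frame.run _ _
  set h0 := Store.init (encodeInput G D) with hh0
  have hP0 : h0.P = 2 + n * n + m * m + n := length_encodeInput G D
  set h1 := initCmd.run h0 with hh1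
  obtain ⟨J2, q2⟩ := loop_spec H1 I1 J1 v₀ rfl hk
  set c2 : Cmd := .loop .rnd (.var .m) nodeCmd with hc2
  have F2 : Frame c2 h1 (c2.run h1) := Frame.run _ _
  set h2 := c2.run h1 with hh2
  have H2 : Ctx G D.tree h2 := H1.frame F2 rfl
  have hout := output_spec H2
  have q3 := outputCmd.cost_le_pcost rfl h2
  have erun : mainCmd.run h0 = outputCmd.run h2 := rfl
  have ecost : mainCmd.cost h0 = initCmd.cost h0 + (c2.cost h1 + outputCmd.cost h2) := rfl
  obtain ⟨f1, f2⟩ := J2.final rfl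
  rw [erun, ecost]
  refine ⟨⟨arrSet n (h2.arr .best), f2, fun v => ?_, hout.2.trans f1⟩, ?_⟩
  · rw [hout.1 v v.2]
    simp only [mem_arrSet]
  · have p1 : h1.P = h0.P := F1.P
    have p2 : h2.P = h0.P := F2.P.trans p1
    rw [p1, hP0] at q2
    rw [p2, hP0] at q3
    rw [hP0] at q1
    set P := 2 + n * n + m * m + n
    rw [mainCost]
    have hpos : 1 ≤ 8 ^ k := Nat.one_le_pow _ _ (by omega)
    set a1 := initCmd.pcost P
    set a3 := outputCmd.pcost P
    have r1 : a1 + 5 + P * 3 + a3 ≤ (a1 + 5 + P * 3 + a3) * 8 ^ k := Nat.le_mul_of_pos_right _ hpos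
    have r2 : (a1 + (5 + P * (nodeCost P + 3)) + a3) * 8 ^ k =
      (a1 + 5 + P * 3 + a3) * 8 ^ k + P * (nodeCost P * 8 ^ k) := by ring
    have r3 : P * (nodeCost P * 8 ^ k + 3) = P * (nodeCost P * 8 ^ k) + P * 3 := by ring
    omega

open RAM

/-- The program of the machine. -/
def maxCutProgram : Program :=
  .seq (.instr (.copy (creg 0) 0)) (.seq (.instr (.copy (creg 1) 0))
    (.seq (.instr (.copy (creg 2) 0)) (mainCmd.code 0)))

/-- The three copies put the heads on cell `P`, where the tape begins. All cells beyond the input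
are zero, as in the initial store. -/
theorem program_spec (l : List ℕ) : Ex maxCutProgram (State.init l)
    (3 + mainCmd.cost (Store.init l)) (Rel (mainCmd.run (Store.init l))) := by
  set s := (Instr.copy (creg 2) 0).apply ((Instr.copy (creg 1) 0).apply
    ((Instr.copy (creg 0) 0).apply (State.init l))) with hs
  have hrel : Rel (Store.init l) s := by
    refine ⟨?_, fun x => ?_, fun p => ?_, fun i _ => rfl, fun i => ?_, fun a i => ?_⟩
    · simp [hs, Instr.apply, creg, State.init, Store.init]
    · have h1 : ∀ p : Fin 3, vreg x ≠ creg p := fun p => by unfold vreg creg; omega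
      have h2 : vreg x ≠ 0 := by unfold vreg; omega
      simp [hs, Instr.apply, h1, State.init, Store.init, h2]
    · fin_cases p <;> simp [hs, Instr.apply, creg, State.init, Store.init]
    · show l.getD (l.length + 2 * i) 0 = 0
      exact List.getD_eq_default _ _ (by omega)
    · show l.getD (acell l.length a i) 0 = 0
      exact List.getD_eq_default _ _ (by unfold acell; omega)
  have h4 := (mainCmd.code_spec 0 hrel).mono le_rfl fun s' hs' => hs'.1
  have h3 : Ex maxCutProgram (State.init l) (1 + (1 + (1 + mainCmd.cost (Store.init l))))
      (Rel (mainCmd.run (Store.init l))) := by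
    refine Ex.seq (R := fun s' => s' = _) (Ex.instr rfl) ?_
    rintro _ rfl
    refine Ex.seq (R := fun s' => s' = _) (Ex.instr rfl) ?_
    rintro _ rfl
    refine Ex.seq (R := fun s' => s' = _) (Ex.instr rfl) ?_
    rintro _ rfl
    exact h4
  exact h3.mono (by omega) fun _ h => h

end

end Imp

end SMWidth

/-! ### The running time and the output of the machine -/

open SMWidth SMWidth.Imp SMWidth.RAM in
theorem mainTheorem2 :
    ∃ (p : SMWidth.RAM.Program) (c : ℕ),
      ∀ (n m k : ℕ) (G : SimpleGraph (Fin n)) (D : SMWidth.BranchDecomposition (Fin n) (Fin m)),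
        D.smWidth G = k →
          p.RunsInTime (SMWidth.encodeInput G D)
            {o | ∃ W : Set (Fin n), SMWidth.IsMaxCut G W ∧ o = SMWidth.encodeCut G W}
            (c * 8 ^ k * (n + m) ^ c) := by
  obtain ⟨a, b, hab⟩ := mainCost_polyBdd
  -- One constant serves as factor and as exponent: 3 steps for setting up the heads, `a * 3 ^ b`
  -- from `P + 1 ≤ 3 * (n + m) ^ 2`, and the exponent `2 * b` from the same estimate.
  refine ⟨maxCutProgram, 3 + a * 3 ^ b + 2 * b, ?_⟩
  intro n m k G D hk
  obtain ⟨⟨W, hW, h1, h2⟩, h3⟩ := main_spec G D hk.le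
  obtain ⟨s, t, hex, ht, hrel⟩ := program_spec (encodeInput G D)
  have hn : 1 ≤ n := by
    obtain ⟨v⟩ := D.nonempty
    exact v.pos
  have hm : 1 ≤ m := by
    obtain ⟨v⟩ := D.nonempty
    exact (D.δ.symm v : Fin m).pos
  have hP : (mainCmd.run (Store.init (encodeInput G D))).P = 2 + n * n + m * m + n :=
    (Frame.run _ _).P.trans (length_encodeInput G D)
  refine ⟨s, t, hex, ht.trans ?_, encodeCut G W, ⟨W, hW, rfl⟩, ?_⟩
  · set N := n + m with hN
    set c := 3 + a * 3 ^ b + 2 * b with hc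
    have hpos : 1 ≤ 8 ^ k := Nat.one_le_pow _ _ (by omega)
    -- Here `n` and `m` must be positive, which holds because a decomposition has a leaf.
    have hN2 : 2 + n * n + m * m + n + 1 ≤ 3 * N ^ 2 := by
      have e : N ^ 2 = n * n + m * m + 2 * (n * m) := by rw [hN]; ring
      have h4 : n ≤ n * m := Nat.le_mul_of_pos_right _ hm
      have h5 : 1 ≤ n * n := Nat.mul_pos hn hn
      have h6 : 1 ≤ m * m := Nat.mul_pos hm hm
      omega
    have h4 : mainCost (2 + n * n + m * m + n) ≤ a * 3 ^ b * N ^ (2 * b) := by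
      refine (hab _).trans ?_
      calc a * (2 + n * n + m * m + n + 1) ^ b ≤ a * (3 * N ^ 2) ^ b :=
            Nat.mul_le_mul_left _ (Nat.pow_le_pow_left hN2 b)
        _ = a * 3 ^ b * N ^ (2 * b) := by rw [mul_pow, ← pow_mul, mul_assoc]
    have h5 : N ^ (2 * b) ≤ N ^ c := Nat.pow_le_pow_right (by omega) (by omega)
    have h6 : 1 ≤ N ^ c := Nat.one_le_pow _ _ (by omega)
    calc 3 + mainCmd.cost (Store.init (encodeInput G D))
        ≤ 3 * (8 ^ k * N ^ c) + a * 3 ^ b * N ^ c * 8 ^ k := by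
          refine Nat.add_le_add ?_ (h3.trans ?_)
          · exact Nat.le_mul_of_pos_right _ (Nat.mul_pos hpos h6)
          · exact Nat.mul_le_mul_right _ (h4.trans (Nat.mul_le_mul_left _ h5))
      _ = (3 + a * 3 ^ b) * 8 ^ k * N ^ c := by ring
      _ ≤ c * 8 ^ k * N ^ c :=
          Nat.mul_le_mul_right _ (Nat.mul_le_mul_right _ (by omega))
  · intro i hi
    have hlen : (encodeCut G (W : Set (Fin n))).length = n + 1 := by simp [encodeCut]
    have hin : i < n + 1 := hlen ▸ hi
    rw [hrel.io i (by omega)]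
    by_cases hlt : i < n
    · rw [h1 ⟨i, hlt⟩]
      simp only [encodeCut]
      rw [List.getElem_append_left (by simpa using hlt)]
      simp
    · obtain rfl : i = n := by omega
      rw [h2]
      simp [encodeCut]
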